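/- Let $n\ge 3$ and let $W=(w_1,\dots,w_n)$, indices modulo $n$, be a closed polygon on the unit sphere $S^2\subset\mathbb{R}^3$ whose edges $w_iw_{i+1}$ are the shortest great circle arcs. $W$ is in general position if no three of its vertices lie on a common great circle, and simple if consecutive edges meet only in their common vertex and all other pairs of distinct edges are disjoint. A vector $\xi\in S^2$ is general for $W$ if $\langle\xi,w_i\rangle\neq 0$ for all $i$, and admissible for $W$ if $\langle\xi,w_i\rangle=0$ implies $\langle\xi,w_{i-1}\rangle\langle\xi,w_{i+1}\rangle<0$ for all $i$; thus general vectors are admissible. The critical point index of $W$ with respect to $\xi$ is $$i(W,\xi)=1-\#\{i:\langle\xi,w_i\rangle\le 0\}+\#\{i:\langle\xi,w_i\rangle\le 0\text{ and }\langle\xi,w_{i+1}\rangle\le 0\}.$$ For $W$ in general position, let $w_i'=\frac{w_i\times w_{i+1}}{\|w_i\times w_{i+1}\|}$ be the vertices of the polar polygon $W'$, again with shortest great circle arcs as edges. For a great circle arc $\gamma$ from $\xi$ to $-\xi$ that meets no vertex of $W'$, let $d(W',\gamma)$ be the sum of the signs of $\langle w_i'\times w_{i+1}',\xi\rangle$ over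 all $i$ such that the edge $w_i'w_{i+1}'$ intersects $\gamma$. If $\xi$ is admissible, then such arcs $\gamma$ exist and $d(W',\gamma)$ is the same for all of them; this common value is the normal degree $d(W,\xi)$. Let $W$ be a simple spherical polygon in general position and let $\xi\in S^2$ be admissible for $W$. Then $|d(W,\xi)|\le|i(W,\xi)|$, and $d(W,\xi)-i(W,\xi)$ is even. Conversely, for any two integers $i,d$ with $i<1$, $|d|\le|i|$ and $d-i$ even, there exist a simple spherical polygon $W$ in general position and a vector $\xi\in S^2$ that is general (hence admissible) for $W$ such that $i(W,\xi)=i$ and $d(W,\xi)=d$. -/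

import Mathlib

noncomputable section

/-- Euclidean three-space. -/
abbrev E3 : Type := EuclideanSpace ℝ (Fin 3)

/-- The unit sphere `S²` in Euclidean three-space. -/
abbrev S2 : Type := Metric.sphere (0 : E3) 1

namespace SphericalPolygon

/-- The cross product on Euclidean three-space. -/
def cross (u v : E3) : E3 :=
  WithLp.toLp 2 (crossProduct (WithLp.ofLp u) (WithLp.ofLp v))

/-- For unit vectors `u ≠ -v`, the (closed) shortest great circle arc connecting `u` and `v`:
the unit vectors in the cone spanned by `u` and `v`. -/
def arc (u v : E3) : Set E3 :=
  {x | ‖x‖ = 1 ∧ ∃ a b : ℝ, 0 ≤ a ∧ 0 ≤ b ∧ x = a • u + b • v}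

variable {n : ℕ}

/-- No three vertices lie on a common great circle, i.e. any three vertices (with distinct
indices) are linearly independent vectors. For `3 ≤ n` this implies that two vertices with
distinct indices are never equal or antipodal. -/
def InGeneralPosition (W : Fin n → S2) : Prop :=
  ∀ i j k : Fin n, i ≠ j → j ≠ k → i ≠ k →
    LinearIndependent ℝ ![(W i : E3), (W j : E3), (W k : E3)]

variable [NeZero n]

/-- The edge of the closed polygon `W` from the vertex `W i` to the vertex `W (i + 1)`, with
indices taken cyclically (addition in `Fin n` is modulo `n`). -/
def edge (W : Fin n → S2) (i : Fin n) : Set E3 :=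
  arc (W i) (W (i + 1))

/-- The polygon does not intersect itself: consecutive edges only share their common vertex, and
any two other distinct edges are disjoint. -/
def IsSimple (W : Fin n → S2) : Prop :=
  (∀ i : Fin n, edge W i ∩ edge W (i + 1) = {(W (i + 1) : E3)}) ∧
    ∀ i j : Fin n, i ≠ j → j ≠ i + 1 → i ≠ j + 1 → Disjoint (edge W i) (edge W j)

/-- `ξ` is general for `W`: no vertex of `W` lies on the great circle with pole `ξ`. -/
def IsGeneral (W : Fin n → S2) (ξ : S2) : Prop :=
  ∀ i : Fin n, inner ℝ (ξ : E3) (W i : E3) ≠ 0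

/-- `ξ` is admissible for `W`: whenever a vertex of `W` lies on the great circle with pole `ξ`,
its two neighbours lie strictly on different sides of that great circle. -/
def IsAdmissible (W : Fin n → S2) (ξ : S2) : Prop :=
  ∀ i : Fin n, inner ℝ (ξ : E3) (W i : E3) = 0 →
    inner ℝ (ξ : E3) (W (i - 1) : E3) * inner ℝ (ξ : E3) (W (i + 1) : E3) < 0

theorem IsGeneral.isAdmissible {W : Fin n → S2} {ξ : S2} (h : IsGeneral W ξ) :
    IsAdmissible W ξ :=
  fun i hi => absurd hi (h i)

open Classical in
/-- The critical point index of `W` with respect to `ξ`: the index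
`1 - ∑ₑ A(e) + ∑_f A(f)` of the apex `0` of the cone over `W`. The edges of the cone at the apex
are the segments from `0` to `W i`, its faces the triangles `0, W i, W (i + 1)`, and `A` is `1` if
the height function `⟨ξ, ·⟩` is maximal at the apex on that edge or face, and `0` otherwise. -/
def index (W : Fin n → S2) (ξ : S2) : ℤ :=
  1 - ∑ i : Fin n, (if inner ℝ (ξ : E3) (W i : E3) ≤ 0 then 1 else 0)
    + ∑ i : Fin n, (if inner ℝ (ξ : E3) (W i : E3) ≤ 0 ∧ inner ℝ (ξ : E3) (W (i + 1) : E3) ≤ 0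
        then 1 else 0)

/-- The `i`-th vertex of the polar polygon of `W`, the normalized cross product of `W i` and
`W (i + 1)`. -/
def polar (W : Fin n → S2) (i : Fin n) : E3 :=
  ‖cross (W i) (W (i + 1))‖⁻¹ • cross (W i) (W (i + 1))

/-- The edge of the polar polygon from its `i`-th to its `(i + 1)`-st vertex. -/
def polarEdge (W : Fin n → S2) (i : Fin n) : Set E3 :=
  arc (polar W i) (polar W (i + 1))

/-- The great circle arc from `ξ` to `-ξ` through `η`, where `η` is a unit vector orthogonal to
`ξ`. Every great circle arc from `ξ` to `-ξ` is of this form for exactly one `η`. -/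
def meridian (ξ : S2) (η : S2) : Set E3 :=
  {x | ‖x‖ = 1 ∧ ∃ a b : ℝ, 0 ≤ b ∧ x = a • (ξ : E3) + b • (η : E3)}

/-- `η` is orthogonal to `ξ`, and the great circle arc from `ξ` to `-ξ` through `η` meets no
vertex of the polar polygon of `W`. -/
def IsMeridian (W : Fin n → S2) (ξ η : S2) : Prop :=
  inner ℝ (ξ : E3) (η : E3) = 0 ∧ ∀ i : Fin n, polar W i ∉ meridian ξ η

open Classical in
/-- The degree of the polar polygon of `W` along the great circle arc from `ξ` to `-ξ` through
`η`: the number of edges of the polar polygon that meet the arc, each counted with the sign of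
`⟨w'ᵢ × w'ᵢ₊₁, ξ⟩`. -/
def degreeAlong (W : Fin n → S2) (ξ η : S2) : ℤ :=
  ∑ i : Fin n, if (polarEdge W i ∩ meridian ξ η).Nonempty
    then (SignType.sign (inner ℝ (cross (polar W i) (polar W (i + 1))) (ξ : E3)) : ℤ) else 0

/-- The normal degree of `W` with respect to `ξ` is (well defined and) equal to `d`: there are
great circle arcs from `ξ` to `-ξ` that meet no vertex of the polar polygon, and the degree of the
polar polygon along every such arc equals `d`. At most one integer `d` has this property. -/
def HasNormalDegree (W : Fin n → S2) (ξ : S2) (d : ℤ) : Prop :=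
  (∃ η : S2, IsMeridian W ξ η) ∧ ∀ η : S2, IsMeridian W ξ η → degreeAlong W ξ η = d

end SphericalPolygon

end

/-! Use coordinates in `ℂ × ℝ` whose height axis is `ξ`. The horizontal part of `w_i × w_{i+1}` is
`Complex.I` times `secant`. For positive heights the secant is a positive multiple of an edge vector
of the central projection of `W` to the plane of height one, and it does not change when both
vectors are negated. Seen along `ξ`, the polar polygon is therefore the tangent indicatrix of the
projected polygon, up to a quarter turn and positive factors. Admissibility excludes half turns, so
`2π d` is the sum of the turning angles `turn` (`degreeAlong_eq`). The index equals `1 - ups`, where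
`ups` counts the edges that rise through height zero (`index_eq`).

The bound is an Umlaufsatz in the style of Hopf. For disjoint edges in the closed upper half space,
the directions from points of one to points of the other lie in an open half plane. Hence the change
of secant direction is a discrete closed one-form on pairs `i < j`, and the sum along the diagonal,
which is the total turning, can be moved to the other sides of the triangle
(`sum_diagonal_eq_sum_sides`). A run above or below height zero enters from infinity and leaves to
infinity, and turns by less than `π` (`IsPolygon.abs_sum_turn_lt`). There are as many rises as
descents, so `|d| < ups` as soon as there is a rise. A polygon on one side turns by less than `4π`,
so `|d| ≤ 1`.

For the parity, `d` is written as a signed number of crossings of the negative real axis and reduced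
modulo two to sign bits of determinants. The same summation over pairs, now with values in `ZMod 2`,
evaluates the resulting corner sum (`IsPolygon.sum_corner`). This needs generic position. A twist
and a small shear reach it, and the admissible case follows because the allowed values of the
turning form a closed set (`IsPolygon.turn_parity`).

For the converse, a zigzag with vertices plus or minus points of the moment curve is used. Each of
its `k` left waves contributes `-1` and each of its `l` right waves `+1` to the degree, which gives
`d = l - k` and `i = -(k + l)`. Signs in Vandermonde-type relations show that it is simple. -/

noncomputable section
namespace SphericalPolygon

/-! ### Arguments of complex numbers in a common open half plane. -/

/-- Three complex numbers that lie in a common open half plane, expressed by the absence of a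
nontrivial nonnegative relation. -/
def Pointed (a b c : ℂ) : Prop :=
  ∀ α β γ : ℝ, 0 ≤ α → 0 ≤ β → 0 ≤ γ → α * a + β * b + γ * c = 0 → α = 0 ∧ β = 0 ∧ γ = 0

theorem Pointed.ne_zero_left {a b c : ℂ} (h : Pointed a b c) : a ≠ 0 := by
  rintro rfl
  have := h 1 0 0 (by norm_num) le_rfl le_rfl (by simp)
  simp at this

theorem Pointed.ne_zero_mid {a b c : ℂ} (h : Pointed a b c) : b ≠ 0 := by
  rintro rfl
  have := h 0 1 0 le_rfl (by norm_num) le_rfl (by simp)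
  simp at this

theorem Pointed.ne_zero_right {a b c : ℂ} (h : Pointed a b c) : c ≠ 0 := by
  rintro rfl
  have := h 0 0 1 le_rfl le_rfl (by norm_num) (by simp)
  simp at this

theorem Pointed.div {a b c : ℂ} (h : Pointed a b c) : Pointed 1 (b / a) (c / a) := by
  intro α β γ hα hβ hγ e
  refine h α β γ hα hβ hγ ?_
  have ha := h.ne_zero_left
  have : (α * a + β * b + γ * c : ℂ) = a * (α * 1 + β * (b / a) + γ * (c / a)) := by
    field_simp
  rw [this, e, mul_zero]

theorem Pointed.conj {a b c : ℂ} (h : Pointed a b c) :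
    Pointed (starRingEnd ℂ a) (starRingEnd ℂ b) (starRingEnd ℂ c) := by
  intro α β γ hα hβ hγ e
  refine h α β γ hα hβ hγ ?_
  have := congrArg (starRingEnd ℂ) e
  simpa using this

theorem arg_eq_pi_absurd {z : ℂ} {γ : Prop} (h : z.arg = Real.pi)
    (k : ∀ t : ℝ, 0 < t → z = -(t : ℂ) → γ) : γ := by
  rw [Complex.arg_eq_pi_iff] at h
  exact k (-z.re) (by linarith) (by apply Complex.ext <;> simp [h.2])

/-- If the sum reached `π`, both arguments would lie in `(0, π)` and `c` would have imaginary part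
at most zero. Then `1`, `b`, `c` surround the origin, and Cramer's rule gives a forbidden
nonnegative relation. -/
theorem Pointed.arg_add_lt_pi {b c : ℂ} (h : Pointed 1 b c) :
    b.arg + (c / b).arg < Real.pi := by
  by_contra! hS
  have hb := h.ne_zero_mid
  have hc := h.ne_zero_right
  have hb1 : b.arg < Real.pi := by
    refine lt_of_le_of_ne (Complex.arg_le_pi b) fun e => ?_
    refine arg_eq_pi_absurd e fun t ht hbt => ?_
    have := h t 1 0 ht.le (by norm_num) le_rfl (by simp [hbt])
    simp at this
  have hc1 : (c / b).arg < Real.pi := by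
    refine lt_of_le_of_ne (Complex.arg_le_pi _) fun e => ?_
    refine arg_eq_pi_absurd e fun t ht hbt => ?_
    rw [div_eq_iff hb] at hbt
    have := h 0 t 1 le_rfl ht.le (by norm_num) (by simp [hbt])
    simp at this
  have hb0 : 0 < b.arg := by linarith
  have hc0 : 0 < (c / b).arg := by linarith
  have e1 := Complex.norm_mul_cos_arg b
  have e2 := Complex.norm_mul_sin_arg b
  have e3 := Complex.norm_mul_cos_arg (c / b)
  have e4 := Complex.norm_mul_sin_arg (c / b)
  have p1 : 0 < ‖b‖ := norm_pos_iff.mpr hb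
  have p2 : 0 < ‖c / b‖ := norm_pos_iff.mpr (div_ne_zero hc hb)
  have s1 := Real.sin_pos_of_pos_of_lt_pi hb0 hb1
  have s2 := Real.sin_pos_of_pos_of_lt_pi hc0 hc1
  have s3 : Real.sin (b.arg + (c / b).arg) ≤ 0 := by
    have := Real.sin_nonneg_of_nonneg_of_le_pi (x := b.arg + (c / b).arg - Real.pi)
      (by linarith) (by linarith)
    rw [Real.sin_sub_pi] at this
    linarith
  rw [Real.sin_add] at s3
  obtain ⟨z, hz⟩ : ∃ z, z = c / b := ⟨_, rfl⟩
  have hcz : c = b * z := by rw [hz]; field_simp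
  rw [← hz] at e3 e4 p2 s2 s3
  have bi : 0 < b.im := by rw [← e2]; positivity
  have zi : 0 < z.im := by rw [← e4]; positivity
  have ci : b.im * z.re + b.re * z.im ≤ 0 := by
    rw [← e1, ← e2, ← e3, ← e4]
    have : 0 ≤ ‖b‖ * ‖z‖ := by positivity
    nlinarith
  -- With `c = b * z`, these are the coefficients `wedge b c`, `-c.im`, `b.im` of the linear
  -- relation between `1`, `b`, `c`.
  have := h ((b.re * b.re + b.im * b.im) * z.im) (-(b.im * z.re + b.re * z.im)) b.im
    (mul_nonneg (by nlinarith [sq_nonneg b.re, sq_nonneg b.im]) zi.le)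
    (by linarith) bi.le (by
      rw [hcz]
      apply Complex.ext <;> simp <;> ring)
  exact bi.ne' this.2.2

theorem arg_conj_of_pointed {z : ℂ} (h : z.arg ≠ Real.pi) :
    (starRingEnd ℂ z).arg = -z.arg := by
  rw [Complex.arg_conj, if_neg h]

theorem Pointed.abs_arg_add_lt {b c : ℂ} (h : Pointed 1 b c) :
    |b.arg + (c / b).arg| < Real.pi := by
  have hb := h.ne_zero_mid
  rw [abs_lt]
  refine ⟨?_, h.arg_add_lt_pi⟩
  have h2 := h.conj
  rw [map_one] at h2
  have := h2.arg_add_lt_pi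
  rw [← map_div₀, arg_conj_of_pointed, arg_conj_of_pointed] at this
  · linarith
  · intro e
    refine arg_eq_pi_absurd e fun t ht hbt => ?_
    rw [div_eq_iff hb] at hbt
    have := h 0 t 1 le_rfl ht.le (by norm_num) (by simp [hbt])
    simp at this
  · intro e
    refine arg_eq_pi_absurd e fun t ht hbt => ?_
    have := h t 1 0 ht.le (by norm_num) le_rfl (by simp [hbt])
    simp at this

/-- Within an open half plane no multiple of `2π` is lost when principal arguments are added. This
additivity makes the change of secant direction a closed one-form. -/
theorem Pointed.arg_div_add_arg_div {a b c : ℂ} (h : Pointed a b c) :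
    (b / a).arg + (c / b).arg = (c / a).arg := by
  have ha := h.ne_zero_left
  have hb := h.ne_zero_mid
  have hc := h.ne_zero_right
  have h1 := h.div.abs_arg_add_lt
  have e : c / a / (b / a) = c / b := by field_simp
  rw [e, abs_lt] at h1
  have e2 : c / a = b / a * (c / b) := by field_simp
  rw [e2, (Complex.arg_mul_eq_add_arg_iff (div_ne_zero hb ha) (div_ne_zero hc hb)).2]
  exact ⟨h1.1, h1.2.le⟩

theorem Pointed.abs_arg_div_lt {a b c : ℂ} (h : Pointed a b c) :
    |(c / a).arg| < Real.pi := by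
  rw [← h.arg_div_add_arg_div]
  have h1 := h.div.abs_arg_add_lt
  have ha := h.ne_zero_left
  have hb := h.ne_zero_mid
  have e : c / a / (b / a) = c / b := by field_simp
  rwa [e] at h1

/-! ### Crossings of the negative real axis. -/

/-- The planar cross product of two complex numbers. -/
def wedge (a b : ℂ) : ℝ := a.re * b.im - a.im * b.re

open Classical in
/-- The signed number of crossings of the negative real axis by a segment from `a` to `b`. -/
def crossing (a b : ℂ) : ℤ :=
  if 0 < a.im ∧ b.im < 0 ∧ 0 < wedge a b then 1
  else if a.im < 0 ∧ 0 < b.im ∧ wedge a b < 0 then -1 else 0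

theorem wedge_eq (a b : ℂ) : wedge a b = ‖a‖ * ‖b‖ * Real.sin (b.arg - a.arg) := by
  rw [Real.sin_sub, wedge, ← Complex.norm_mul_cos_arg a, ← Complex.norm_mul_sin_arg a,
    ← Complex.norm_mul_cos_arg b, ← Complex.norm_mul_sin_arg b]
  ring

theorem arg_div_eq_of_mem {a b : ℂ} (ha : a ≠ 0) (hb : b ≠ 0) (n : ℤ)
    (h : b.arg - a.arg + 2 * Real.pi * n ∈ Set.Ioc (-Real.pi) Real.pi) :
    (b / a).arg = b.arg - a.arg + 2 * Real.pi * n := by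
  have e : ((b / a).arg : Real.Angle) = ((b.arg - a.arg + 2 * Real.pi * n : ℝ) : Real.Angle) := by
    rw [Complex.arg_div_coe_angle hb ha, Real.Angle.coe_add, Real.Angle.coe_sub]
    have : ((2 * Real.pi * n : ℝ) : Real.Angle) = 0 := by
      rw [Real.Angle.coe_eq_zero_iff]
      exact ⟨n, by simp; ring⟩
    rw [this, add_zero]
  have e2 := congrArg Real.Angle.toReal e
  rwa [Complex.arg_coe_angle_toReal_eq_arg, Real.Angle.toReal_coe_eq_self_iff_mem_Ioc.2 h] at e2

theorem wedge_ne_zero_of_slit {a b : ℂ} (ha : a.im ≠ 0) (hab : b / a ∈ Complex.slitPlane)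
    (h : a.im * b.im < 0) : wedge a b ≠ 0 := by
  intro hw
  have ha0 : a ≠ 0 := by rintro rfl; simp at ha
  have hb : b = ((b.im / a.im : ℝ) : ℂ) * a := by
    unfold wedge at hw
    apply Complex.ext
    · simp; field_simp; linarith
    · simp; field_simp
  rw [hb, mul_div_assoc, div_self ha0, mul_one, Complex.ofReal_mem_slitPlane] at hab
  rcases lt_or_gt_of_ne ha with h1 | h1
  · have := div_neg_of_pos_of_neg (a := b.im) (b := a.im) (by nlinarith) h1
    linarith
  · have := div_neg_of_neg_of_pos (a := b.im) (b := a.im) (by nlinarith) h1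
    linarith

theorem abs_arg_lt_pi_of_slit {a : ℂ} (ha : a ∈ Complex.slitPlane) : |a.arg| < Real.pi := by
  rw [Complex.mem_slitPlane_iff_arg] at ha
  rw [abs_lt]
  exact ⟨Complex.neg_pi_lt_arg a, lt_of_le_of_ne (Complex.arg_le_pi a) ha.1⟩

/-- The correction to the difference of arguments is nonzero exactly when that difference leaves
`(-π, π)`. This requires imaginary parts of opposite sign, and then the sign of `wedge a b`, that is
of the sine of the difference, decides. -/
theorem arg_div_eq_crossing {a b : ℂ} (ha : a ∈ Complex.slitPlane) (hb : b ∈ Complex.slitPlane)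
    (hab : b / a ∈ Complex.slitPlane) :
    (b / a).arg = b.arg - a.arg + 2 * Real.pi * crossing a b := by
  have ha0 := Complex.slitPlane_ne_zero ha
  have hb0 := Complex.slitPlane_ne_zero hb
  refine arg_div_eq_of_mem ha0 hb0 _ ?_
  have na : 0 < ‖a‖ := norm_pos_iff.mpr ha0
  have nb : 0 < ‖b‖ := norm_pos_iff.mpr hb0
  have ba := abs_lt.1 (abs_arg_lt_pi_of_slit ha)
  have bb := abs_lt.1 (abs_arg_lt_pi_of_slit hb)
  have hw := wedge_eq a b
  have hn : 0 < ‖a‖ * ‖b‖ := by positivity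
  unfold crossing
  by_cases h1 : 0 < a.im ∧ b.im < 0
  · have w0 := wedge_ne_zero_of_slit h1.1.ne' hab (by nlinarith [h1.1, h1.2])
    have a1 : 0 ≤ a.arg := Complex.arg_nonneg_iff.2 h1.1.le
    have b1 : b.arg < 0 := Complex.arg_neg_iff.2 h1.2
    by_cases h2 : 0 < wedge a b
    · rw [if_pos ⟨h1.1, h1.2, h2⟩]
      have : b.arg - a.arg < -Real.pi := by
        by_contra! hc
        have := Real.sin_nonpos_of_nonpos_of_neg_pi_le (x := b.arg - a.arg) (by linarith) hc
        nlinarith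
      constructor <;> push_cast <;> linarith
    · rw [if_neg (by tauto), if_neg (by intro h; linarith [h.1, h1.1])]
      have : -Real.pi < b.arg - a.arg := by
        by_contra! hc
        have := Real.sin_nonneg_of_nonneg_of_le_pi (x := b.arg - a.arg + 2 * Real.pi)
          (by linarith) (by linarith)
        rw [Real.sin_add_two_pi] at this
        have : 0 ≤ wedge a b := by rw [hw]; positivity
        exact h2 (lt_of_le_of_ne this w0.symm)
      constructor <;> push_cast <;> linarith [Real.pi_pos]
  by_cases h2 : a.im < 0 ∧ 0 < b.im
  · have w0 := wedge_ne_zero_of_slit h2.1.ne hab (by nlinarith [h2.1, h2.2])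
    have a1 : a.arg < 0 := Complex.arg_neg_iff.2 h2.1
    have b1 : 0 ≤ b.arg := Complex.arg_nonneg_iff.2 h2.2.le
    rw [if_neg (by tauto)]
    by_cases h3 : wedge a b < 0
    · rw [if_pos ⟨h2.1, h2.2, h3⟩]
      have : Real.pi < b.arg - a.arg := by
        by_contra! hc
        have := Real.sin_nonneg_of_nonneg_of_le_pi (x := b.arg - a.arg) (by linarith) hc
        nlinarith
      constructor <;> push_cast <;> linarith
    · rw [if_neg (by tauto)]
      have : b.arg - a.arg < Real.pi := by
        by_contra! hc
        have := Real.sin_nonneg_of_nonneg_of_le_pi (x := b.arg - a.arg - Real.pi)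
          (by linarith) (by linarith)
        rw [Real.sin_sub_pi] at this
        have : wedge a b ≤ 0 := by rw [hw]; nlinarith
        exact h3 (lt_of_le_of_ne this w0)
      constructor <;> push_cast <;> linarith [Real.pi_pos]
  rw [if_neg (by tauto), if_neg (by tauto)]
  have key : (0 ≤ a.arg ∧ 0 ≤ b.arg) ∨ (a.arg ≤ 0 ∧ b.arg ≤ 0) := by
    have z (c : ℂ) (hc : c ∈ Complex.slitPlane) (h : c.im = 0) : c.arg = 0 := by
      rw [Complex.arg_eq_zero_iff]
      rcases hc with hc | hc
      · exact ⟨hc.le, h⟩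
      · exact absurd h hc
    rcases lt_trichotomy a.im 0 with h | h | h
    · right
      refine ⟨(Complex.arg_neg_iff.2 h).le, ?_⟩
      rcases lt_trichotomy b.im 0 with k | k | k
      · exact (Complex.arg_neg_iff.2 k).le
      · exact (z b hb k).le
      · tauto
    · rw [z a ha h]
      rcases le_total 0 b.arg with k | k <;> simp [k]
    · left
      refine ⟨Complex.arg_nonneg_iff.2 h.le, ?_⟩
      rcases lt_trichotomy b.im 0 with k | k | k
      · tauto
      · exact (z b hb k).ge
      · exact Complex.arg_nonneg_iff.2 k.le
  rcases key with k | k <;> constructor <;> push_cast <;> linarith [Real.pi_pos]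

-- This matches the combinatorial crossing number with the form used in `degreeAlong`: the cone over
-- the segment must contain a negative real number, and the orientation of the segment gives the
-- sign.
open Classical in
theorem crossing_eq_sign {a b : ℂ} (ha : a ∈ Complex.slitPlane) (hb : b ∈ Complex.slitPlane) :
    crossing a b = if ∃ α β ρ : ℝ, 0 ≤ α ∧ 0 ≤ β ∧ 0 < ρ ∧ (α * a + β * b : ℂ) = -ρ
      then (SignType.sign (wedge a b) : ℤ) else 0 := by
  split_ifs with h
  · obtain ⟨α, β, ρ, hα, hβ, hρ, e⟩ := h
    have er := congrArg Complex.re e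
    have ei := congrArg Complex.im e
    simp at er ei
    have key (c : ℂ) (hc : c ∈ Complex.slitPlane) (t : ℝ) (ht : 0 ≤ t) (h1 : t * c.re = -ρ)
        (h2 : t * c.im = 0) : False := by
      have : t ≠ 0 := by rintro rfl; simp at h1; linarith
      have t0 : 0 < t := lt_of_le_of_ne ht this.symm
      rcases hc with hc | hc
      · nlinarith
      · exact (mul_ne_zero this hc) h2
    have α0 : 0 < α := by
      refine lt_of_le_of_ne hα ?_
      rintro rfl
      simp at er ei
      exact key b hb β hβ er (by simpa using ei)
    have β0 : 0 < β := by
      refine lt_of_le_of_ne hβ ?_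
      rintro rfl
      simp at er ei
      exact key a ha α hα er (by simpa using ei)
    have c1 : β * wedge a b = a.im * ρ := by
      unfold wedge
      linear_combination a.re * ei - a.im * er
    unfold crossing
    rcases lt_trichotomy a.im 0 with h | h | h
    · have hb1 : 0 < b.im := by
        by_contra! hc
        nlinarith
      have w : wedge a b < 0 := by
        by_contra! hc
        nlinarith [mul_nonneg hβ hc]
      rw [if_neg (by intro h; linarith [h.1]), if_pos ⟨h, hb1, w⟩, sign_neg w]
      rfl
    · exfalso
      have hb1 : b.im = 0 := by
        rw [h] at ei; simp at ei; rcases ei with ei | ei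
        · exact absurd ei β0.ne'
        · exact ei
      have a1 : 0 < a.re := by rcases ha with k | k; exacts [k, absurd h k]
      have b1 : 0 < b.re := by rcases hb with k | k; exacts [k, absurd hb1 k]
      nlinarith [mul_pos α0 a1, mul_pos β0 b1]
    · have hb1 : b.im < 0 := by
        by_contra! hc
        nlinarith [mul_nonneg hβ hc, mul_pos α0 h]
      have w : 0 < wedge a b := by
        by_contra! hc
        nlinarith [mul_pos h hρ]
      rw [if_pos ⟨h, hb1, w⟩, sign_pos w]
      rfl
  · unfold crossing
    rw [if_neg, if_neg]
    · rintro ⟨h1, h2, h3⟩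
      refine h ⟨b.im, -a.im, -wedge a b, h2.le, by linarith, by linarith, ?_⟩
      apply Complex.ext
      · simp [wedge]; ring
      · simp; ring
    · rintro ⟨h1, h2, h3⟩
      refine h ⟨-b.im, a.im, wedge a b, by linarith, h1.le, h3, ?_⟩
      apply Complex.ext
      · simp [wedge]; ring
      · simp; ring

end SphericalPolygon
end

/-! ### Summation over pairs of indices, and polygonal cones in `ℂ × ℝ`. -/

noncomputable section
namespace SphericalPolygon

/-- Summing a discrete closed one-form on the grid of pairs `i < j` along the diagonal and along
the other two sides of the triangle gives the same result. -/
theorem sum_diagonal_eq_sum_sides {A : Type*} [AddCommGroup A] (R C : ℕ → ℕ → A) (D : ℕ → A)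
    (M : ℕ)
    (tri : ∀ k, k ≤ M → R k (k + 1) + C k (k + 2) = D k)
    (sq : ∀ i j, i + 2 ≤ j → j ≤ M + 1 → (i = 0 → j ≤ M) →
      R i j + C i (j + 1) = C i j + R (i + 1) j) :
    ∑ k ∈ Finset.range (M + 1), D k =
      ∑ j ∈ Finset.range M, R 0 (j + 1) + (if M = 0 then D 0 else C 0 (M + 1) + R 1 (M + 1)) +
        ∑ i ∈ Finset.range M, C (i + 1) (M + 2) := by
  rcases Nat.eq_zero_or_pos M with rfl | hM
  · simp
  rw [if_neg hM.ne']
  -- Pushing the path from row `i` to row `i + 1`, one square at a time. The square at `(0, M + 1)`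
  -- is never used; for a closed polygon with `M + 2` edges it would compare adjacent edges.
  have G : ∀ i j, i + 2 ≤ j → j ≤ M + 2 → (i = 0 → j ≤ M + 1) →
      ∑ k ∈ Finset.range (i + 1), D k + ∑ l ∈ Finset.Ico (i + 2) j, R (i + 1) l =
        ∑ k ∈ Finset.range i, D k + ∑ l ∈ Finset.Ico (i + 1) j, R i l + C i j := by
    intro i j hij
    induction j, hij using Nat.le_induction with
    | base =>
      intro hj _
      rw [Finset.sum_range_succ, ← tri i (by omega)]
      simp [add_assoc]
    | succ j hij ih =>
      intro hj h0
      rw [Finset.sum_Ico_succ_top (by omega), Finset.sum_Ico_succ_top (by omega), ← add_assoc,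
        ih (by omega) (by omega)]
      have := sq i j hij (by omega) (by omega)
      rw [add_assoc, ← this]
      abel
  have H : ∀ i, i ≤ M → ∑ k ∈ Finset.range (i + 1), D k +
      ∑ l ∈ Finset.Ico (i + 2) (M + 2), R (i + 1) l =
        D 0 + ∑ l ∈ Finset.Ico 2 (M + 2), R 1 l + ∑ k ∈ Finset.range i, C (k + 1) (M + 2) := by
    intro i
    induction i with
    | zero => intro _; simp
    | succ i ih =>
      intro hi
      rw [G (i + 1) (M + 2) (by omega) le_rfl (by omega), ih (by omega), Finset.sum_range_succ]
      abel
  have h1 := H M le_rfl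
  have h2 := G 0 (M + 1) (by omega) (by omega) (by omega)
  simp only [Finset.Ico_self, Finset.sum_empty, add_zero] at h1
  simp only [Finset.range_zero, Finset.sum_empty, zero_add, Finset.sum_range_one] at h2
  rw [h1, Finset.sum_Ico_succ_top (by omega), ← add_assoc, h2, Finset.sum_Ico_eq_sum_range]
  simp only [Nat.add_sub_cancel]
  simp only [add_comm 1]
  abel

theorem sum_range_shift {A : Type*} [AddCommGroup A] {n : ℕ} {g : ℕ → A}
    (hg : ∀ k, g (k + n) = g k) (s : ℕ) :
    ∑ k ∈ Finset.range n, g (k + s) = ∑ k ∈ Finset.range n, g k := by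
  induction s with
  | zero => rfl
  | succ s ih =>
    have h1 := Finset.sum_range_succ (fun k => g (k + s)) n
    have h2 := Finset.sum_range_succ' (fun k => g (k + s)) n
    rw [h1, ih] at h2
    have h3 : g (n + s) = g (0 + s) := by rw [zero_add, add_comm, hg]
    rw [h3] at h2
    simpa [add_assoc, add_comm 1] using (add_right_cancel h2).symm

/-- Three-space with a distinguished height coordinate, the second component. -/
abbrev V : Type := ℂ × ℝ

/-- For `x`, `y` of positive height, a positive multiple of the difference of the central
projections of `y` and `x` to the plane of height one. -/
def secant (x y : V) : ℂ := x.2 * y.1 - y.2 * x.1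

/-- The determinant of three vectors. -/
def det3 (x y z : V) : ℝ :=
  x.2 * wedge y.1 z.1 + y.2 * wedge z.1 x.1 + z.2 * wedge x.1 y.1

/-- The cones spanned by `a, b` and by `c, d` only share the origin. -/
def ConeDisjoint (a b c d : V) : Prop :=
  ∀ α β γ δ : ℝ, 0 ≤ α → 0 ≤ β → 0 ≤ γ → 0 ≤ δ → α • a + β • b = γ • c + δ • d →
    α = 0 ∧ β = 0 ∧ γ = 0 ∧ δ = 0

theorem ConeDisjoint.symm {a b c d : V} (h : ConeDisjoint a b c d) : ConeDisjoint c d a b := by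
  intro α β γ δ hα hβ hγ hδ e
  have := h γ δ α β hγ hδ hα hβ e.symm
  tauto

theorem ConeDisjoint.swap_left {a b c d : V} (h : ConeDisjoint a b c d) :
    ConeDisjoint b a c d := by
  intro α β γ δ hα hβ hγ hδ e
  have := h β α γ δ hβ hα hγ hδ (by rw [← e, add_comm])
  tauto

theorem ConeDisjoint.map {a b c d : V} (h : ConeDisjoint a b c d) (φ : V →ₗ[ℝ] V)
    (hφ : Function.Injective φ) : ConeDisjoint (φ a) (φ b) (φ c) (φ d) := by
  intro α β γ δ hα hβ hγ hδ e
  refine h α β γ δ hα hβ hγ hδ (hφ ?_)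
  simpa using e

theorem eq_zero_of_det3_ne_zero {x y z : V} (h : det3 x y z ≠ 0) {α β γ : ℝ}
    (e : α • x + β • y + γ • z = 0) : α = 0 ∧ β = 0 ∧ γ = 0 := by
  have e1 := congrArg (fun v : V => v.1.re) e
  have e2 := congrArg (fun v : V => v.1.im) e
  have e3 := congrArg (fun v : V => v.2) e
  simp at e1 e2 e3
  unfold det3 wedge at h
  refine ⟨?_, ?_, ?_⟩
  · refine (mul_eq_zero.1 ?_).resolve_right h
    linear_combination (y.1.im * z.2 - y.2 * z.1.im) * e1 + (y.2 * z.1.re - y.1.re * z.2) * e2 +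
      (y.1.re * z.1.im - y.1.im * z.1.re) * e3
  · refine (mul_eq_zero.1 ?_).resolve_right h
    linear_combination (z.1.im * x.2 - z.2 * x.1.im) * e1 + (z.2 * x.1.re - z.1.re * x.2) * e2 +
      (z.1.re * x.1.im - z.1.im * x.1.re) * e3
  · refine (mul_eq_zero.1 ?_).resolve_right h
    linear_combination (x.1.im * y.2 - x.2 * y.1.im) * e1 + (x.2 * y.1.re - x.1.re * y.2) * e2 +
      (x.1.re * y.1.im - x.1.im * y.1.re) * e3

theorem det3_rotate (x y z : V) : det3 y z x = det3 x y z := by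
  unfold det3; ring

theorem det3_swap (x y z : V) : det3 y x z = -det3 x y z := by
  unfold det3 wedge; ring

theorem wedge_secant (x y z : V) : wedge (secant x y) (secant y z) = y.2 * det3 x y z := by
  unfold secant wedge det3 wedge
  simp
  ring

theorem secant_swap (x y : V) : secant y x = -secant x y := by simp [secant]

/-- A closed polygonal cone with `n` edges in general position without self-intersections, given
by a periodic sequence of vectors. -/
structure IsPolygon (n : ℕ) (u : ℕ → V) : Prop where
  three_le : 3 ≤ n
  periodic : ∀ k, u (k + n) = u k
  det_ne_zero : ∀ i j k, i < j → j < k → k < i + n → det3 (u i) (u j) (u k) ≠ 0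
  disjoint : ∀ i j, i + 2 ≤ j → j + 2 ≤ i + n →
    ConeDisjoint (u i) (u (i + 1)) (u j) (u (j + 1))

theorem IsPolygon.shift {n : ℕ} {u : ℕ → V} (h : IsPolygon n u) (s : ℕ) :
    IsPolygon n fun k => u (k + s) where
  three_le := h.three_le
  periodic k := by rw [add_right_comm, h.periodic]
  det_ne_zero i j k h1 h2 h3 := h.det_ne_zero _ _ _ (by omega) (by omega) (by omega)
  disjoint i j h1 h2 := by
    have := h.disjoint (i + s) (j + s) (by omega) (by omega)
    rwa [add_right_comm i s, add_right_comm j s] at this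

theorem IsPolygon.map {n : ℕ} {u : ℕ → V} (h : IsPolygon n u) (φ : V →ₗ[ℝ] V) {c : ℝ}
    (hc : c ≠ 0) (hφ : ∀ x y z, det3 (φ x) (φ y) (φ z) = c * det3 x y z)
    (hi : Function.Injective φ) : IsPolygon n fun k => φ (u k) where
  three_le := h.three_le
  periodic k := by rw [h.periodic]
  det_ne_zero i j k h1 h2 h3 := by
    rw [hφ]
    exact mul_ne_zero hc (h.det_ne_zero _ _ _ h1 h2 h3)
  disjoint i j h1 h2 := (h.disjoint i j h1 h2).map φ hi

/-- Vertices of height zero have neighbours on both sides. -/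
def Admissible (u : ℕ → V) : Prop :=
  ∀ k, (u (k + 1)).2 = 0 → (u k).2 * (u (k + 2)).2 < 0

/-- The turning angle of the polygon at its vertex `k + 1`. -/
def turn (u : ℕ → V) (k : ℕ) : ℝ :=
  (secant (u (k + 1)) (u (k + 2)) / secant (u k) (u (k + 1))).arg

theorem turn_periodic {n : ℕ} {u : ℕ → V} (h : ∀ k, u (k + n) = u k) (k : ℕ) :
    turn u (k + n) = turn u k := by
  unfold turn
  rw [add_right_comm k n 1, add_right_comm k n 2, h, h, h]

theorem slit_of_wedge_ne_zero {a b : ℂ} (h : wedge a b ≠ 0) : b / a ∈ Complex.slitPlane := by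
  right
  rw [Complex.div_im]
  have ha : a ≠ 0 := by rintro rfl; simp [wedge] at h
  have : b.im * a.re / Complex.normSq a - b.re * a.im / Complex.normSq a =
      wedge a b / Complex.normSq a := by
    unfold wedge; ring
  rw [this]
  exact div_ne_zero h (Complex.normSq_pos.2 ha).ne'

theorem secant_ne_zero_of_det {x y z : V} (hd : det3 x y z ≠ 0) (h : y.2 ≠ 0) :
    secant x y ≠ 0 ∧ secant y z ≠ 0 := by
  have := wedge_secant x y z
  constructor <;> intro e <;> rw [e] at this <;> simp [wedge] at this <;> tauto

theorem height_ne_zero_fst {x y z : V} (hd : det3 x y z ≠ 0) (h : y.2 = 0) : y.1 ≠ 0 := by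
  intro h1
  apply hd
  unfold det3 wedge
  simp [h1, h]

/-- At a vertex of height zero the two secants are `x.2 * y.1` and `-z.2 * y.1`. Neighbours on
opposite sides make these positive multiples of each other, so there is no turn. At other vertices
`wedge_secant` shows that the secants are not parallel. -/
theorem secant_div_slit {x y z : V} (hd : det3 x y z ≠ 0) (h : y.2 = 0 → x.2 * z.2 < 0) :
    secant x y ≠ 0 ∧ secant y z ≠ 0 ∧ secant y z / secant x y ∈ Complex.slitPlane ∧
      (y.2 = 0 → (secant y z / secant x y).arg = 0) := by
  by_cases hy : y.2 = 0
  · have hy1 := height_ne_zero_fst hd hy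
    have hxz := h hy
    have hx : x.2 ≠ 0 := by intro h; rw [h] at hxz; simp at hxz
    have hz : z.2 ≠ 0 := by intro h; rw [h] at hxz; simp at hxz
    have e1 : secant x y = x.2 * y.1 := by simp [secant, hy]
    have e2 : secant y z = -z.2 * y.1 := by simp [secant, hy]
    have e3 : secant y z / secant x y = ((-z.2 / x.2 : ℝ) : ℂ) := by
      rw [e1, e2]
      have : (x.2 : ℂ) ≠ 0 := by exact_mod_cast hx
      push_cast
      field_simp
    have e4 : 0 < -z.2 / x.2 := by
      rcases lt_or_gt_of_ne hx with h1 | h1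
      · exact div_pos_of_neg_of_neg (by nlinarith) h1
      · exact div_pos (by nlinarith) h1
    refine ⟨?_, ?_, ?_, fun _ => ?_⟩
    · rw [e1]; exact mul_ne_zero (by exact_mod_cast hx) hy1
    · rw [e2]; exact mul_ne_zero (by simpa using hz) hy1
    · rw [e3]; exact Complex.ofReal_mem_slitPlane.2 e4
    · rw [e3]; exact Complex.arg_ofReal_of_nonneg e4.le
  · have := secant_ne_zero_of_det hd hy
    refine ⟨this.1, this.2, slit_of_wedge_ne_zero ?_, fun h => absurd h hy⟩
    rw [wedge_secant]
    exact mul_ne_zero hy hd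

end SphericalPolygon
end

/-! ### Turning of a part of a polygon in the upper half space. -/

noncomputable section
namespace SphericalPolygon

theorem Pointed.reverse {a b c : ℂ} (h : Pointed a b c) : Pointed c b a := by
  intro α β γ hα hβ hγ e
  have := h γ β α hγ hβ hα (by rw [← e]; ring)
  tauto

/-- The cone spanned by `s • a + t • b` and `b` lies in the cone spanned by `a` and `b`, so an edge
may be shortened. -/
theorem ConeDisjoint.add_left {a b c d : V} (h : ConeDisjoint a b c d) {s t : ℝ} (hs : 0 < s)
    (ht : 0 ≤ t) : ConeDisjoint (s • a + t • b) b c d := by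
  intro α β γ δ hα hβ hγ hδ e
  have := h (α * s) (α * t + β) γ δ (by positivity) (by positivity) hγ hδ
    (by rw [← e]; module)
  have h1 : α = 0 := (mul_eq_zero.1 this.1).resolve_right hs.ne'
  subst h1
  simpa using this

theorem ConeDisjoint.add_right {a b c d : V} (h : ConeDisjoint a b c d) {s t : ℝ} (hs : 0 < s)
    (ht : 0 ≤ t) : ConeDisjoint a b c (s • d + t • c) :=
  ((h.symm.swap_left).add_left hs ht).swap_left.symm

theorem add_eq_zero_of_nonneg {a b : ℝ} (ha : 0 ≤ a) (hb : 0 ≤ b) (h : a + b = 0) :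
    a = 0 ∧ b = 0 := (add_eq_zero_iff_of_nonneg ha hb).1 h

/-- Nonnegative relations between the four secants of two disjoint edges. -/
theorem ConeDisjoint.secant_relation {a b c d : V} (h : ConeDisjoint a b c d) (ha : 0 ≤ a.2)
    (hb : 0 < b.2) (hc : 0 < c.2) (hd : 0 ≤ d.2) {α β γ δ : ℝ} (hα : 0 ≤ α) (hβ : 0 ≤ β)
    (hγ : 0 ≤ γ) (hδ : 0 ≤ δ)
    (e : (α * secant a c + β * secant a d + γ * secant b d + δ * secant b c : ℂ) = 0) :
    α = 0 ∧ γ = 0 ∧ δ = 0 ∧ β * a.2 = 0 ∧ β * d.2 = 0 := by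
  -- Collecting `e` by vertices gives one vector in each cone. The two have the same height
  -- identically, and `e` says that their horizontal parts agree.
  have := h (α * c.2 + β * d.2) (γ * d.2 + δ * c.2) (α * a.2 + δ * b.2) (β * a.2 + γ * b.2)
    (by positivity) (by positivity) (by positivity) (by positivity) (by
      apply Prod.ext
      · simp only [Prod.fst_add, Prod.smul_fst, Complex.real_smul]
        unfold secant at e
        push_cast
        linear_combination -e
      · simp
        ring)
  obtain ⟨h1, h2, h3, h4⟩ := this
  have k1 := add_eq_zero_of_nonneg (by positivity) (by positivity) h1
  have k3 := add_eq_zero_of_nonneg (by positivity) (by positivity) h3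
  have k4 := add_eq_zero_of_nonneg (by positivity) (by positivity) h4
  refine ⟨(mul_eq_zero.1 k1.1).resolve_right hc.ne', (mul_eq_zero.1 k4.2).resolve_right hb.ne',
    (mul_eq_zero.1 k3.2).resolve_right hb.ne', k4.1, k1.2⟩

theorem ConeDisjoint.pointed_through {a b c d : V} (h : ConeDisjoint a b c d) (ha : 0 ≤ a.2)
    (hb : 0 < b.2) (hc : 0 < c.2) (hd : 0 ≤ d.2) :
    Pointed (secant a c) (secant b c) (secant b d) := by
  intro α δ γ hα hδ hγ e
  have := h.secant_relation ha hb hc hd hα le_rfl hγ hδ (by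
    rw [← e]; push_cast; ring)
  tauto

theorem ConeDisjoint.pointed_other {a b c d : V} (h : ConeDisjoint a b c d) (ha : 0 ≤ a.2)
    (hb : 0 < b.2) (hc : 0 < c.2) (hd : 0 ≤ d.2) (had : 0 < a.2 ∨ 0 < d.2) :
    Pointed (secant a c) (secant a d) (secant b d) := by
  intro α β γ hα hβ hγ e
  have := h.secant_relation ha hb hc hd hα hβ hγ le_rfl (by
    rw [← e]; push_cast; ring)
  refine ⟨this.1, ?_, this.2.1⟩
  rcases had with k | k
  · exact (mul_eq_zero.1 this.2.2.2.1).resolve_right k.ne'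
  · exact (mul_eq_zero.1 this.2.2.2.2).resolve_right k.ne'

/-- Both sides equal the argument of `secant b d / secant a c`: the two ways of moving both
endpoints pass through `secant a d` or `secant b c`, and stay in a half plane either way. At most
one of the outer endpoints may be at infinity. -/
theorem ConeDisjoint.square {a b c d : V} (h : ConeDisjoint a b c d) (ha : 0 ≤ a.2)
    (hb : 0 < b.2) (hc : 0 < c.2) (hd : 0 ≤ d.2) (had : 0 < a.2 ∨ 0 < d.2) :
    (secant a d / secant a c).arg + (secant b d / secant a d).arg =
      (secant b c / secant a c).arg + (secant b d / secant b c).arg := by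
  rw [(h.pointed_other ha hb hc hd had).arg_div_add_arg_div,
    (h.pointed_through ha hb hc hd).arg_div_add_arg_div]

/-- A nonnegative relation between the three side vectors rearranges to a linear relation between
the vertices. Independence kills its coefficients, two of which are sums of terms of one sign. -/
theorem pointed_triangle {a b c : V} (h : det3 a b c ≠ 0) (ha : 0 ≤ a.2) (hb : 0 < b.2)
    (hc : 0 ≤ c.2) (hac : 0 < a.2 ∨ 0 < c.2) :
    Pointed (secant a b) (secant a c) (secant b c) := by
  intro α β γ hα hβ hγ e
  have := eq_zero_of_det3_ne_zero h (α := -(α * b.2 + β * c.2)) (β := α * a.2 - γ * c.2)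
    (γ := β * a.2 + γ * b.2) (by
      apply Prod.ext
      · simp only [Prod.fst_add, Prod.smul_fst, Complex.real_smul]
        unfold secant at e
        push_cast
        simp only [Prod.fst_zero]
        linear_combination e
      · simp
        ring)
  obtain ⟨h1, -, h3⟩ := this
  have k1 := add_eq_zero_of_nonneg (by positivity) (by positivity) (neg_eq_zero.1 h1)
  have k3 := add_eq_zero_of_nonneg (by positivity) (by positivity) h3
  refine ⟨(mul_eq_zero.1 k1.1).resolve_right hb.ne', ?_, (mul_eq_zero.1 k3.2).resolve_right hb.ne'⟩
  rcases hac with k | k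
  · exact (mul_eq_zero.1 k3.1).resolve_right k.ne'
  · exact (mul_eq_zero.1 k1.2).resolve_right k.ne'

theorem arg_scale {s t : ℝ} (hs : 0 < s) (ht : 0 < t) (a b : ℂ) :
    (((s : ℂ) * a) / ((t : ℂ) * b)).arg = (a / b).arg := by
  have : ((s : ℂ) * a) / ((t : ℂ) * b) = ((s / t : ℝ) : ℂ) * (a / b) := by
    push_cast
    rw [mul_div_mul_comm]
  rw [this, Complex.arg_real_mul _ (div_pos hs ht)]

/-- A vector of height zero is a point at infinity of the projection: the direction from it is the
same at every point of the plane. -/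
theorem arg_div_secant_left {x y z : V} (hx : x.2 = 0) (hy : 0 < y.2) (hz : 0 < z.2) :
    (secant x z / secant x y).arg = 0 := by
  have e1 : secant x z = (z.2 : ℂ) * -x.1 := by simp [secant, hx]
  have e2 : secant x y = (y.2 : ℂ) * -x.1 := by simp [secant, hx]
  rw [e1, e2, arg_scale hz hy]
  by_cases h : -x.1 = 0
  · simp [h]
  · rw [div_self h, Complex.arg_one]

theorem arg_div_secant_right {x y z : V} (hx : x.2 = 0) (hy : 0 < y.2) (hz : 0 < z.2) :
    (secant z x / secant y x).arg = 0 := by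
  rw [secant_swap, secant_swap x y, neg_div_neg_eq]
  exact arg_div_secant_left hx hy hz

theorem det3_add_left {a b c : V} (s t : ℝ) : det3 (s • a + t • b) b c = s * det3 a b c := by
  unfold det3 wedge; simp; ring

theorem det3_add_right {a b c : V} (s t : ℝ) : det3 a b (s • c + t • b) = s * det3 a b c := by
  unfold det3 wedge; simp; ring

theorem secant_add_left {a b : V} (s t : ℝ) : secant (s • a + t • b) b = s * secant a b := by
  unfold secant; simp; ring

theorem secant_add_right {a b : V} (s t : ℝ) : secant b (s • a + t • b) = s * secant b a := by
  unfold secant; simp; ring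

theorem snd_smul_add_neg_smul {a b : V} {s t : ℝ} : (s • a + (-t) • b).2 = s * a.2 - t * b.2 := by
  simp; ring

/-- A part of a polygon that runs in the upper half space turns by less than a half turn. -/
theorem IsPolygon.abs_sum_turn_lt {n : ℕ} {u : ℕ → V} (hu : IsPolygon n u) (ha : Admissible u)
    {m : ℕ} (hm : 1 ≤ m) (hmn : m + 1 ≤ n) (h0 : (u 0).2 ≤ 0)
    (hpos : ∀ j, 1 ≤ j → j ≤ m → 0 < (u j).2) (hlast : (u (m + 1)).2 ≤ 0) :
    |∑ k ∈ Finset.range m, turn u k| < Real.pi := by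
  have h3 := hu.three_le
  obtain ⟨M, rfl⟩ : ∃ M, m = M + 1 := ⟨m - 1, by omega⟩
  rcases Nat.eq_zero_or_pos M with rfl | hM
  · simp only [zero_add, Finset.sum_range_one]
    have := secant_div_slit (hu.det_ne_zero 0 1 2 (by omega) (by omega) (by omega))
      (fun h => ha 0 h)
    exact abs_arg_lt_pi_of_slit this.2.2.1
  -- `q` and `r` are positive multiples of the points where the entering and the leaving edge reach
  -- height zero. Replacing the ends by them makes all heights nonnegative and keeps all secant
  -- directions.
  set q : V := (u 1).2 • u 0 + (-(u 0).2) • u 1 with hq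
  set r : V := (u (M + 1)).2 • u (M + 2) + (-(u (M + 2)).2) • u (M + 1) with hr
  have p1 := hpos 1 le_rfl (by omega)
  have pM := hpos (M + 1) (by omega) le_rfl
  have q2 : q.2 = 0 := by rw [hq, snd_smul_add_neg_smul]; ring
  have r2 : r.2 = 0 := by rw [hr, snd_smul_add_neg_smul]; ring
  set y : ℕ → V := fun j => if j = 0 then q else if j = M + 2 then r else u j with hy
  have y0 : y 0 = q := by simp [hy]
  have yl : y (M + 2) = r := by simp [hy]
  have yu : ∀ j, 1 ≤ j → j ≤ M + 1 → y j = u j := by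
    intro j h1 h2
    simp only [hy]
    rw [if_neg (by omega), if_neg (by omega)]
  have ypos : ∀ j, 1 ≤ j → j ≤ M + 1 → 0 < (y j).2 := by
    intro j h1 h2
    rw [yu j h1 h2]
    exact hpos j h1 h2
  have ynn : ∀ j, j ≤ M + 2 → 0 ≤ (y j).2 := by
    intro j h2
    rcases Nat.eq_zero_or_pos j with rfl | h1
    · rw [y0, q2]
    · rcases Nat.lt_or_ge j (M + 2) with h | h
      · exact (ypos j h1 (by omega)).le
      · rw [show j = M + 2 by omega, yl, r2]
  have ydet : ∀ k, k ≤ M → det3 (y k) (y (k + 1)) (y (k + 2)) ≠ 0 := by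
    intro k hk
    have d := hu.det_ne_zero k (k + 1) (k + 2) (by omega) (by omega) (by omega)
    rcases Nat.eq_zero_or_pos k with rfl | h1
    · rw [y0, yu _ (by omega) (by omega), yu _ (by omega) (by omega), hq, zero_add, det3_add_left]
      exact mul_ne_zero p1.ne' d
    · rcases Nat.lt_or_ge k M with h | h
      · rw [yu _ h1 (by omega), yu _ (by omega) (by omega), yu _ (by omega) (by omega)]
        exact d
      · obtain rfl : k = M := by omega
        rw [yu _ h1 (by omega), yu _ (by omega) (by omega), yl, hr, det3_add_right]
        exact mul_ne_zero pM.ne' d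
  have ydis : ∀ i j, i + 2 ≤ j → j ≤ M + 1 →
      ConeDisjoint (y i) (y (i + 1)) (y j) (y (j + 1)) := by
    intro i j hij hj
    -- The entering and the leaving edge may share their lower vertex, namely if `u 0` is the only
    -- vertex outside the run. Simplicity says nothing then, and disjointness of the shortened edges
    -- comes from general position.
    by_cases hc : i = 0 ∧ j + 2 > n
    · obtain ⟨rfl, hc⟩ := hc
      obtain rfl : j = M + 1 := by omega
      obtain rfl : n = M + 2 := by omega
      have un : u (M + 2) = u 0 := by simpa using hu.periodic 0
      have un1 : u (M + 3) = u 1 := by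
        have := hu.periodic 1
        rwa [show 1 + (M + 2) = M + 3 by omega] at this
      -- Height zero would contradict admissibility, since both neighbours of this vertex are above.
      have hneg : (u 0).2 < 0 := by
        refine lt_of_le_of_ne h0 fun e => ?_
        have := ha (M + 1) (by rw [show M + 1 + 1 = M + 2 by omega, un, e])
        rw [show M + 1 + 2 = M + 3 by omega, un1] at this
        nlinarith
      rw [y0, yu _ (by omega) (by omega), yu _ (by omega) (by omega), yl, hq, hr, un]
      intro α β γ δ hα hβ hγ hδ e
      have d := hu.det_ne_zero 0 1 (M + 1) (by omega) (by omega) (by omega)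
      have := eq_zero_of_det3_ne_zero d (α := α * (u 1).2 - δ * (u (M + 1)).2)
        (β := β - α * (u 0).2) (γ := δ * (u 0).2 - γ) (by
          have e' := sub_eq_zero.2 e
          rw [← e']
          simp only [zero_add]
          module)
      have k1 := add_eq_zero_of_nonneg (a := β) (b := α * -(u 0).2) hβ
        (mul_nonneg hα (by linarith)) (by linarith [this.2.1])
      have k2 := add_eq_zero_of_nonneg (a := γ) (b := δ * -(u 0).2) hγ
        (mul_nonneg hδ (by linarith)) (by linarith [this.2.2])
      refine ⟨(mul_eq_zero.1 k1.2).resolve_right (by linarith), k1.1, k2.1,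
        (mul_eq_zero.1 k2.2).resolve_right (by linarith)⟩
    · have d := hu.disjoint i j hij (by omega)
      have d2 : ConeDisjoint (u i) (u (i + 1)) (y j) (y (j + 1)) := by
        rw [yu j (by omega) hj]
        rcases Nat.lt_or_ge j (M + 1) with h | h
        · rwa [yu (j + 1) (by omega) (by omega)]
        · obtain rfl : j = M + 1 := by omega
          rw [yl, hr]
          exact d.add_right pM (by simpa using hlast)
      rw [yu (i + 1) (by omega) (by omega)]
      rcases Nat.eq_zero_or_pos i with rfl | h
      · rw [y0, hq]
        exact d2.add_left p1 (by simpa using h0)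
      · rwa [yu i h (by omega)]
  have ysec : ∀ k, k ≤ M + 1 → ∃ c : ℝ, 0 < c ∧
      secant (y k) (y (k + 1)) = c * secant (u k) (u (k + 1)) := by
    intro k hk
    rcases Nat.eq_zero_or_pos k with rfl | h1
    · refine ⟨(u 1).2, p1, ?_⟩
      rw [y0, yu _ (by omega) (by omega), hq, zero_add, secant_add_left]
    · rcases Nat.lt_or_ge k (M + 1) with h | h
      · exact ⟨1, one_pos, by rw [yu _ h1 (by omega), yu _ (by omega) (by omega)]; simp⟩
      · obtain rfl : k = M + 1 := by omega
        refine ⟨(u (M + 1)).2, pM, ?_⟩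
        rw [yl, yu _ h1 (by omega), hr, secant_add_right]
  have hturn : ∑ k ∈ Finset.range (M + 1), turn u k = ∑ k ∈ Finset.range (M + 1), turn y k := by
    refine Finset.sum_congr rfl fun k hk => ?_
    rw [Finset.mem_range] at hk
    obtain ⟨c, hc, e⟩ := ysec k (by omega)
    obtain ⟨c', hc', e'⟩ := ysec (k + 1) (by omega)
    unfold turn
    rw [show k + 2 = k + 1 + 1 by omega, e, e', arg_scale hc' hc]
  have := sum_diagonal_eq_sum_sides
    (fun i j => (secant (y i) (y (j + 1)) / secant (y i) (y j)).arg)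
    (fun i j => (secant (y (i + 1)) (y j) / secant (y i) (y j)).arg) (turn y) M
    (fun k hk => by
      refine (pointed_triangle (ydet k hk) (ynn _ (by omega)) (ypos _ (by omega) (by omega))
        (ynn _ (by omega)) ?_).arg_div_add_arg_div
      rcases Nat.eq_zero_or_pos k with rfl | h1
      · exact Or.inr (ypos _ (by omega) (by omega))
      · exact Or.inl (ypos _ (by omega) (by omega)))
    (fun i j hij hj hc => by
      refine (ydis i j hij hj).square (ynn _ (by omega)) (ypos _ (by omega) (by omega))
        (ypos _ (by omega) (by omega)) (ynn _ (by omega)) ?_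
      rcases Nat.eq_zero_or_pos i with rfl | h1
      · exact Or.inr (ypos _ (by omega) (by have := hc rfl; omega))
      · exact Or.inl (ypos _ (by omega) (by omega)))
  -- The row belonging to `q` and the column belonging to `r` vanish, because directions from a
  -- point at infinity are constant. Only the corner is left, a single angle between vectors of an
  -- open half plane.
  rw [hturn, this, if_neg hM.ne', Finset.sum_eq_zero, Finset.sum_eq_zero, zero_add, add_zero]
  · have P := (ydis 0 (M + 1) (by omega) le_rfl).pointed_through (ynn _ (by omega))
      (ypos _ (by omega) (by omega)) (ypos _ (by omega) (by omega)) (ynn _ (by omega))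
    rw [P.arg_div_add_arg_div]
    exact P.abs_arg_div_lt
  · intro i hi
    rw [Finset.mem_range] at hi
    exact arg_div_secant_right (by rw [yl, r2]) (ypos _ (by omega) (by omega))
      (ypos _ (by omega) (by omega))
  · intro j hj
    rw [Finset.mem_range] at hj
    exact arg_div_secant_left (by rw [y0, q2]) (ypos _ (by omega) (by omega))
      (ypos _ (by omega) (by omega))

theorem arg_mem_of_lex {a : ℂ} (h : 0 < a.re ∨ a.re = 0 ∧ 0 < a.im) :
    a.arg ∈ Set.Ioc (-(Real.pi / 2)) (Real.pi / 2) := by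
  rcases h with h | h
  · have := abs_lt.1 (Complex.abs_arg_lt_pi_div_two_iff.2 (Or.inl h))
    exact ⟨this.1, this.2.le⟩
  · rw [Complex.arg_eq_pi_div_two_iff.2 h]
    constructor <;> linarith [Real.pi_pos]

theorem arg_div_of_lex {a b : ℂ} (ha : 0 < a.re ∨ a.re = 0 ∧ 0 < a.im)
    (hb : 0 < b.re ∨ b.re = 0 ∧ 0 < b.im) : (b / a).arg = b.arg - a.arg := by
  have h1 := arg_mem_of_lex ha
  have h2 := arg_mem_of_lex hb
  have z (c : ℂ) (hc : 0 < c.re ∨ c.re = 0 ∧ 0 < c.im) : c ≠ 0 := by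
    rintro rfl; simp at hc
  have := arg_div_eq_of_mem (z a ha) (z b hb) 0 (by
    constructor <;> push_cast <;> linarith [h1.1, h1.2, h2.1, h2.2])
  simpa using this

/-- A vertex whose projection is leftmost, and lowest among the leftmost ones. Starting there, as in
Hopf's proof, all directions to other vertices lie in a half plane. -/
theorem exists_lex_min (n : ℕ) (hn : 0 < n) (u : ℕ → V) (hper : ∀ k, u (k + n) = u k)
    (hpos : ∀ k, 0 < (u k).2) : ∃ s, ∀ k, secant (u s) (u k) ≠ 0 →
      0 < (secant (u s) (u k)).re ∨
        (secant (u s) (u k)).re = 0 ∧ 0 < (secant (u s) (u k)).im := by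
  obtain ⟨s, -, hs⟩ := Finset.exists_min_image (Finset.range n)
    (fun k => toLex ((u k).1.re / (u k).2, (u k).1.im / (u k).2)) ⟨0, by simpa using hn⟩
  refine ⟨s, fun k hk => ?_⟩
  have hmod : u (k % n) = u k := (Function.Periodic.map_mod_nat (f := u) hper k)
  have := hs (k % n) (by simpa using Nat.mod_lt _ hn)
  rw [hmod, Prod.Lex.toLex_le_toLex] at this
  have ps := hpos s
  have pk := hpos k
  have e1 : (secant (u s) (u k)).re = (u s).2 * (u k).1.re - (u k).2 * (u s).1.re := by
    simp [secant]
  have e2 : (secant (u s) (u k)).im = (u s).2 * (u k).1.im - (u k).2 * (u s).1.im := by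
    simp [secant]
  simp only at this
  rw [div_lt_div_iff₀ ps pk, div_eq_div_iff ps.ne' pk.ne', div_le_div_iff₀ ps pk] at this
  rcases this with h | ⟨h, h'⟩
  · left; rw [e1]; linarith
  · right
    have hr : (secant (u s) (u k)).re = 0 := by rw [e1]; linarith
    refine ⟨hr, lt_of_le_of_ne (by rw [e2]; linarith) fun e => hk ?_⟩
    exact Complex.ext hr e.symm

/-- The row and the column through the extreme vertex contribute the same difference of two
arguments in `(-π/2, π/2]`. The corner and the closing turn are both equal to one angle of absolute
value less than `π`. The total is twice a sum of two numbers in `(-π, π)`; this weak bound suffices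
because the turning is a multiple of `2π`. -/
theorem IsPolygon.abs_sum_turn_lt_of_lex {n : ℕ} {u : ℕ → V} (hu : IsPolygon n u)
    (hpos : ∀ k, 0 < (u k).2)
    (hlex : ∀ k, secant (u 0) (u k) ≠ 0 →
      0 < (secant (u 0) (u k)).re ∨ (secant (u 0) (u k)).re = 0 ∧ 0 < (secant (u 0) (u k)).im) :
    |∑ k ∈ Finset.range n, turn u k| < 4 * Real.pi := by
  have h3 := hu.three_le
  obtain ⟨M, rfl⟩ : ∃ M, n = M + 2 := ⟨n - 2, by omega⟩
  have hM : M ≠ 0 := by omega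
  have hun : u (M + 2) = u 0 := by simpa using hu.periodic 0
  have hun1 : u (M + 3) = u 1 := by
    have := hu.periodic 1
    rwa [show 1 + (M + 2) = M + 3 by omega] at this
  have lex : ∀ k, 1 ≤ k → k ≤ M + 1 → 0 < (secant (u 0) (u k)).re ∨
      (secant (u 0) (u k)).re = 0 ∧ 0 < (secant (u 0) (u k)).im := by
    intro k h1 h2
    apply hlex k
    rcases Nat.lt_or_ge k (M + 1) with h | h
    · have := hu.det_ne_zero 0 k (M + 1) (by omega) (by omega) (by omega)
      exact (secant_ne_zero_of_det this (hpos k).ne').1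
    · obtain rfl : k = M + 1 := by omega
      have := hu.det_ne_zero 0 1 (M + 1) (by omega) (by omega) (by omega)
      rw [← det3_rotate] at this
      have := (secant_ne_zero_of_det this (hpos _).ne').2
      rw [secant_swap]
      simpa using this
  have grid := sum_diagonal_eq_sum_sides
    (fun i j => (secant (u i) (u (j + 1)) / secant (u i) (u j)).arg)
    (fun i j => (secant (u (i + 1)) (u j) / secant (u i) (u j)).arg) (turn u) M
    (fun k hk => (pointed_triangle (hu.det_ne_zero k (k + 1) (k + 2) (by omega) (by omega)
      (by omega)) (hpos _).le (hpos _) (hpos _).le (Or.inl (hpos _))).arg_div_add_arg_div)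
    (fun i j hij hj hc => (hu.disjoint i j hij (by
      rcases Nat.eq_zero_or_pos i with rfl | h
      · have := hc rfl; omega
      · omega)).square (hpos _).le (hpos _) (hpos _) (hpos _).le (Or.inl (hpos _)))
  rw [if_neg hM] at grid
  have row : ∑ j ∈ Finset.range M,
      (secant (u 0) (u (j + 1 + 1)) / secant (u 0) (u (j + 1))).arg =
        (secant (u 0) (u (M + 1))).arg - (secant (u 0) (u 1)).arg := by
    rw [← Finset.sum_range_sub (fun j => (secant (u 0) (u (j + 1))).arg)]
    refine Finset.sum_congr rfl fun j hj => ?_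
    rw [Finset.mem_range] at hj
    exact arg_div_of_lex (lex _ (by omega) (by omega)) (lex _ (by omega) (by omega))
  have col : ∑ i ∈ Finset.range M,
      (secant (u (i + 1 + 1)) (u (M + 2)) / secant (u (i + 1)) (u (M + 2))).arg =
        (secant (u 0) (u (M + 1))).arg - (secant (u 0) (u 1)).arg := by
    rw [← row]
    refine Finset.sum_congr rfl fun j hj => ?_
    rw [hun, secant_swap, secant_swap (u 0) (u (j + 1)), neg_div_neg_eq]
  have P : Pointed (secant (u 0) (u (M + 1))) (secant (u 1) (u (M + 1))) (secant (u 1) (u 0)) := by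
    have := hu.det_ne_zero 0 1 (M + 1) (by omega) (by omega) (by omega)
    have d : det3 (u 1) (u 0) (u (M + 1)) ≠ 0 := by rw [det3_swap]; simpa using this
    exact (pointed_triangle d (hpos _).le (hpos _) (hpos _).le (Or.inl (hpos _))).reverse
  have e1 := P.arg_div_add_arg_div
  have e2 : turn u (M + 1) = (secant (u 1) (u 0) / secant (u 0) (u (M + 1))).arg := by
    unfold turn
    rw [show M + 1 + 1 = M + 2 by omega, show M + 1 + 2 = M + 3 by omega, hun, hun1,
      secant_swap (u 1) (u 0), secant_swap (u 0) (u (M + 1)), neg_div, div_neg,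
      neg_neg]
  have e3 := abs_lt.1 P.abs_arg_div_lt
  simp only [zero_add] at grid
  rw [row, col, hun, e1] at grid
  rw [show M + 2 = M + 1 + 1 by omega, Finset.sum_range_succ, grid, e2, abs_lt]
  have m1 := arg_mem_of_lex (lex 1 le_rfl (by omega))
  have m2 := arg_mem_of_lex (lex (M + 1) (by omega) le_rfl)
  constructor <;> linarith [m1.1, m1.2, m2.1, m2.2, e3.1, e3.2]

theorem turn_shift (u : ℕ → V) (s k : ℕ) : turn (fun k => u (k + s)) k = turn u (k + s) := by
  unfold turn
  simp only [add_right_comm _ _ s]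

theorem IsPolygon.abs_sum_turn_lt_of_pos {n : ℕ} {u : ℕ → V} (hu : IsPolygon n u)
    (hpos : ∀ k, 0 < (u k).2) : |∑ k ∈ Finset.range n, turn u k| < 4 * Real.pi := by
  obtain ⟨s, hs⟩ := exists_lex_min n (by have := hu.three_le; omega) u hu.periodic hpos
  have := (hu.shift s).abs_sum_turn_lt_of_lex (fun k => hpos _) (fun k => by simpa using hs (k + s))
  rw [← sum_range_shift (turn_periodic hu.periodic) s]
  simpa only [turn_shift] using this

end SphericalPolygon
end

/-! ### The bound on the total turning. -/

noncomputable section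
namespace SphericalPolygon

/-- Negation exchanges the two half spaces and keeps all turning angles, so runs below height zero
need no separate argument. -/
theorem secant_neg (x y : V) : secant (-x) (-y) = secant x y := by
  unfold secant; simp

theorem turn_neg (u : ℕ → V) (k : ℕ) : turn (fun k => -u k) k = turn u k := by
  unfold turn; simp only [secant_neg]

theorem IsPolygon.neg {n : ℕ} {u : ℕ → V} (h : IsPolygon n u) : IsPolygon n fun k => -u k :=
  h.map (-LinearMap.id) (c := -1) (by norm_num)
    (fun x y z => by simp [det3, wedge]; ring) (fun x y e => by simpa using e)

theorem Admissible.shift {u : ℕ → V} (h : Admissible u) (s : ℕ) :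
    Admissible fun k => u (k + s) := by
  intro k hk
  have := h (k + s) (by rw [add_right_comm]; exact hk)
  rwa [add_right_comm k s 2] at this

theorem Admissible.neg {u : ℕ → V} (h : Admissible u) : Admissible fun k => -u k := by
  intro k hk
  simpa using h k (by simpa using hk)

open Classical in
/-- The number of edges among the first `n` that go up through height zero. -/
def ups (u : ℕ → V) (n : ℕ) : ℤ :=
  ∑ k ∈ Finset.range n, if (u k).2 ≤ 0 ∧ 0 < (u (k + 1)).2 then 1 else 0

open Classical in
/-- The number of edges among the first `n` that go down through height zero. -/
def downs (u : ℕ → V) (n : ℕ) : ℤ :=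
  ∑ k ∈ Finset.range n, if 0 ≤ (u k).2 ∧ (u (k + 1)).2 < 0 then 1 else 0

theorem ups_shift {n : ℕ} {u : ℕ → V} (h : ∀ k, u (k + n) = u k) (s : ℕ) :
    ups (fun k => u (k + s)) n = ups u n := by
  unfold ups
  rw [← sum_range_shift (s := s) (n := n) (g := fun k =>
    if (u k).2 ≤ 0 ∧ 0 < (u (k + 1)).2 then (1 : ℤ) else 0)]
  · simp only [add_right_comm]
  · intro k
    rw [add_right_comm, h, h]

-- Around a closed polygon, descents and rises alternate. The proof writes their difference as the
-- change of a periodic state.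
open Classical in
theorem downs_eq_ups {n : ℕ} {u : ℕ → V} (h : ∀ k, u (k + n) = u k) (ha : Admissible u) :
    downs u n = ups u n := by
  -- The state "below": a vertex of height zero counts as below if the polygon is about to rise from
  -- it.
  set p : ℕ → ℤ := fun k => (if (u k).2 < 0 then 1 else 0) +
    (if (u k).2 = 0 ∧ 0 < (u (k + 1)).2 then 1 else 0) with hp
  have key : ∀ k, (if 0 ≤ (u k).2 ∧ (u (k + 1)).2 < 0 then (1 : ℤ) else 0) -
      (if (u k).2 ≤ 0 ∧ 0 < (u (k + 1)).2 then 1 else 0) = p (k + 1) - p k := by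
    intro k
    have adm := ha k
    simp only [hp, show k + 1 + 1 = k + 2 from rfl]
    generalize (u k).2 = a at *
    generalize (u (k + 1)).2 = b at *
    generalize (u (k + 2)).2 = c at *
    rcases lt_trichotomy b 0 with hb | rfl | hb
    · rcases lt_trichotomy a 0 with h1 | rfl | h1
      · simp [hb, hb.ne, hb.not_gt, h1, h1.not_ge, h1.ne]
      · simp [hb, hb.ne, hb.not_gt]
      · simp [hb, hb.ne, hb.not_gt, h1.ne', h1.not_gt, h1.le]
    · have := adm rfl
      rcases lt_trichotomy a 0 with h1 | rfl | h1
      · have hc : 0 < c := by nlinarith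
        simp [h1, h1.ne, hc]
      · simp at this
      · have hc : c < 0 := by nlinarith
        simp [h1.not_gt, h1.ne', hc.not_gt]
    · rcases lt_trichotomy a 0 with h1 | rfl | h1
      · simp [hb, hb.ne', hb.not_gt, h1, h1.le, h1.ne]
      · simp [hb, hb.ne', hb.not_gt]
      · simp [hb.ne', hb.not_gt, h1.not_ge, h1.ne', h1.not_gt]
  have := Finset.sum_range_sub p n
  rw [show p n = p 0 by
    have h0 := h 0; have h1 := h 1
    rw [zero_add] at h0
    simp only [hp, h0, zero_add, add_comm n 1, h1], sub_self] at this
  have e : downs u n - ups u n = ∑ k ∈ Finset.range n, (p (k + 1) - p k) := by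
    rw [downs, ups, ← Finset.sum_sub_distrib]
    exact Finset.sum_congr rfl fun k _ => key k
  rw [← sub_eq_zero, e, this]

/-- The total turning up to, and without, the vertex `k + 1`. -/
def partialTurn (u : ℕ → V) (k : ℕ) : ℝ := ∑ j ∈ Finset.range k, turn u j

theorem partialTurn_add (u : ℕ → V) (k m : ℕ) :
    partialTurn u (k + m) - partialTurn u k =
      ∑ j ∈ Finset.range m, turn (fun i => u (i + k)) j := by
  unfold partialTurn
  rw [Finset.sum_range_add, add_sub_cancel_left]
  refine Finset.sum_congr rfl fun j _ => ?_
  rw [turn_shift, add_comm]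

theorem ups_add (u : ℕ → V) (k m : ℕ) :
    0 ≤ ups u (k + m) - ups u k := by
  classical
  unfold ups
  rw [Finset.sum_range_add, add_sub_cancel_left]
  exact Finset.sum_nonneg fun i _ => by split_ifs <;> norm_num

theorem downs_add (u : ℕ → V) (k m : ℕ) :
    0 ≤ downs u (k + m) - downs u k := by
  classical
  unfold downs
  rw [Finset.sum_range_add, add_sub_cancel_left]
  exact Finset.sum_nonneg fun i _ => by split_ifs <;> norm_num

theorem one_le_ups_add {u : ℕ → V} {k m : ℕ} (hm : 1 ≤ m) (h0 : (u k).2 ≤ 0)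
    (h1 : 0 < (u (k + 1)).2) : 1 ≤ ups u (k + m) - ups u k := by
  have := ups_add u (k + 1) (m - 1)
  rw [show k + 1 + (m - 1) = k + m by omega] at this
  have e : ups u (k + 1) = ups u k + 1 := by
    classical
    unfold ups
    rw [Finset.sum_range_succ, if_pos ⟨h0, h1⟩]
  omega

theorem one_le_downs_add {u : ℕ → V} {k m : ℕ} (hm : 1 ≤ m) (h0 : 0 ≤ (u k).2)
    (h1 : (u (k + 1)).2 < 0) : 1 ≤ downs u (k + m) - downs u k := by
  have := downs_add u (k + 1) (m - 1)
  rw [show k + 1 + (m - 1) = k + m by omega] at this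
  have e : downs u (k + 1) = downs u k + 1 := by
    classical
    unfold downs
    rw [Finset.sum_range_succ, if_pos ⟨h0, h1⟩]
  omega

/-- From a vertex where the polygon enters the upper half space, it turns by less than a half turn
until it leaves it again. -/
theorem IsPolygon.exists_run {n : ℕ} {u : ℕ → V} (hu : IsPolygon n u) (ha : Admissible u)
    {k l : ℕ} (hl : l ≤ n) (hkl : k < l) (h0 : (u k).2 ≤ 0) (h1 : 0 < (u (k + 1)).2)
    (hend : k + 1 = l + 1 ∨ (u l).2 ≤ 0 ∨ (0 < k ∧ (u (l + 1)).2 ≤ 0)) :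
    ∃ m, 1 ≤ m ∧ k + m ≤ l ∧ |partialTurn u (k + m) - partialTurn u k| < Real.pi ∧
      0 < (u (k + m)).2 ∧ (u (k + m + 1)).2 ≤ 0 := by
  classical
  -- The last clause secures `m + 1 ≤ n` for `k = 0`; for positive `k` it follows from `k + m ≤ l ≤
  -- n`.
  have ex : ∃ m, 1 ≤ m ∧ (u (k + m + 1)).2 ≤ 0 ∧ k + m ≤ l ∧ (k = 0 → m < n) := by
    rcases hend with h | h | h
    · omega
    · have : k + 1 ≠ l := by rintro rfl; linarith
      refine ⟨l - k - 1, by omega, ?_, by omega, by omega⟩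
      rwa [show k + (l - k - 1) + 1 = l by omega]
    · refine ⟨l - k, by omega, ?_, by omega, by omega⟩
      rw [show k + (l - k) + 1 = l + 1 by omega]
      exact h.2
  obtain ⟨hm1, hm2, hm3, hm4⟩ := Nat.find_spec ex
  have hmin := fun j => Nat.find_min ex (m := j)
  generalize Nat.find ex = m at *
  have hpos : ∀ j, 1 ≤ j → j ≤ m → 0 < (u (j + k)).2 := by
    intro j hj1 hj2
    rcases Nat.lt_or_ge 1 j with hj | hj
    · by_contra! hc
      refine hmin (j - 1) (by omega) ⟨by omega, ?_, by omega, by omega⟩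
      rwa [show k + (j - 1) + 1 = j + k by omega]
    · rw [show j + k = k + 1 by omega]
      exact h1
  refine ⟨m, hm1, hm3, ?_, ?_, hm2⟩
  · rw [partialTurn_add]
    refine (hu.shift k).abs_sum_turn_lt (ha.shift k) hm1 (by omega) (by simpa using h0) hpos ?_
    rwa [show m + 1 + k = k + m + 1 by omega]
  · rw [add_comm]
    exact hpos m hm1 le_rfl

theorem partialTurn_neg (u : ℕ → V) (k : ℕ) :
    partialTurn (fun k => -u k) k = partialTurn u k := by
  unfold partialTurn
  simp only [turn_neg]

theorem IsPolygon.abs_partialTurn_lt_of_up {n : ℕ} {u : ℕ → V} (hu : IsPolygon n u)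
    (ha : Admissible u) (h0 : (u 0).2 ≤ 0) (h1 : 0 < (u 1).2) :
    |partialTurn u n| < 2 * Real.pi * ups u n := by
  have h3 := hu.three_le
  have hn : (u n).2 ≤ 0 := by
    have := hu.periodic 0
    rw [zero_add] at this
    rwa [this]
  have hn1 : 0 < (u (n + 1)).2 := by
    have := hu.periodic 1
    rw [add_comm] at this
    rwa [this]
  have hpi := Real.pi_pos
  -- From an edge that meets height zero onward, each remaining rise or descent costs at most `π`.
  -- The inequality is not strict since nothing may remain; strictness comes from the first run,
  -- which is treated separately.
  have claim : ∀ l k, k + l = n → ¬(0 < (u k).2 ∧ 0 < (u (k + 1)).2) →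
      ¬((u k).2 < 0 ∧ (u (k + 1)).2 < 0) →
      |partialTurn u n - partialTurn u k| ≤
        Real.pi * (ups u n - ups u k + (downs u n - downs u k) : ℤ) := by
    intro l
    induction l using Nat.strong_induction_on with
    | _ l ih =>
      intro k hk hb1 hb2
      rcases Nat.eq_zero_or_pos l with rfl | hl
      · obtain rfl : k = n := by omega
        simp
      have step : ∀ m, 1 ≤ m → k + m ≤ n →
          ¬(0 < (u (k + m)).2 ∧ 0 < (u (k + m + 1)).2) →
          ¬((u (k + m)).2 < 0 ∧ (u (k + m + 1)).2 < 0) →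
          |partialTurn u (k + m) - partialTurn u k| ≤
            Real.pi * (ups u (k + m) - ups u k + (downs u (k + m) - downs u k) : ℤ) →
          |partialTurn u n - partialTurn u k| ≤
            Real.pi * (ups u n - ups u k + (downs u n - downs u k) : ℤ) := by
        intro m hm hmn h1 h2 h3
        have := ih (l - m) (by omega) (k + m) (by omega) h1 h2
        have t := abs_sub_le (partialTurn u n) (partialTurn u (k + m)) (partialTurn u k)
        push_cast at *
        nlinarith
      have one : ∀ m, 1 ≤ ups u (k + m) - ups u k + (downs u (k + m) - downs u k) →
          |partialTurn u (k + m) - partialTurn u k| < Real.pi →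
          |partialTurn u (k + m) - partialTurn u k| ≤
            Real.pi * (ups u (k + m) - ups u k + (downs u (k + m) - downs u k) : ℤ) := by
        intro m hm ht
        have : (1 : ℝ) ≤ (ups u (k + m) - ups u k + (downs u (k + m) - downs u k) : ℤ) := by
          exact_mod_cast hm
        nlinarith
      rcases lt_trichotomy (u (k + 1)).2 0 with h | h | h
      · have hk0 : 0 < k := by
          rcases Nat.eq_zero_or_pos k with rfl | hk0
          · simp at h; linarith
          · exact hk0
        have hk1 : 0 ≤ (u k).2 := by by_contra! hc; exact hb2 ⟨hc, h⟩
        -- A lower run may still be going at vertex `n`. It ends there, since vertex `n + 1` is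
        -- above; this is why the polygon was made to start with a rise.
        obtain ⟨m, hm1, hm2, hm3, hm4, hm5⟩ := hu.neg.exists_run ha.neg (k := k) (l := n) le_rfl
          (by omega) (by simpa using hk1) (by simpa using h)
          (Or.inr (Or.inr ⟨hk0, by simpa using hn1.le⟩))
        simp only [partialTurn_neg, Prod.snd_neg, Left.neg_nonpos_iff, Left.neg_pos_iff]
          at hm3 hm4 hm5
        refine step m hm1 hm2 (fun h => by linarith [h.1]) (fun h => by linarith [h.2])
          (one m ?_ hm3)
        have := one_le_downs_add hm1 hk1 h
        have := ups_add u k m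
        omega
      · have ht : turn u k = 0 :=
          (secant_div_slit (hu.det_ne_zero k (k + 1) (k + 2) (by omega) (by omega) (by omega))
            (fun h => ha k h)).2.2.2 h
        refine step 1 le_rfl (by omega) (fun h' => by linarith [h'.1]) (fun h' => by linarith [h'.1])
          ?_
        rw [partialTurn_add]
        simp only [Finset.sum_range_one, turn_shift, zero_add, ht, abs_zero]
        have h1 := ups_add u k 1
        have h2 := downs_add u k 1
        have : (0 : ℝ) ≤ (ups u (k + 1) - ups u k + (downs u (k + 1) - downs u k) : ℤ) := by
          exact_mod_cast add_nonneg h1 h2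
        positivity
      · have hk1 : (u k).2 ≤ 0 := by by_contra! hc; exact hb1 ⟨hc, h⟩
        obtain ⟨m, hm1, hm2, hm3, hm4, hm5⟩ := hu.exists_run ha (k := k) (l := n) le_rfl
          (by omega) hk1 h (Or.inr (Or.inl hn))
        refine step m hm1 hm2 (fun h => by linarith [h.2]) (fun h => by linarith [h.1])
          (one m ?_ hm3)
        have := one_le_ups_add hm1 hk1 h
        have := downs_add u k m
        omega
  -- The first run supplies the strict inequality. Equality of rises and descents then turns `π *
  -- (ups + downs)` into `2 * π * ups`.
  obtain ⟨m, hm1, hm2, hm3, hm4, hm5⟩ := hu.exists_run ha (k := 0) (l := n) le_rfl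
    (by omega) h0 h1 (Or.inr (Or.inl hn))
  have c := claim (n - (0 + m)) (0 + m) (by omega) (fun h => by linarith [h.2])
    (fun h => by linarith [h.1])
  have e1 : ups u 0 = 0 := by simp [ups]
  have e2 : partialTurn u 0 = 0 := by simp [partialTurn]
  have e3 := one_le_ups_add (u := u) (k := 0) hm1 h0 h1
  have e4 := downs_add u 0 m
  have e5 : downs u 0 = 0 := by simp [downs]
  have t := abs_sub_le (partialTurn u n) (partialTurn u (0 + m)) 0
  rw [downs_eq_ups hu.periodic ha] at c
  rw [e2] at hm3
  have : (1 : ℝ) ≤ (ups u (0 + m) + downs u (0 + m) : ℤ) := by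
    exact_mod_cast (by omega : 1 ≤ ups u (0 + m) + downs u (0 + m))
  push_cast at *
  simp only [sub_zero] at *
  nlinarith

/-- A polygon that crosses height zero turns by less than one full turn for each time that it
goes up. -/
theorem IsPolygon.abs_partialTurn_lt {n : ℕ} {u : ℕ → V} (hu : IsPolygon n u)
    (ha : Admissible u) {s : ℕ} (h0 : (u s).2 ≤ 0) (h1 : 0 < (u (s + 1)).2) :
    |partialTurn u n| < 2 * Real.pi * ups u n := by
  have := (hu.shift s).abs_partialTurn_lt_of_up (ha.shift s) (by simpa using h0)
    (by simpa [add_comm] using h1)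
  rw [ups_shift hu.periodic] at this
  unfold partialTurn at *
  simp only [turn_shift] at this
  rwa [sum_range_shift (turn_periodic hu.periodic)] at this

/-- A polygon that does not cross height zero turns by less than two full turns. -/
theorem IsPolygon.abs_partialTurn_lt_of_forall {n : ℕ} {u : ℕ → V} (hu : IsPolygon n u)
    (ha : Admissible u) (h : ∀ k, (u k).2 ≤ 0 → (u (k + 1)).2 ≤ 0) :
    |partialTurn u n| < 4 * Real.pi ∧ ups u n = 0 := by
  classical
  refine ⟨?_, ?_⟩
  · by_cases hc : ∃ s, (u s).2 ≤ 0
    · obtain ⟨s, hs⟩ := hc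
      have all : ∀ k, (u (k + s)).2 ≤ 0 := by
        intro k
        induction k with
        | zero => simpa using hs
        | succ k ih => rw [add_right_comm]; exact h _ ih
      -- A vertex of height zero would need a neighbour above, so from here on the heights are
      -- strictly negative.
      have all2 : ∀ k, (u (k + 1 + s)).2 < 0 := by
        intro k
        refine lt_of_le_of_ne (all _) fun e => ?_
        have := ha (k + s) (by rw [add_right_comm]; exact e)
        have h1 := all k
        have h2 := all (k + 2)
        rw [add_right_comm] at h2
        nlinarith
      have := ((hu.shift s).shift 1).neg.abs_sum_turn_lt_of_pos (fun k => by simpa using all2 k)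
      simp only [turn_neg] at this
      simp only [add_assoc, turn_shift u (1 + s)] at this
      rwa [sum_range_shift (turn_periodic hu.periodic)] at this
    · push Not at hc
      exact hu.abs_sum_turn_lt_of_pos hc
  · unfold ups
    refine Finset.sum_eq_zero fun k _ => if_neg fun hk => ?_
    linarith [h k hk.1, hk.2]

end SphericalPolygon
end

/-! ### Parity of the rotation number in generic position. -/

noncomputable section
namespace SphericalPolygon

open Classical in
/-- The sign of a nonzero real number as an element of `ℤ/2`. -/
def sg (x : ℝ) : ZMod 2 := if x < 0 then 1 else 0

theorem sg_neg {x : ℝ} (h : x ≠ 0) : sg (-x) = 1 + sg x := by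
  unfold sg
  rcases lt_or_gt_of_ne h with h | h
  · simp [h, show ¬ (0 < x) from h.not_gt]; decide
  · simp [h, h.not_gt]

theorem sg_mul {x y : ℝ} (hx : x ≠ 0) (hy : y ≠ 0) : sg (x * y) = sg x + sg y := by
  unfold sg
  rcases lt_or_gt_of_ne hx with h | h <;> rcases lt_or_gt_of_ne hy with k | k
  · simp [h, k, (mul_pos_of_neg_of_neg h k).not_gt]; decide
  · simp [h, k.not_gt, mul_neg_of_neg_of_pos h k]
  · simp [h.not_gt, k, mul_neg_of_pos_of_neg h k]
  · simp [h.not_gt, k.not_gt, (mul_pos h k).not_gt]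

/-- Three nonzero numbers with sum zero do not all have the same sign. -/
theorem sg_relation {x y z : ℝ} (hx : x ≠ 0) (hy : y ≠ 0) (hz : z ≠ 0) (h : x + y + z = 0) :
    (1 + sg x + sg y) * (1 + sg x + sg z) = 0 := by
  unfold sg
  rcases lt_or_gt_of_ne hx with h1 | h1 <;> rcases lt_or_gt_of_ne hy with h2 | h2 <;>
    rcases lt_or_gt_of_ne hz with h3 | h3 <;>
    first
    | (exfalso; linarith)
    | (simp only [h1, h2, h3, h1.not_gt, h2.not_gt, h3.not_gt, if_true, if_false]; decide)

/-- The relation between signs that comes from a three-term Grassmann-Plücker relation. -/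
theorem sg_plucker {a b c d e f : ℝ} (ha : a ≠ 0) (hb : b ≠ 0) (hc : c ≠ 0) (hd : d ≠ 0)
    (he : e ≠ 0) (hf : f ≠ 0) (h : a * b - c * d + e * f = 0) :
    (sg a + sg b + (sg c + sg d)) * (1 + (sg a + sg b) + (sg e + sg f)) = 0 := by
  have := sg_relation (mul_ne_zero ha hb) (neg_ne_zero.2 (mul_ne_zero hc hd))
    (mul_ne_zero he hf) (by linarith)
  rw [sg_neg (mul_ne_zero hc hd), sg_mul ha hb, sg_mul hc hd, sg_mul he hf] at this
  rw [← this]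
  generalize sg a + sg b = x
  generalize sg c + sg d = y
  generalize sg e + sg f = z
  revert x y z
  decide

-- The finite core of `ConeDisjoint.bits`: the `E` are signs of areas in the projection along the
-- real axis, the `D` signs of determinants. The hypotheses are the Grassmann-Plücker sign
-- conditions for four vectors together with that axis, and the condition that the edges do not
-- cross.
set_option synthInstance.maxSize 4000 in
set_option synthInstance.maxHeartbeats 400000 in
theorem bits_crossing : ∀ Eab Eac Ead Ebc Ebd Ecd : ZMod 2,
    (Eab + Ecd + (Eac + Ebd)) * (1 + (Eab + Ecd) + (Ead + Ebc)) = 0 →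
    ∀ Dabc Dabd Dacd Dbcd : ZMod 2,
    (Eab + Dacd + (Eac + Dabd)) * (1 + (Eab + Dacd) + (Ead + Dabc)) = 0 →
    (Eab + Dbcd + (Ebc + Dabd)) * (1 + (Eab + Dbcd) + (Ebd + Dabc)) = 0 →
    (Eac + Dbcd + (Ebc + Dacd)) * (1 + (Eac + Dbcd) + (Ecd + Dabc)) = 0 →
    (Ead + Dbcd + (Ebd + Dacd)) * (1 + (Ead + Dbcd) + (Ecd + Dabd)) = 0 →
    (Dbcd + Dacd) * (Dabd + Dabc) * (Dbcd + Dabd) = 0 →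
    (Eac + Ead) * (Eac + Ecd) * (Dacd + Ecd) + (Ebc + Ebd) * (Ebc + Ecd) * (Dbcd + Ecd) +
      (Eac + Ebc) * (1 + Eac + Eab) * (Dabc + Eab + 1) +
      (Ead + Ebd) * (1 + Ead + Eab) * (Dabd + Eab + 1) = 0 := by
  decide +kernel

/-- The determinant of two vectors after projection along the real axis of `ℂ × ℝ`. -/
def area (x y : V) : ℝ := (secant x y).im

theorem area_swap (x y : V) : area y x = -area x y := by
  simp [area, secant_swap x y]

theorem sg_area_swap {x y : V} (h : area x y ≠ 0) : sg (area y x) = 1 + sg (area x y) := by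
  rw [area_swap, sg_neg h]

theorem area_plucker (a b c d : V) :
    area a b * area c d - area a c * area b d + area a d * area b c = 0 := by
  unfold area secant; simp; ring

theorem sg_area_plucker {a b c d : V} (hab : area a b ≠ 0) (hac : area a c ≠ 0)
    (had : area a d ≠ 0) (hbc : area b c ≠ 0) (hbd : area b d ≠ 0) (hcd : area c d ≠ 0) :
    (sg (area a b) + sg (area c d) + (sg (area a c) + sg (area b d))) *
      (1 + (sg (area a b) + sg (area c d)) + (sg (area a d) + sg (area b c))) = 0 :=
  sg_plucker hab hcd hac hbd had hbc (area_plucker a b c d)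

/-- In generic position, this is `1` if the half plane bounded by the real axis through `a` meets
the edge from `c` to `d`, and `0` otherwise. -/
def meets (a c d : V) : ZMod 2 :=
  (1 + sg (area c a) + sg (area a d)) * (1 + sg (area c a) + sg (area c d))

/-- Indicates that the edge from `c` to `d` passes the vertex `a` on one side. -/
def above (a c d : V) : ZMod 2 := meets a c d * (sg (det3 a c d) + sg (area c d))

/-- Indicates that the edge from `c` to `d` passes the vertex `a` on the other side. -/
def below (a c d : V) : ZMod 2 := meets a c d * (sg (det3 a c d) + sg (area c d) + 1)

theorem above_add_below (a c d : V) : above a c d + below a c d = meets a c d := by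
  unfold above below
  generalize sg (det3 a c d) + sg (area c d) = x
  generalize meets a c d = y
  revert x y; decide

/-- Four vectors satisfy a linear relation with their `3 × 3` minors as coefficients. The excluded
sign patterns are the two for which this relation exhibits a common vector of both cones. -/
theorem sg_not_cross {a b c d : V} (h : ConeDisjoint a b c d) (h1 : det3 b c d ≠ 0)
    (h2 : det3 a c d ≠ 0) (h3 : det3 a b d ≠ 0) (h4 : det3 a b c ≠ 0) :
    (sg (det3 b c d) + sg (det3 a c d)) * (sg (det3 a b d) + sg (det3 a b c)) *
      (sg (det3 b c d) + sg (det3 a b d)) = 0 := by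
  have rel : det3 b c d • a - det3 a c d • b + det3 a b d • c - det3 a b c • d = 0 := by
    unfold det3 wedge
    apply Prod.ext
    · apply Complex.ext <;> simp <;> ring
    · simp; ring
  generalize det3 b c d = x at *
  generalize det3 a c d = y at *
  generalize det3 a b d = z at *
  generalize det3 a b c = w at *
  unfold sg
  rcases lt_or_gt_of_ne h1 with k1 | k1 <;> rcases lt_or_gt_of_ne h2 with k2 | k2 <;>
    rcases lt_or_gt_of_ne h3 with k3 | k3 <;> rcases lt_or_gt_of_ne h4 with k4 | k4 <;>
    first
    | (simp only [k1, k2, k3, k4, k1.not_gt, k2.not_gt, k3.not_gt, k4.not_gt, if_true,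
        if_false]; decide)
    | (exfalso
       refine h1 (h x (-y) (-z) w k1.le (by linarith) (by linarith) k4.le ?_).1
       rw [← sub_eq_zero, ← rel]; module)
    | (exfalso
       refine h1 (neg_eq_zero.1 (h (-x) y z (-w) (by linarith) k2.le k3.le (by linarith) ?_).1)
       rw [← sub_eq_zero, ← neg_eq_zero, ← rel]; module)

/-- Disjoint edges see their endpoints consistently. -/
theorem ConeDisjoint.bits {a b c d : V} (h : ConeDisjoint a b c d) (hab : area a b ≠ 0)
    (hac : area a c ≠ 0) (had : area a d ≠ 0) (hbc : area b c ≠ 0) (hbd : area b d ≠ 0)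
    (hcd : area c d ≠ 0) (h1 : det3 b c d ≠ 0) (h2 : det3 a c d ≠ 0) (h3 : det3 a b d ≠ 0)
    (h4 : det3 a b c ≠ 0) :
    above a c d + above b c d + below c a b + below d a b = 0 := by
  -- In the projection along the real axis the two edges span sectors. If these overlap, each of the
  -- two ends of the overlap is an endpoint of one edge inside the sector of the other. As the edges
  -- are disjoint, the order of the two along the axis is constant on the overlap, so the four
  -- indicators add up to zero or two.
  have := bits_crossing _ _ _ _ _ _ (sg_area_plucker hab hac had hbc hbd hcd)
    (sg (det3 a b c)) (sg (det3 a b d)) (sg (det3 a c d)) (sg (det3 b c d))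
    (sg_plucker hab h2 hac h3 had h4 (by unfold area secant det3 wedge; simp; ring))
    (sg_plucker hab h1 hbc h3 hbd h4 (by unfold area secant det3 wedge; simp; ring))
    (sg_plucker hac h1 hbc h2 hcd h4 (by unfold area secant det3 wedge; simp; ring))
    (sg_plucker had h1 hbd h2 hcd h3 (by unfold area secant det3 wedge; simp; ring))
    (sg_not_cross h h1 h2 h3 h4)
  rw [← this]
  unfold above below meets
  rw [sg_area_swap hac, sg_area_swap hbc, sg_area_swap hbd,
    ← det3_rotate c a b, ← det3_rotate d a b]
  have e1 : ∀ x y : ZMod 2, 1 + x + (1 + y) = x + y := by decide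
  have e2 : ∀ x : ZMod 2, 1 + (1 + x) = x := by decide
  simp only [e1, e2]

theorem meets_comm {a c d : V} (hca : area a c ≠ 0) (had : area a d ≠ 0) (hcd : area c d ≠ 0) :
    meets a d c = meets a c d := by
  unfold meets
  rw [sg_area_swap hca, sg_area_swap had, sg_area_swap hcd]
  generalize sg (area a c) = x
  generalize sg (area a d) = y
  generalize sg (area c d) = z
  revert x y z; decide

theorem above_add_below_corner {a b c : V} (hab : area a b ≠ 0) (hbc : area b c ≠ 0) :
    above a b c + below c a b =
      (sg (area a b) + sg (area b c)) * (sg (det3 a b c) + sg (area b c)) := by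
  unfold above below meets
  rw [sg_area_swap hab, sg_area_swap hbc, ← det3_rotate c a b]
  generalize sg (area a b) = x
  generalize sg (area a c) = y
  generalize sg (area b c) = z
  generalize sg (det3 a b c) = w
  revert x y z w; decide

theorem meets_corner {a b c : V} (hab : area a b ≠ 0) (hbc : area b c ≠ 0) :
    meets a b c + meets c a b = sg (area a b) + sg (area b c) := by
  unfold meets
  rw [sg_area_swap hab, sg_area_swap hbc]
  generalize sg (area a b) = x
  generalize sg (area a c) = y
  generalize sg (area b c) = z
  revert x y z; decide

/-- Two sectors of less than half a turn have zero or two boundary rays in each other, hence an even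
number. This allows the ray through `a` to be replaced by the ray through `r`. -/
theorem meets_sector {a r c d : V} (har : area a r ≠ 0) (hac : area a c ≠ 0)
    (had : area a d ≠ 0) (hrc : area r c ≠ 0) (hrd : area r d ≠ 0) (hcd : area c d ≠ 0) :
    meets a c d = meets r c d + meets c a r + meets d a r := by
  have := sg_area_plucker har hac had hrc hrd hcd
  unfold meets
  rw [sg_area_swap hac, sg_area_swap hrc, sg_area_swap hrd]
  revert this
  generalize sg (area a r) = x1
  generalize sg (area a c) = x2
  generalize sg (area a d) = x3
  generalize sg (area r c) = x4
  generalize sg (area r d) = x5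
  generalize sg (area c d) = x6
  revert x1 x2 x3 x4 x5 x6; decide

theorem meets_sector_corner {a r c : V} (hrc : area r c ≠ 0) :
    meets c a r = meets r a c + 1 + sg (area a r) + sg (area a c) := by
  unfold meets
  rw [sg_area_swap hrc]
  generalize sg (area a r) = x1
  generalize sg (area a c) = x2
  generalize sg (area r c) = x4
  revert x1 x2 x4; decide

/-- The auxiliary direction of height zero. -/
def sidePole : V := (Complex.I, 0)

theorem area_sidePole (x : V) : area x sidePole = x.2 := by
  simp [area, secant, sidePole]

theorem sidePole_area_ne {x : V} (h : x.2 ≠ 0) : area sidePole x ≠ 0 := by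
  rw [area_swap, area_sidePole]; simpa using h

/-- The ray through `sidePole` has height zero, so this detects whether the edge passes height zero
on the side of positive imaginary part. -/
theorem meets_sidePole {c d : V} (hd : d.2 ≠ 0) :
    meets sidePole c d = (sg c.2 + sg d.2) * (1 + sg c.2 + sg (area c d)) := by
  unfold meets
  have := sg_area_swap (x := d) (y := sidePole) (by rwa [area_sidePole])
  rw [this, area_sidePole, area_sidePole]
  generalize sg c.2 = x
  generalize sg d.2 = y
  generalize sg (area c d) = z
  revert x y z; decide

/-- The left side counts, with an orientation condition, the vertices where the projection along the
real axis folds back. By summation over pairs, this count is reduced to the edges seen from one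
vertex, and from there to the edges that meet one half plane of height zero. -/
theorem IsPolygon.sum_corner {n : ℕ} {u : ℕ → V} (hu : IsPolygon n u)
    (hh : ∀ k, (u k).2 ≠ 0) (hE : ∀ i j, i < j → j < i + n → area (u i) (u j) ≠ 0) :
    ∑ k ∈ Finset.range n, (sg (area (u k) (u (k + 1))) + sg (area (u (k + 1)) (u (k + 2)))) *
        (sg (det3 (u k) (u (k + 1)) (u (k + 2))) + sg (area (u (k + 1)) (u (k + 2)))) =
      ∑ k ∈ Finset.range n, meets sidePole (u k) (u (k + 1)) + 1 := by
  have h3 := hu.three_le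
  obtain ⟨M, rfl⟩ : ∃ M, n = M + 2 := ⟨n - 2, by omega⟩
  have hM : M ≠ 0 := by omega
  have hun : u (M + 2) = u 0 := by simpa using hu.periodic 0
  have hun1 : u (M + 3) = u 1 := by
    have := hu.periodic 1
    rwa [show 1 + (M + 2) = M + 3 by omega] at this
  have two : (2 : ZMod 2) = 0 := by decide
  have corner : ∀ k, (sg (area (u k) (u (k + 1))) + sg (area (u (k + 1)) (u (k + 2)))) *
      (sg (det3 (u k) (u (k + 1)) (u (k + 2))) + sg (area (u (k + 1)) (u (k + 2)))) =
      above (u k) (u (k + 1)) (u (k + 2)) + below (u (k + 2)) (u k) (u (k + 1)) := fun k =>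
    (above_add_below_corner (hE _ _ (by omega) (by omega))
      (hE _ _ (by omega) (by omega))).symm
  simp only [corner]
  -- The one-form records passages of an edge on one side of a vertex, with opposite sides for rows
  -- and columns. Modulo two, `ConeDisjoint.bits` says that it is closed.
  have grid := sum_diagonal_eq_sum_sides (fun i j => above (u i) (u j) (u (j + 1)))
    (fun i j => below (u j) (u i) (u (i + 1)))
    (fun k => above (u k) (u (k + 1)) (u (k + 2)) + below (u (k + 2)) (u k) (u (k + 1))) M
    (fun k _ => rfl)
    (fun i j hij hj hc => by
      have hjn : j + 1 < i + (M + 2) := by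
        rcases Nat.eq_zero_or_pos i with rfl | h
        · have := hc rfl; omega
        · omega
      have := (hu.disjoint i j hij (by omega)).bits (hE _ _ (by omega) (by omega))
        (hE _ _ (by omega) (by omega)) (hE _ _ (by omega) (by omega))
        (hE _ _ (by omega) (by omega)) (hE _ _ (by omega) (by omega))
        (hE _ _ (by omega) (by omega)) (hu.det_ne_zero _ _ _ (by omega) (by omega) (by omega))
        (hu.det_ne_zero _ _ _ (by omega) (by omega) (by omega))
        (hu.det_ne_zero _ _ _ (by omega) (by omega) (by omega))
        (hu.det_ne_zero _ _ _ (by omega) (by omega) (by omega))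
      linear_combination this - (below (u j) (u i) (u (i + 1)) +
        above (u (i + 1)) (u j) (u (j + 1))) * two)
  rw [if_neg hM] at grid
  simp only [zero_add, hun, show M + 1 + 1 = M + 2 from rfl] at grid
  rw [show M + 2 = M + 1 + 1 from rfl, Finset.sum_range_succ, grid]
  simp only [show M + 1 + 1 = M + 2 from rfl, show M + 1 + 2 = M + 3 from rfl, hun, hun1]
  -- The row and the column at `u 0` record both sides and so combine to `meets`. Moving the ray
  -- from `u 0` to `sidePole` produces differences that telescope.
  have row : ∑ j ∈ Finset.range M, above (u 0) (u (j + 1)) (u (j + 2)) +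
      ∑ j ∈ Finset.range M, below (u 0) (u (j + 1)) (u (j + 2)) =
      ∑ j ∈ Finset.range M, meets sidePole (u (j + 1)) (u (j + 2)) +
        (meets (u 1) (u 0) sidePole + meets (u (M + 1)) (u 0) sidePole) := by
    rw [← Finset.sum_add_distrib]
    have tele := Finset.sum_range_sub (fun j => meets (u (j + 1)) (u 0) sidePole) M
    have : meets (u 1) (u 0) sidePole + meets (u (M + 1)) (u 0) sidePole =
        ∑ j ∈ Finset.range M,
          (meets (u (j + 1 + 1)) (u 0) sidePole - meets (u (j + 1)) (u 0) sidePole) := by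
      rw [tele]
      simp only [zero_add]
      linear_combination meets (u 1) (u 0) sidePole * two
    rw [this, ← Finset.sum_add_distrib]
    refine Finset.sum_congr rfl fun j hj => ?_
    rw [Finset.mem_range] at hj
    rw [above_add_below, meets_sector (r := sidePole) (by rw [area_sidePole]; exact hh 0)
      (hE _ _ (by omega) (by omega)) (hE _ _ (by omega) (by omega)) (sidePole_area_ne (hh _))
      (sidePole_area_ne (hh _)) (hE _ _ (by omega) (by omega))]
    linear_combination meets (u (j + 1)) (u 0) sidePole * two
  have a01 := hE 0 1 (by omega) (by omega)
  have a0M : area (u (M + 1)) (u 0) ≠ 0 := by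
    rw [← hun]; exact hE _ _ (by omega) (by omega)
  have v1 := meets_sector_corner (a := u 0) (r := sidePole) (c := u 1)
    (sidePole_area_ne (hh _))
  have v2 := meets_sector_corner (a := u 0) (r := sidePole) (c := u (M + 1))
    (sidePole_area_ne (hh _))
  rw [meets_comm (sidePole_area_ne (hh _)) (sidePole_area_ne (hh _)) a0M,
    sg_area_swap a0M] at v2
  have c1 := meets_corner (a := u (M + 1)) (b := u 0) (c := u 1) a0M a01
  have s1 := above_add_below (u (M + 1)) (u 0) (u 1)
  have s2 := above_add_below (u 1) (u (M + 1)) (u 0)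
  rw [Finset.sum_range_succ, Finset.sum_range_succ']
  simp only [zero_add, show ∀ j, j + 1 + 1 = j + 2 from fun _ => rfl, hun] at *
  linear_combination row + v1 + v2 + c1 + s1 + s2 + (sg (area (u 0) sidePole) +
    sg (area (u (M + 1)) (u 0)) + sg (area (u 0) (u 1)) + 1) * two


open Classical in
theorem crossing_zmod {a b : ℂ} (ha : a.im ≠ 0) (hb : b.im ≠ 0) (hw : wedge a b ≠ 0) :
    (crossing a b : ZMod 2) = (sg a.im + sg b.im) * (1 + sg (wedge a b) + sg a.im) := by
  unfold crossing sg
  rcases lt_or_gt_of_ne ha with k1 | k1 <;> rcases lt_or_gt_of_ne hb with k2 | k2 <;>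
    rcases lt_or_gt_of_ne hw with k3 | k3 <;>
    (simp only [k1, k2, k3, k1.not_gt, k2.not_gt, k3.not_gt, and_true, and_false, if_true,
      if_false]; decide)

theorem slit_of_im_ne_zero {z : ℂ} (h : z.im ≠ 0) : z ∈ Complex.slitPlane := Or.inr h

/-- The differences of arguments telescope around the closed polygon, so only the crossings of the
negative real axis remain. -/
theorem partialTurn_eq_sum_crossing {n : ℕ} {u : ℕ → V} (hu : ∀ k, u (k + n) = u k)
    (hs : ∀ k, secant (u k) (u (k + 1)) ∈ Complex.slitPlane)
    (hr : ∀ k, secant (u (k + 1)) (u (k + 2)) / secant (u k) (u (k + 1)) ∈ Complex.slitPlane) :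
    partialTurn u n = 2 * Real.pi * (∑ k ∈ Finset.range n,
      crossing (secant (u k) (u (k + 1))) (secant (u (k + 1)) (u (k + 2))) : ℤ) := by
  have e : ∀ k, turn u k = ((secant (u (k + 1)) (u (k + 1 + 1))).arg -
      (secant (u k) (u (k + 1))).arg) + 2 * Real.pi *
      (crossing (secant (u k) (u (k + 1))) (secant (u (k + 1)) (u (k + 2))) : ℤ) := fun k =>
    arg_div_eq_crossing (hs k) (hs (k + 1)) (hr k)
  unfold partialTurn
  rw [Finset.sum_congr rfl fun k _ => e k, Finset.sum_add_distrib, ← Finset.mul_sum,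
    Finset.sum_range_sub (fun k => (secant (u k) (u (k + 1))).arg)]
  have h0 := hu 0
  have h1 := hu 1
  rw [zero_add] at h0
  rw [add_comm] at h1
  rw [h0, h1]
  simp

open Classical in
theorem ups_zmod {u : ℕ → V} (hh : ∀ k, (u k).2 ≠ 0) (n : ℕ) :
    (ups u n : ZMod 2) = ∑ k ∈ Finset.range n, sg (u k).2 * (1 + sg (u (k + 1)).2) := by
  unfold ups sg
  push_cast
  refine Finset.sum_congr rfl fun k _ => ?_
  rcases lt_or_gt_of_ne (hh k) with k1 | k1 <;> rcases lt_or_gt_of_ne (hh (k + 1)) with k2 | k2 <;>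
    (simp only [k1, k2, k1.le, k1.not_gt, k2.not_gt, k1.not_ge, and_true, and_false, if_true,
      if_false]; decide)

/-- The parity of the number of full turns, in generic position. -/
theorem IsPolygon.turn_parity_of_generic {n : ℕ} {u : ℕ → V} (hu : IsPolygon n u)
    (hh : ∀ k, (u k).2 ≠ 0) (hE : ∀ i j, i < j → j < i + n → area (u i) (u j) ≠ 0) :
    ∃ d : ℤ, partialTurn u n = 2 * Real.pi * d ∧ Even (d - ups u n - 1) := by
  have h3 := hu.three_le
  have hd : ∀ k, det3 (u k) (u (k + 1)) (u (k + 2)) ≠ 0 := fun k =>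
    hu.det_ne_zero _ _ _ (by omega) (by omega) (by omega)
  have ha : ∀ k, area (u k) (u (k + 1)) ≠ 0 := fun k => hE _ _ (by omega) (by omega)
  have hw : ∀ k, wedge (secant (u k) (u (k + 1))) (secant (u (k + 1)) (u (k + 2))) ≠ 0 := by
    intro k
    rw [wedge_secant]
    exact mul_ne_zero (hh _) (hd k)
  refine ⟨_, partialTurn_eq_sum_crossing hu.periodic (fun k => slit_of_im_ne_zero (ha k))
    (fun k => slit_of_wedge_ne_zero (hw k)), ?_⟩
  rw [even_iff_two_dvd]
  refine (ZMod.intCast_zmod_eq_zero_iff_dvd _ 2).1 ?_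
  push_cast
  rw [ups_zmod hh]
  have c1 : ∀ k, (crossing (secant (u k) (u (k + 1))) (secant (u (k + 1)) (u (k + 2))) : ZMod 2) =
      (sg (area (u k) (u (k + 1))) + sg (area (u (k + 1)) (u (k + 2)))) *
        (1 + (sg (u (k + 1)).2 + sg (det3 (u k) (u (k + 1)) (u (k + 2)))) +
          sg (area (u k) (u (k + 1)))) := by
    intro k
    rw [crossing_zmod (ha k) (ha (k + 1)) (hw k), wedge_secant, sg_mul (hh _) (hd k)]
    rfl
  rw [Finset.sum_congr rfl fun k _ => c1 k]
  have s := hu.sum_corner hh hE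
  rw [Finset.sum_congr rfl fun k _ => meets_sidePole (hh (k + 1))] at s
  have t1 := sum_range_shift (n := n) (g := fun k => sg (area (u k) (u (k + 1))) * sg (u k).2)
    (fun k => by rw [add_right_comm, hu.periodic, hu.periodic]) 1
  have t2 := sum_range_shift (n := n) (g := fun k => sg (u k).2)
    (fun k => by rw [hu.periodic]) 1
  have two : (2 : ZMod 2) = 0 := by decide
  -- A local identity at each vertex. It combines a crossing, a corner term, a passage of `sidePole`
  -- and a rise; the last two brackets sum to zero modulo two by periodicity.
  have bits : ∀ e e' h h' D : ZMod 2, (e + e') * (1 + (h' + D) + e) + (e + e') * (D + e') +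
      (h + h') * (1 + h + e) + h * (1 + h') + (e' * h' + e * h) + (h' + h) = 0 := by decide
  have key := Finset.sum_eq_zero (s := Finset.range n) fun k _ =>
    bits (sg (area (u k) (u (k + 1)))) (sg (area (u (k + 1)) (u (k + 2)))) (sg (u k).2)
      (sg (u (k + 1)).2) (sg (det3 (u k) (u (k + 1)) (u (k + 2))))
  simp only [Finset.sum_add_distrib] at key
  simp only [show ∀ k, k + 1 + 1 = k + 2 from fun _ => rfl] at t1
  linear_combination key - s - t1 - t2 -
    (∑ k ∈ Finset.range n, sg (u k).2 * (1 + sg (u (k + 1)).2) + 1 +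
      ∑ k ∈ Finset.range n, (sg (u k).2 + sg (u (k + 1)).2) *
        (1 + sg (u k).2 + sg (area (u k) (u (k + 1)))) +
      ∑ k ∈ Finset.range n, sg (area (u k) (u (k + 1))) * sg (u k).2 +
      ∑ k ∈ Finset.range n, sg (u k).2) * two

end SphericalPolygon
end

/-! ### Parity for admissible polygons, by perturbation. -/

noncomputable section
namespace SphericalPolygon
open Filter Topology

/-- Multiplication of the horizontal component by a complex number. -/
def twist (c : ℂ) : V →ₗ[ℝ] V := (LinearMap.mulLeft ℝ c).prodMap LinearMap.id

theorem twist_apply (c : ℂ) (x : V) : twist c x = (c * x.1, x.2) := rfl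

theorem det3_twist (c : ℂ) (x y z : V) :
    det3 (twist c x) (twist c y) (twist c z) = Complex.normSq c * det3 x y z := by
  simp only [twist_apply, det3, wedge, Complex.mul_re, Complex.mul_im, Complex.normSq_apply]
  ring

theorem twist_injective {c : ℂ} (hc : c ≠ 0) : Function.Injective (twist c) := by
  intro x y h
  rw [twist_apply, twist_apply, Prod.mk.injEq] at h
  exact Prod.ext (mul_left_cancel₀ hc h.1) h.2

theorem secant_twist (c : ℂ) (x y : V) : secant (twist c x) (twist c y) = c * secant x y := by
  simp only [twist_apply, secant]; ring

theorem partialTurn_twist {c : ℂ} (hc : c ≠ 0) (u : ℕ → V) (n : ℕ) :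
    partialTurn (fun k => twist c (u k)) n = partialTurn u n := by
  unfold partialTurn turn
  simp only [secant_twist, mul_div_mul_left _ _ hc]

theorem IsPolygon.secant_ne_zero {n : ℕ} {u : ℕ → V} (hu : IsPolygon n u)
    (hh : ∀ k, (u k).2 ≠ 0) {i j : ℕ} (hij : i < j) (hj : j < i + n) :
    secant (u i) (u j) ≠ 0 := by
  have h3 := hu.three_le
  -- The third vertex for general position is `j + 1`, unless this is `i` again; then `i + 1`
  -- serves.
  by_cases h : j + 1 < i + n
  · exact (secant_ne_zero_of_det (hu.det_ne_zero i j (j + 1) hij (by omega) h) (hh _)).1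
  · have := hu.det_ne_zero i (i + 1) j (by omega) (by omega) hj
    rw [← det3_rotate, ← det3_rotate] at this
    have := (secant_ne_zero_of_det this (hh _)).1
    rw [secant_swap] at this
    simpa using this

/-- For a nonzero secant the imaginary part in question is affine in `t` and not identically zero,
so each pair of vertices excludes at most one `t`, and by periodicity there are finitely many pairs.
-/
theorem exists_twist (n : ℕ) {u : ℕ → V} (hu : ∀ k, u (k + n) = u k) (hn : 0 < n) :
    ∃ t : ℝ, ∀ i j, secant (u i) (u j) ≠ 0 → (((1 + t * Complex.I : ℂ) * secant (u i) (u j))).im ≠ 0 := by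
  have hfin : (⋃ p ∈ (Finset.range n ×ˢ Finset.range n : Finset (ℕ × ℕ)),
      {t : ℝ | secant (u p.1) (u p.2) ≠ 0 ∧
        ((1 + t * Complex.I : ℂ) * secant (u p.1) (u p.2)).im = 0}).Finite := by
    refine Set.Finite.biUnion (Finset.finite_toSet _) fun p _ => ?_
    refine Set.Subsingleton.finite fun s hs t ht => ?_
    have h1 := hs.2
    have h2 := ht.2
    have h0 := hs.1
    simp at h1 h2
    have hre : (secant (u p.1) (u p.2)).re ≠ 0 := by
      intro e
      rw [e] at h1
      apply h0
      apply Complex.ext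
      · exact e
      · simpa using h1
    have : (s - t) * (secant (u p.1) (u p.2)).re = 0 := by linarith
    have := (mul_eq_zero.1 this).resolve_right hre
    linarith
  obtain ⟨t, ht⟩ := hfin.infinite_compl.nonempty
  refine ⟨t, fun i j h0 h => ht ?_⟩
  have hi : u (i % n) = u i := Function.Periodic.map_mod_nat (f := u) hu i
  have hj : u (j % n) = u j := Function.Periodic.map_mod_nat (f := u) hu j
  simp only [Set.mem_iUnion]
  refine ⟨(i % n, j % n), ?_, ?_⟩
  · simp [Nat.mod_lt _ hn]
  · simp only [hi, hj]
    exact ⟨h0, h⟩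

theorem IsPolygon.turn_parity_of_general {n : ℕ} {u : ℕ → V} (hu : IsPolygon n u)
    (hh : ∀ k, (u k).2 ≠ 0) :
    ∃ d : ℤ, partialTurn u n = 2 * Real.pi * d ∧ Even (d - ups u n - 1) := by
  obtain ⟨t, ht⟩ := exists_twist n hu.periodic (by have := hu.three_le; omega)
  have hc : (1 + t * Complex.I : ℂ) ≠ 0 := by
    intro h
    have := congrArg Complex.re h
    simp at this
  obtain ⟨d, h1, h2⟩ := (hu.map (twist (1 + t * Complex.I)) (c := Complex.normSq _)
    (Complex.normSq_pos.2 hc).ne' (det3_twist _)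
    (twist_injective hc)).turn_parity_of_generic hh (fun i j hij hj => by
      rw [area, secant_twist]
      exact ht i j (hu.secant_ne_zero hh hij hj))
  refine ⟨d, ?_, h2⟩
  rwa [partialTurn_twist hc] at h1

/-- A small shear that moves all vectors off height zero. -/
def shear (ε : ℝ) : V →ₗ[ℝ] V where
  toFun x := (x.1, x.2 + ε * x.1.re + ε ^ 2 * x.1.im)
  map_add' x y := by
    apply Prod.ext
    · rfl
    · simp; ring
  map_smul' c x := by
    apply Prod.ext
    · rfl
    · simp; ring

theorem shear_fst (ε : ℝ) (x : V) : (shear ε x).1 = x.1 := rfl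

theorem shear_snd (ε : ℝ) (x : V) : (shear ε x).2 = x.2 + ε * x.1.re + ε ^ 2 * x.1.im := rfl

theorem det3_shear (ε : ℝ) (x y z : V) :
    det3 (shear ε x) (shear ε y) (shear ε z) = 1 * det3 x y z := by
  simp only [det3, shear_fst, shear_snd, wedge]
  ring

theorem shear_injective (ε : ℝ) : Function.Injective (shear ε) := by
  intro x y h
  have h1 : (shear ε x).1 = (shear ε y).1 := congrArg (fun z : V => z.1) h
  rw [shear_fst, shear_fst] at h1
  have h2 := congrArg (fun z : V => z.2) h
  rw [shear_snd, shear_snd, h1] at h2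
  exact Prod.ext h1 (by linarith)

theorem continuous_shear_snd (x : V) : Continuous fun ε => (shear ε x).2 := by
  simp only [shear_snd]
  fun_prop

theorem continuous_secant_shear (x y : V) :
    Continuous fun ε => secant (shear ε x) (shear ε y) := by
  simp only [secant, shear_snd, shear_fst]
  fun_prop

theorem shear_zero (x : V) : shear 0 x = x := by
  apply Prod.ext
  · rfl
  · rw [shear_snd]; simp

/-- The height after the shear is a polynomial in `ε` whose coefficients are the coordinates of `x`.
It is not the zero polynomial, so it has no small positive roots. -/
theorem eventually_shear_ne_zero {x : V} (hx : x ≠ 0) :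
    ∀ᶠ ε in 𝓝[>] (0 : ℝ), (shear ε x).2 ≠ 0 := by
  have nhds (f : ℝ → ℝ) (hf : Continuous f) (h0 : f 0 ≠ 0) : ∀ᶠ ε in 𝓝[>] (0 : ℝ), f ε ≠ 0 :=
    (hf.continuousAt.eventually_ne h0).filter_mono nhdsWithin_le_nhds
  by_cases h1 : x.2 = 0
  · by_cases h2 : x.1.re = 0
    · have h3 : x.1.im ≠ 0 := fun h3 => hx (Prod.ext (Complex.ext h2 h3) h1)
      filter_upwards [self_mem_nhdsWithin] with ε hε
      rw [shear_snd, h1, h2]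
      have : ε ≠ 0 := ne_of_gt hε
      simpa using ⟨this, h3⟩
    · filter_upwards [self_mem_nhdsWithin, nhds (fun ε => x.1.re + ε * x.1.im) (by fun_prop)
        (by simpa using h2)] with ε hε h
      rw [shear_snd, h1, show 0 + ε * x.1.re + ε ^ 2 * x.1.im = ε * (x.1.re + ε * x.1.im) by ring]
      exact mul_ne_zero (ne_of_gt hε) h
  · exact nhds _ (continuous_shear_snd x) (by rw [shear_zero]; exact h1)

theorem eventually_shear_sign (x : V) :
    ∀ᶠ ε in 𝓝[>] (0 : ℝ), (0 < x.2 → 0 < (shear ε x).2) ∧ (x.2 < 0 → (shear ε x).2 < 0) := by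
  have h := (continuous_shear_snd x).continuousAt (x := 0)
  rw [ContinuousAt, shear_zero] at h
  refine Eventually.filter_mono nhdsWithin_le_nhds (Eventually.and ?_ ?_)
  · by_cases k : 0 < x.2
    · filter_upwards [h.eventually_const_lt k] with ε hε _ using hε
    · exact Eventually.of_forall fun _ h => absurd h k
  · by_cases k : x.2 < 0
    · filter_upwards [h.eventually_lt_const k] with ε hε _ using hε
    · exact Eventually.of_forall fun _ h => absurd h k

open Classical in
/-- Moving the vertices of height zero of an admissible polygon does not change how often it goes
up. -/
theorem ups_eq_of_perturbation {n : ℕ} {u v : ℕ → V} (hu : ∀ k, u (k + n) = u k)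
    (hv : ∀ k, v (k + n) = v k) (ha : Admissible u) (hne : ∀ k, (v k).2 ≠ 0)
    (hpos : ∀ k, 0 < (u k).2 → 0 < (v k).2) (hneg : ∀ k, (u k).2 < 0 → (v k).2 < 0) :
    ups v n = ups u n := by
  -- This marks the vertices of height zero before a rise that the perturbation has already moved
  -- above. There the rise takes place one edge earlier than before.
  set p : ℕ → ℤ := fun k =>
    (if (u k).2 = 0 ∧ 0 < (u (k + 1)).2 ∧ 0 < (v k).2 then 1 else 0) with hp
  have key : ∀ k, (if (v k).2 ≤ 0 ∧ 0 < (v (k + 1)).2 then (1 : ℤ) else 0) -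
      (if (u k).2 ≤ 0 ∧ 0 < (u (k + 1)).2 then 1 else 0) = p (k + 1) - p k := by
    intro k
    have adm := ha k
    have n0 := hne k
    have n1 := hne (k + 1)
    have p0 := hpos k
    have p1 := hpos (k + 1)
    have m0 := hneg k
    have m1 := hneg (k + 1)
    simp only [hp, show k + 1 + 1 = k + 2 from rfl]
    clear_value p
    generalize (u k).2 = a at *
    generalize (u (k + 1)).2 = b at *
    generalize (u (k + 2)).2 = c at *
    generalize (v k).2 = a' at *
    generalize (v (k + 1)).2 = b' at *
    rcases lt_trichotomy b 0 with hb | rfl | hb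
    · have := m1 hb
      simp [hb.ne, hb.not_gt, this.not_gt]
    · have := adm rfl
      rcases lt_trichotomy a 0 with h1 | rfl | h1
      · have hc : 0 < c := by nlinarith
        simp [(m0 h1).le, hc, h1.ne]
      · simp at this
      · have hc : c < 0 := by nlinarith
        simp [h1.ne', hc.not_gt, (p0 h1).not_ge]
    · have := p1 hb
      rcases lt_trichotomy a 0 with h1 | rfl | h1
      · simp [hb, hb.ne', h1.le, h1.ne, (m0 h1).le, this]
      · rcases lt_or_gt_of_ne n0 with h2 | h2
        · simp [hb, hb.ne', h2.le, h2.not_gt, this]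
        · simp [hb, hb.ne', h2.not_ge, h2]
      · simp [hb.ne', h1.ne', h1.not_ge, (p0 h1).not_ge]
  have := Finset.sum_range_sub p n
  rw [show p n = p 0 by
    have h0 := hu 0; have h1 := hu 1; have h2 := hv 0
    rw [zero_add] at h0 h2
    simp only [hp, h0, h2, zero_add, add_comm n 1, h1], sub_self] at this
  have e : ups v n - ups u n = ∑ k ∈ Finset.range n, (p (k + 1) - p k) := by
    rw [ups, ups, ← Finset.sum_sub_distrib]
    exact Finset.sum_congr rfl fun k _ => key k
  rw [← sub_eq_zero, e, this]

/-- An affine preimage of the integers. Closedness lets integrality and parity pass to the limit of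
the perturbed turnings. -/
theorem isClosed_turns (r : ℤ) :
    IsClosed {x : ℝ | ∃ d : ℤ, x = 2 * Real.pi * d ∧ Even (d - r - 1)} := by
  have : {x : ℝ | ∃ d : ℤ, x = 2 * Real.pi * d ∧ Even (d - r - 1)} =
      (fun x : ℝ => (x / (2 * Real.pi) - r - 1) / 2) ⁻¹' Set.range ((↑) : ℤ → ℝ) := by
    ext x
    simp only [Set.mem_ofPred_eq, Set.mem_preimage, Set.mem_range]
    have hpi := Real.pi_ne_zero
    constructor
    · rintro ⟨d, rfl, m, hm⟩
      refine ⟨m, ?_⟩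
      have : (d : ℝ) - r - 1 = m + m := by exact_mod_cast hm
      field_simp
      linarith
    · rintro ⟨m, hm⟩
      refine ⟨2 * m + r + 1, ?_, m, by ring⟩
      push_cast
      field_simp at hm ⊢
      linarith
  rw [this]
  exact Int.isClosedEmbedding_coe_real.isClosed_range.preimage (by fun_prop)

theorem IsPolygon.secant_slit {n : ℕ} {u : ℕ → V} (hu : IsPolygon n u) (ha : Admissible u)
    (k : ℕ) : secant (u k) (u (k + 1)) ≠ 0 ∧
      secant (u (k + 1)) (u (k + 2)) / secant (u k) (u (k + 1)) ∈ Complex.slitPlane := by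
  have h3 := hu.three_le
  have := secant_div_slit (hu.det_ne_zero k (k + 1) (k + 2) (by omega) (by omega) (by omega))
    (fun h => ha k h)
  exact ⟨this.1, this.2.2.1⟩

/-- The total turning is a whole number of full turns, of the opposite parity to the number of
times that the polygon goes up through height zero. -/
theorem IsPolygon.turn_parity {n : ℕ} {u : ℕ → V} (hu : IsPolygon n u) (ha : Admissible u) :
    ∃ d : ℤ, partialTurn u n = 2 * Real.pi * d ∧ Even (d - ups u n - 1) := by
  have h3 := hu.three_le
  -- All quotients of consecutive secants lie in the slit plane, including those at vertices of
  -- height zero, so the turning is continuous at `ε = 0`.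
  have hlim : Tendsto (fun ε => partialTurn (fun k => shear ε (u k)) n) (𝓝[>] 0)
      (𝓝 (partialTurn u n)) := by
    refine Tendsto.mono_left ?_ nhdsWithin_le_nhds
    refine tendsto_finsetSum _ fun k _ => ?_
    have hs := hu.secant_slit ha k
    have c1 := (continuous_secant_shear (u k) (u (k + 1))).tendsto 0
    have c2 := (continuous_secant_shear (u (k + 1)) (u (k + 2))).tendsto 0
    rw [shear_zero, shear_zero] at c1 c2
    exact (Complex.continuousAt_arg hs.2).tendsto.comp (c2.div c1 hs.1)
  refine (isClosed_turns (ups u n)).mem_of_tendsto hlim ?_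
  have hne : ∀ k, u k ≠ 0 := by
    intro k h
    have := hu.det_ne_zero k (k + 1) (k + 2) (by omega) (by omega) (by omega)
    rw [h] at this
    simp [det3, wedge] at this
  have e1 : ∀ᶠ ε in 𝓝[>] (0 : ℝ), ∀ k ∈ Finset.range n, (shear ε (u k)).2 ≠ 0 :=
    (Finset.eventually_all _).2 fun k _ => eventually_shear_ne_zero (hne k)
  have e2 : ∀ᶠ ε in 𝓝[>] (0 : ℝ), ∀ k ∈ Finset.range n,
      (0 < (u k).2 → 0 < (shear ε (u k)).2) ∧ ((u k).2 < 0 → (shear ε (u k)).2 < 0) :=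
    (Finset.eventually_all _).2 fun k _ => eventually_shear_sign (u k)
  filter_upwards [e1, e2] with ε h1 h2
  have hmod : ∀ k, u (k % n) = u k := fun k => Function.Periodic.map_mod_nat (f := u) hu.periodic k
  have hlt : ∀ k, k % n ∈ Finset.range n := fun k =>
    Finset.mem_range.2 (Nat.mod_lt _ (by omega))
  have hv : IsPolygon n fun k => shear ε (u k) :=
    hu.map (shear ε) one_ne_zero (det3_shear ε) (shear_injective ε)
  have hgen : ∀ k, (shear ε (u k)).2 ≠ 0 := fun k => by
    have := h1 _ (hlt k); rwa [hmod] at this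
  obtain ⟨d, hd1, hd2⟩ := hv.turn_parity_of_general hgen
  refine ⟨d, hd1, ?_⟩
  rwa [ups_eq_of_perturbation hu.periodic hv.periodic ha hgen
    (fun k => by have := (h2 _ (hlt k)).1; rwa [hmod] at this)
    (fun k => by have := (h2 _ (hlt k)).2; rwa [hmod] at this)] at hd2

/-- The rotation number of a polygon without self-intersections is bounded by, and congruent to,
the number of times that it goes up through height zero, minus one. -/
theorem IsPolygon.exists_turn_bound {n : ℕ} {u : ℕ → V} (hu : IsPolygon n u)
    (ha : Admissible u) :
    ∃ d : ℤ, partialTurn u n = 2 * Real.pi * d ∧ |d| ≤ |1 - ups u n| ∧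
      Even (d - (1 - ups u n)) := by
  obtain ⟨d, h1, h2⟩ := hu.turn_parity ha
  have hpi := Real.pi_pos
  have habs : |partialTurn u n| = 2 * Real.pi * (|d| : ℤ) := by
    rw [h1, abs_mul, abs_of_pos (by positivity), Int.cast_abs]
  have even : Even (d - (1 - ups u n)) := by
    rw [Int.even_iff] at h2 ⊢; omega
  refine ⟨d, h1, ?_, even⟩
  -- With a rise, the strict bound `|d| < ups` between integers is the claim. Without one, `ups =
  -- 0`, and `|d| < 2` is enough.
  by_cases hc : ∃ s, (u s).2 ≤ 0 ∧ 0 < (u (s + 1)).2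
  · obtain ⟨s, hs1, hs2⟩ := hc
    have := hu.abs_partialTurn_lt ha hs1 hs2
    rw [habs] at this
    have : ((|d| : ℤ) : ℝ) < ups u n := lt_of_mul_lt_mul_left this (by positivity)
    have : |d| < ups u n := by exact_mod_cast this
    rw [abs_sub_comm 1, abs_of_nonneg (a := ups u n - 1) (by have := abs_nonneg d; omega)]
    omega
  · push Not at hc
    obtain ⟨h3, h4⟩ := hu.abs_partialTurn_lt_of_forall ha hc
    rw [habs] at h3
    have : ((|d| : ℤ) : ℝ) < 2 := by nlinarith
    have : |d| < 2 := by exact_mod_cast this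
    rw [h4]
    simpa using Int.lt_add_one_iff.1 this

end SphericalPolygon
end

/-! ### Orthonormal frames, and spherical polygons in coordinates. -/

noncomputable section
namespace SphericalPolygon

theorem inner_eq (x y : E3) : inner ℝ x y = x 0 * y 0 + x 1 * y 1 + x 2 * y 2 := by
  simp [PiLp.inner_apply, Fin.sum_univ_three]
  ring

theorem cross_zero (x y : E3) : cross x y 0 = x 1 * y 2 - x 2 * y 1 := by
  simp [cross, crossProduct]

theorem cross_one (x y : E3) : cross x y 1 = x 2 * y 0 - x 0 * y 2 := by
  simp [cross, crossProduct]

theorem cross_two (x y : E3) : cross x y 2 = x 0 * y 1 - x 1 * y 0 := by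
  simp [cross, crossProduct]

theorem ext_E3 {x y : E3} (h0 : x 0 = y 0) (h1 : x 1 = y 1) (h2 : x 2 = y 2) : x = y := by
  ext i
  fin_cases i <;> assumption

/-- A positively oriented orthonormal frame of three-space. -/
structure IsFrame (e₁ e₂ e₃ : E3) : Prop where
  norm₁ : inner ℝ e₁ e₁ = 1
  norm₂ : inner ℝ e₂ e₂ = 1
  norm₃ : inner ℝ e₃ e₃ = 1
  orth₁₂ : inner ℝ e₁ e₂ = 0
  orth₂₃ : inner ℝ e₂ e₃ = 0
  orth₃₁ : inner ℝ e₃ e₁ = 0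
  cross₁₂ : cross e₁ e₂ = e₃
  cross₂₃ : cross e₂ e₃ = e₁
  cross₃₁ : cross e₃ e₁ = e₂

theorem exists_frame (ξ : S2) : ∃ e₁ e₂ : E3, IsFrame e₁ e₂ ξ := by
  obtain ⟨x, hx⟩ := ξ
  have hx1 : inner ℝ x x = 1 := by
    rw [real_inner_self_eq_norm_sq, mem_sphere_zero_iff_norm.1 hx, one_pow]
  obtain ⟨v, hv0, hv⟩ : ∃ v : E3, v ≠ 0 ∧ inner ℝ x v = 0 := by
    by_cases h : x 0 = 0 ∧ x 1 = 0
    · refine ⟨!₂[1, 0, 0], fun e => ?_, ?_⟩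
      · have := congrArg (fun z : E3 => z 0) e
        simp at this
      · rw [inner_eq]; simp [h.1]
    · refine ⟨!₂[x 1, -x 0, 0], fun e => h ⟨?_, ?_⟩, ?_⟩
      · have := congrArg (fun z : E3 => z 1) e
        simpa using this
      · have := congrArg (fun z : E3 => z 0) e
        simpa using this
      · rw [inner_eq]; simp; ring
  obtain ⟨e, he, hxe⟩ : ∃ e : E3, inner ℝ e e = 1 ∧ inner ℝ x e = 0 := by
    refine ⟨‖v‖⁻¹ • v, ?_, ?_⟩
    · rw [real_inner_self_eq_norm_sq, norm_smul, norm_inv, norm_norm,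
        inv_mul_cancel₀ (norm_ne_zero_iff.2 hv0), one_pow]
    · rw [inner_smul_right, hv, mul_zero]
  refine ⟨e, cross x e, ?_⟩
  simp only
  rw [inner_eq] at hx1 he hxe
  refine ⟨?_, ?_, ?_, ?_, ?_, ?_, ?_, ?_, rfl⟩
  · rw [inner_eq]; exact he
  · rw [inner_eq, cross_zero, cross_one, cross_two]
    linear_combination (e 0 * e 0 + e 1 * e 1 + e 2 * e 2) * hx1 + he -
      (x 0 * e 0 + x 1 * e 1 + x 2 * e 2) * hxe
  · rw [inner_eq]; exact hx1
  · rw [inner_eq, cross_zero, cross_one, cross_two]; ring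
  · rw [inner_eq, cross_zero, cross_one, cross_two]; ring
  · rw [inner_eq]; exact hxe
  · apply ext_E3
    · rw [cross_zero, cross_one, cross_two]; linear_combination x 0 * he - e 0 * hxe
    · rw [cross_one, cross_zero, cross_two]; linear_combination x 1 * he - e 1 * hxe
    · rw [cross_two, cross_one, cross_zero]; linear_combination x 2 * he - e 2 * hxe
  · apply ext_E3
    · rw [cross_zero, cross_one, cross_two]; linear_combination e 0 * hx1 - x 0 * hxe
    · rw [cross_one, cross_zero, cross_two]; linear_combination e 1 * hx1 - x 1 * hxe
    · rw [cross_two, cross_one, cross_zero]; linear_combination e 2 * hx1 - x 2 * hxe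

/-- The coordinates of a vector with respect to a frame, the first two as a complex number. -/
def coords (e₁ e₂ e₃ : E3) : E3 →ₗ[ℝ] V where
  toFun x := (⟨inner ℝ e₁ x, inner ℝ e₂ x⟩, inner ℝ e₃ x)
  map_add' x y := by
    apply Prod.ext
    · apply Complex.ext <;> simp [inner_add_right]
    · simp [inner_add_right]
  map_smul' c x := by
    apply Prod.ext
    · apply Complex.ext <;> simp [inner_smul_right]
    · simp [inner_smul_right]

theorem coords_re (e₁ e₂ e₃ x : E3) : (coords e₁ e₂ e₃ x).1.re = inner ℝ e₁ x := rfl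
theorem coords_im (e₁ e₂ e₃ x : E3) : (coords e₁ e₂ e₃ x).1.im = inner ℝ e₂ x := rfl
theorem coords_snd (e₁ e₂ e₃ x : E3) : (coords e₁ e₂ e₃ x).2 = inner ℝ e₃ x := rfl

theorem inner_cross_cross (a b x y : E3) :
    inner ℝ (cross a b) (cross x y) =
      inner ℝ a x * inner ℝ b y - inner ℝ a y * inner ℝ b x := by
  simp only [inner_eq, cross_zero, cross_one, cross_two]
  ring

section Frame
variable {e₁ e₂ e₃ : E3}

/-- This is the link between the polar polygon and the projected polygon: normals are secants after
a quarter turn. -/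
theorem IsFrame.coords_cross (h : IsFrame e₁ e₂ e₃) (x y : E3) :
    (coords e₁ e₂ e₃ (cross x y)).1 =
      Complex.I * secant (coords e₁ e₂ e₃ x) (coords e₁ e₂ e₃ y) := by
  apply Complex.ext
  · rw [coords_re]
    conv_lhs => rw [← h.cross₂₃, inner_cross_cross]
    simp [secant, coords_re, coords_im, coords_snd]
    ring
  · rw [coords_im]
    conv_lhs => rw [← h.cross₃₁, inner_cross_cross]
    simp [secant, coords_re, coords_im, coords_snd]

theorem IsFrame.wedge_coords (h : IsFrame e₁ e₂ e₃) (x y : E3) :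
    wedge (coords e₁ e₂ e₃ x).1 (coords e₁ e₂ e₃ y).1 = inner ℝ (cross x y) e₃ := by
  rw [real_inner_comm]
  conv_rhs => rw [← h.cross₁₂, inner_cross_cross]
  simp only [wedge, coords_re, coords_im]
  ring

theorem IsFrame.det3_coords (h : IsFrame e₁ e₂ e₃) (x y z : E3) :
    det3 (coords e₁ e₂ e₃ x) (coords e₁ e₂ e₃ y) (coords e₁ e₂ e₃ z) =
      inner ℝ x (cross y z) := by
  -- Inserting the determinant of the frame, which is one, makes the claim the multiplicativity of
  -- determinants, a polynomial identity.
  have : inner ℝ (cross e₁ e₂) e₃ * inner ℝ x (cross y z) = inner ℝ x (cross y z) := by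
    rw [h.cross₁₂, h.norm₃, one_mul]
  rw [← this]
  simp only [det3, wedge, coords_re, coords_im, coords_snd, inner_eq, cross_zero, cross_one,
    cross_two]
  ring

theorem IsFrame.eq_sum (h : IsFrame e₁ e₂ e₃) (x : E3) :
    x = (inner ℝ e₁ x) • e₁ + (inner ℝ e₂ x) • e₂ + (inner ℝ e₃ x) • e₃ := by
  have hd : inner ℝ (cross e₁ e₂) e₃ = 1 := by rw [h.cross₁₂, h.norm₃]
  have : (inner ℝ (cross e₁ e₂) e₃) • x = (inner ℝ e₁ x) • cross e₂ e₃ +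
      (inner ℝ e₂ x) • cross e₃ e₁ + (inner ℝ e₃ x) • cross e₁ e₂ := by
    apply ext_E3 <;>
      simp only [PiLp.add_apply, PiLp.smul_apply, smul_eq_mul, inner_eq, cross_zero, cross_one,
        cross_two] <;> ring
  rwa [hd, one_smul, h.cross₁₂, h.cross₂₃, h.cross₃₁] at this

theorem IsFrame.coords_injective (h : IsFrame e₁ e₂ e₃) :
    Function.Injective (coords e₁ e₂ e₃) := by
  intro x y e
  have e1 : inner ℝ e₁ x = inner ℝ e₁ y := congrArg (fun z : V => z.1.re) e
  have e2 : inner ℝ e₂ x = inner ℝ e₂ y := congrArg (fun z : V => z.1.im) e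
  have e3 : inner ℝ e₃ x = inner ℝ e₃ y := congrArg (fun z : V => z.2) e
  rw [h.eq_sum x, h.eq_sum y, e1, e2, e3]

theorem IsFrame.coords_third (h : IsFrame e₁ e₂ e₃) : coords e₁ e₂ e₃ e₃ = (0, 1) := by
  apply Prod.ext
  · apply Complex.ext
    · rw [coords_re, real_inner_comm, h.orth₃₁]; rfl
    · rw [coords_im, h.orth₂₃]; rfl
  · rw [coords_snd, h.norm₃]

theorem IsFrame.det_ne_zero_iff (h : IsFrame e₁ e₂ e₃) (x y z : E3) :
    det3 (coords e₁ e₂ e₃ x) (coords e₁ e₂ e₃ y) (coords e₁ e₂ e₃ z) ≠ 0 ↔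
      LinearIndependent ℝ ![x, y, z] := by
  constructor
  · intro hd
    rw [Fintype.linearIndependent_iff]
    intro g hg
    simp only [Fin.sum_univ_three, Matrix.cons_val_zero, Matrix.cons_val_one,
      Matrix.cons_val] at hg
    have := eq_zero_of_det3_ne_zero hd (α := g 0) (β := g 1) (γ := g 2) (by
      rw [← map_smul, ← map_smul, ← map_smul, ← map_add, ← map_add, hg, map_zero])
    intro i
    fin_cases i
    · exact this.1
    · exact this.2.1
    · exact this.2.2
  · intro hl hd
    rw [h.det3_coords] at hd
    have hdet : (Matrix.of ![WithLp.ofLp x, WithLp.ofLp y, WithLp.ofLp z]).det = 0 := by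
      rw [Matrix.det_fin_three, ← hd, inner_eq, cross_zero, cross_one, cross_two]
      simp
      ring
    obtain ⟨v, hv0, hv⟩ := Matrix.exists_vecMul_eq_zero_iff.2 hdet
    rw [Fintype.linearIndependent_iff] at hl
    apply hv0
    funext i
    refine hl v ?_ i
    simp only [Fin.sum_univ_three, Matrix.cons_val_zero, Matrix.cons_val_one, Matrix.cons_val]
    have c (j : Fin 3) := congrFun hv j
    simp only [Matrix.vecMul, dotProduct, Fin.sum_univ_three, Matrix.of_apply,
      Matrix.cons_val_zero, Matrix.cons_val_one, Matrix.cons_val, Pi.zero_apply] at c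
    apply ext_E3
    · simpa using c 0
    · simpa using c 1
    · simpa using c 2

end Frame

/-- The residue of a natural number as an index of a polygon. -/
def ix (n : ℕ) [NeZero n] (k : ℕ) : Fin n := ⟨k % n, Nat.mod_lt _ (NeZero.pos n)⟩

theorem ix_succ (n : ℕ) [NeZero n] (k : ℕ) : ix n (k + 1) = ix n k + 1 := by
  apply Fin.ext
  rw [Fin.val_add, Fin.val_one']
  simp [ix]

theorem ix_add_self (n : ℕ) [NeZero n] (k : ℕ) : ix n (k + n) = ix n k := by
  apply Fin.ext
  simp [ix]

theorem ix_val (n : ℕ) [NeZero n] (i : Fin n) : ix n i.val = i := by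
  apply Fin.ext
  simp [ix, Nat.mod_eq_of_lt i.isLt]

theorem ix_ne (n : ℕ) [NeZero n] {a b : ℕ} (h1 : a < b) (h2 : b < a + n) : ix n a ≠ ix n b := by
  intro h
  have h3 : a % n = b % n := congrArg Fin.val h
  have h4 := (Nat.modEq_iff_dvd' h1.le).1 h3
  have := Nat.le_of_dvd (by omega) h4
  omega

/-- The vertices of a spherical polygon, as a periodic sequence in the coordinates of a frame. -/
def lift {n : ℕ} [NeZero n] (e₁ e₂ e₃ : E3) (W : Fin n → S2) (k : ℕ) : V :=
  coords e₁ e₂ e₃ (W (ix n k))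

theorem normalize_mem_arc {u v x : E3} {a b : ℝ} (ha : 0 ≤ a) (hb : 0 ≤ b) (hx : x ≠ 0)
    (h : x = a • u + b • v) : ‖x‖⁻¹ • x ∈ arc u v := by
  refine ⟨?_, ‖x‖⁻¹ * a, ‖x‖⁻¹ * b, by positivity, by positivity, ?_⟩
  · rw [norm_smul, norm_inv, norm_norm, inv_mul_cancel₀ (norm_ne_zero_iff.2 hx)]
  · rw [mul_smul, mul_smul, ← smul_add, ← h]

theorem isPolygon_lift {n : ℕ} [NeZero n] {e₁ e₂ e₃ : E3} (hf : IsFrame e₁ e₂ e₃)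
    {W : Fin n → S2} (hn : 3 ≤ n) (hg : InGeneralPosition W) (hs : IsSimple W) :
    IsPolygon n (lift e₁ e₂ e₃ W) := by
  have hdet : ∀ i j k, i < j → j < k → k < i + n →
      det3 (lift e₁ e₂ e₃ W i) (lift e₁ e₂ e₃ W j) (lift e₁ e₂ e₃ W k) ≠ 0 := by
    intro i j k h1 h2 h3
    exact (hf.det_ne_zero_iff _ _ _).2
      (hg _ _ _ (ix_ne n h1 (by omega)) (ix_ne n h2 (by omega)) (ix_ne n (by omega) h3))
  have hind : ∀ i (α β : ℝ), α • lift e₁ e₂ e₃ W i + β • lift e₁ e₂ e₃ W (i + 1) = 0 →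
      α = 0 ∧ β = 0 := by
    intro i α β e
    have := eq_zero_of_det3_ne_zero (hdet i (i + 1) (i + 2) (by omega) (by omega) (by omega))
      (α := α) (β := β) (γ := 0) (by rw [e, zero_smul, zero_add])
    exact ⟨this.1, this.2.1⟩
  refine ⟨hn, fun k => by rw [lift, ix_add_self]; rfl, hdet, ?_⟩
  intro i j hij hj α β γ δ hα hβ hγ hδ e
  by_cases h0 : α • lift e₁ e₂ e₃ W i + β • lift e₁ e₂ e₃ W (i + 1) = 0
  · have := hind _ _ _ h0
    rw [h0] at e
    have := hind _ _ _ e.symm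
    tauto
  · exfalso
    set x : E3 := α • (W (ix n i) : E3) + β • (W (ix n i + 1) : E3) with hx
    have x1 : coords e₁ e₂ e₃ x =
        α • lift e₁ e₂ e₃ W i + β • lift e₁ e₂ e₃ W (i + 1) := by
      rw [hx, map_add, map_smul, map_smul, lift, lift, ix_succ]
    have x2 : x = γ • (W (ix n j) : E3) + δ • (W (ix n j + 1) : E3) := by
      apply hf.coords_injective
      rw [x1, e, map_add, map_smul, map_smul, lift, lift, ix_succ]
    have hx0 : x ≠ 0 := by
      intro h
      rw [h, map_zero] at x1
      exact h0 x1.symm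
    have m1 : ‖x‖⁻¹ • x ∈ edge W (ix n i) := normalize_mem_arc hα hβ hx0 hx
    have m2 : ‖x‖⁻¹ • x ∈ edge W (ix n j) := normalize_mem_arc hγ hδ hx0 x2
    have := hs.2 (ix n i) (ix n j) (ix_ne n (by omega) (by omega))
      (by rw [← ix_succ]; exact (ix_ne n (by omega) (by omega)).symm)
      (by rw [← ix_succ, ← ix_add_self n i]; exact (ix_ne n (by omega) (by omega)).symm)
    exact Set.disjoint_left.1 this m1 m2

theorem admissible_lift {n : ℕ} [NeZero n] {e₁ e₂ : E3} {ξ : S2} {W : Fin n → S2}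
    (ha : IsAdmissible W ξ) : Admissible (lift e₁ e₂ ξ W) := by
  intro k hk
  have := ha (ix n (k + 1)) hk
  rw [ix_succ, add_sub_cancel_right, ← ix_succ, ← ix_succ] at this
  exact this

/-- The vertices at or below height zero, minus the edges with both ends there, leave the edges that
start there and end above. -/
theorem index_eq {n : ℕ} [NeZero n] {e₁ e₂ : E3} {ξ : S2} {W : Fin n → S2} :
    index W ξ = 1 - ups (lift e₁ e₂ ξ W) n := by
  classical
  unfold index ups
  rw [Finset.sum_range, sub_add, ← Finset.sum_sub_distrib]
  congr 1
  refine Finset.sum_congr rfl fun i _ => ?_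
  simp only [lift, ix_succ, ix_val, coords_snd]
  by_cases h1 : inner ℝ (ξ : E3) (W i : E3) ≤ 0 <;>
    by_cases h2 : inner ℝ (ξ : E3) (W (i + 1) : E3) ≤ 0 <;> simp [h1, h2, not_lt.2, not_le.1]

end SphericalPolygon
end

/-! ### The normal degree as a rotation number. -/

noncomputable section
namespace SphericalPolygon

theorem sign_mul_pos {c x : ℝ} (hc : 0 < c) : SignType.sign (c * x) = SignType.sign x := by
  rw [sign_mul, sign_pos hc, one_mul]

theorem norm_eq_one_of_inner_self {x : E3} (h : inner ℝ x x = 1) : ‖x‖ = 1 := by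
  rw [real_inner_self_eq_norm_sq] at h
  exact (pow_eq_one_iff_of_nonneg (norm_nonneg x) two_ne_zero).1 h

section Degree
variable {n : ℕ} [NeZero n] {e₁ e₂ : E3} {ξ : S2} {W : Fin n → S2}

/-- The horizontal coordinates of the vertices of the polar polygon. -/
def polarCoord (e₁ e₂ : E3) (ξ : S2) (W : Fin n → S2) (i : Fin n) : ℂ :=
  (coords e₁ e₂ ξ (polar W i)).1

theorem polar_coord_eq (hf : IsFrame e₁ e₂ ξ) (i : Fin n)
    (h : secant (coords e₁ e₂ ξ (W i)) (coords e₁ e₂ ξ (W (i + 1))) ≠ 0) :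
    ∃ s : ℝ, 0 < s ∧ polarCoord e₁ e₂ ξ W i =
      s * (Complex.I * secant (coords e₁ e₂ ξ (W i)) (coords e₁ e₂ ξ (W (i + 1)))) ∧
      ‖polar W i‖ = 1 := by
  have hc : cross (W i) (W (i + 1)) ≠ 0 := by
    intro h0
    have := hf.coords_cross (W i) (W (i + 1))
    rw [h0, map_zero] at this
    exact mul_ne_zero Complex.I_ne_zero h this.symm
  have hn := norm_ne_zero_iff.2 hc
  refine ⟨‖cross (W i) (W (i + 1))‖⁻¹, by positivity, ?_, ?_⟩
  · rw [polarCoord, polar, map_smul, Prod.smul_fst, hf.coords_cross, Complex.real_smul]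
  · rw [polar, norm_smul, norm_inv, norm_norm, inv_mul_cancel₀ hn]

theorem coords_meridian (hf : IsFrame e₁ e₂ ξ) {η : S2}
    (hη : inner ℝ (ξ : E3) (η : E3) = 0) (a b : ℝ) :
    coords e₁ e₂ ξ (a • (ξ : E3) + b • (η : E3)) = (b * (coords e₁ e₂ ξ η).1, a) := by
  rw [map_add, map_smul, map_smul, hf.coords_third]
  apply Prod.ext
  · simp
  · simp [coords_snd, hη]

theorem eq_of_coords_fst (hf : IsFrame e₁ e₂ ξ) {η : S2}
    (hη : inner ℝ (ξ : E3) (η : E3) = 0) {x : E3} {b : ℝ}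
    (h : (coords e₁ e₂ ξ x).1 = b * (coords e₁ e₂ ξ η).1) :
    x = (coords e₁ e₂ ξ x).2 • (ξ : E3) + b • (η : E3) := by
  apply hf.coords_injective
  rw [coords_meridian hf hη]
  exact Prod.ext h rfl

theorem coords_pole_ne_zero (hf : IsFrame e₁ e₂ ξ) {η : S2}
    (hη : inner ℝ (ξ : E3) (η : E3) = 0) : (coords e₁ e₂ ξ η).1 ≠ 0 := by
  intro h
  have h1 : coords e₁ e₂ ξ η = coords e₁ e₂ ξ 0 := by
    rw [map_zero]
    exact Prod.ext h (by rw [coords_snd]; exact hη)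
  have h2 := hf.coords_injective h1
  have h3 := norm_eq_of_mem_sphere η
  rw [h2, norm_zero] at h3
  exact zero_ne_one h3

/-- After a rotation that puts the arc on the negative real axis, the degree is the sum of the
crossing numbers of the polar edges. The arguments of the polar vertices telescope, and positive
factors and quarter turns do not affect the quotients. -/
theorem degreeAlong_eq (hf : IsFrame e₁ e₂ ξ) {η : S2} (hm : IsMeridian W ξ η)
    (hs : ∀ i, secant (coords e₁ e₂ ξ (W i)) (coords e₁ e₂ ξ (W (i + 1))) ≠ 0)
    (hr : ∀ i : Fin n, secant (coords e₁ e₂ ξ (W (i + 1))) (coords e₁ e₂ ξ (W (i + 1 + 1))) /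
      secant (coords e₁ e₂ ξ (W i)) (coords e₁ e₂ ξ (W (i + 1))) ∈ Complex.slitPlane) :
    2 * Real.pi * (degreeAlong W ξ η : ℝ) = ∑ i : Fin n,
      (secant (coords e₁ e₂ ξ (W (i + 1))) (coords e₁ e₂ ξ (W (i + 1 + 1))) /
        secant (coords e₁ e₂ ξ (W i)) (coords e₁ e₂ ξ (W (i + 1)))).arg := by
  classical
  obtain ⟨hη, hv⟩ := hm
  set c := (coords e₁ e₂ ξ η).1 with hc
  have c0 : c ≠ 0 := coords_pole_ne_zero hf hη
  choose s s0 hP hnorm using fun i => polar_coord_eq (W := W) hf i (hs i)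
  set P := polarCoord e₁ e₂ ξ W with hPdef
  set f : Fin n → ℂ := fun i => secant (coords e₁ e₂ ξ (W i)) (coords e₁ e₂ ξ (W (i + 1))) with hfd
  have hf' : ∀ i, P i = s i * (Complex.I * f i) := hP
  have P0 : ∀ i, P i ≠ 0 := fun i => by
    rw [hf']
    exact mul_ne_zero (by exact_mod_cast (s0 i).ne') (mul_ne_zero Complex.I_ne_zero (hs i))
  have ratio : ∀ i, (-P (i + 1) / c) / (-P i / c) =
      ((s (i + 1) / s i : ℝ) : ℂ) * (f (i + 1) / f i) := by
    intro i
    have h1 : f i ≠ 0 := hs i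
    have h2 : (s i : ℂ) ≠ 0 := by exact_mod_cast (s0 i).ne'
    rw [hf', hf']
    push_cast
    field_simp
  have pos : ∀ i, 0 < s (i + 1) / s i := fun i => div_pos (s0 _) (s0 _)
  -- Division by `-c` sends the horizontal direction of the arc to the negative real axis. A polar
  -- vertex off the arc thus lands in the slit plane.
  have slit : ∀ i, -P i / c ∈ Complex.slitPlane := by
    intro i
    rw [Complex.mem_slitPlane_iff_not_le_zero]
    intro hle
    rw [Complex.le_def] at hle
    apply hv i
    refine ⟨hnorm i, (coords e₁ e₂ ξ (polar W i)).2, -(-P i / c).re, by simpa using hle.1, ?_⟩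
    refine eq_of_coords_fst hf hη ?_
    have : -P i / c = ((-P i / c).re : ℂ) := Complex.ext rfl (by simpa using hle.2)
    rw [Complex.ofReal_neg, ← this, ← hc]
    field_simp
    rfl
  have slit2 : ∀ i, (-P (i + 1) / c) / (-P i / c) ∈ Complex.slitPlane := by
    intro i
    rw [ratio, Complex.mem_slitPlane_iff_arg, Complex.arg_real_mul _ (pos i)]
    have := Complex.mem_slitPlane_iff_arg.1 (hr i)
    exact ⟨this.1, mul_ne_zero (by exact_mod_cast (pos i).ne') this.2⟩
  have term : ∀ i, (if (polarEdge W i ∩ meridian ξ η).Nonempty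
      then (SignType.sign (inner ℝ (cross (polar W i) (polar W (i + 1))) (ξ : E3)) : ℤ) else 0) =
      crossing (-P i / c) (-P (i + 1) / c) := by
    intro i
    have cond : (polarEdge W i ∩ meridian ξ η).Nonempty ↔ ∃ α β ρ : ℝ, 0 ≤ α ∧ 0 ≤ β ∧ 0 < ρ ∧
        (α * (-P i / c) + β * (-P (i + 1) / c) : ℂ) = -ρ := by
      have eqv : ∀ α β ρ : ℝ, (α * (-P i / c) + β * (-P (i + 1) / c) : ℂ) = -ρ ↔
          α * P i + β * P (i + 1) = ρ * c := by
        intro α β ρ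
        field_simp
        constructor <;> intro h <;> linear_combination -h
      have proj : ∀ α β : ℝ, (coords e₁ e₂ ξ (α • polar W i + β • polar W (i + 1))).1 =
          α * P i + β * P (i + 1) := by
        intro α β
        rw [map_add, map_smul, map_smul, Prod.fst_add, Prod.smul_fst, Prod.smul_fst,
          Complex.real_smul, Complex.real_smul]
        rfl
      constructor
      · rintro ⟨x, ⟨hx, α, β, hα, hβ, hab⟩, -, a, b, hb, hx2⟩
        have h1 : α * P i + β * P (i + 1) = b * c := by
          rw [← proj, ← hab, hx2, coords_meridian hf hη]
        -- The case `b = 0` means that the polar edge passes through one of the poles. Its ends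
        -- would then have opposite horizontal directions, which `slit2` excludes.
        refine ⟨α, β, b, hα, hβ, lt_of_le_of_ne hb ?_, (eqv _ _ _).2 h1⟩
        rintro rfl
        rw [Complex.ofReal_zero, zero_mul] at h1
        have hβ0 : β = 0 := by
          by_contra hβ0
          have hβ1 : 0 < β := lt_of_le_of_ne hβ (Ne.symm hβ0)
          have h2 : (-P (i + 1) / c) / (-P i / c) = ((-(α / β) : ℝ) : ℂ) := by
            have := P0 i
            have : (β : ℂ) ≠ 0 := by exact_mod_cast hβ0
            push_cast
            field_simp
            linear_combination h1
          have := slit2 i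
          rw [h2, Complex.ofReal_mem_slitPlane] at this
          have := div_nonneg hα hβ
          linarith
        subst hβ0
        have hα0 : α = 0 := by
          by_contra hα0
          simp at h1
          rcases h1 with h1 | h1
          · exact hα0 h1
          · exact P0 i h1
        subst hα0
        rw [hab] at hx
        simp at hx
      · rintro ⟨α, β, ρ, hα, hβ, hρ, e⟩
        rw [eqv, ← proj] at e
        have e2 := eq_of_coords_fst hf hη e
        set x := α • polar W i + β • polar W (i + 1) with hx
        have x0 : x ≠ 0 := by
          intro h
          rw [h, map_zero] at e
          have : (ρ : ℂ) ≠ 0 := by exact_mod_cast hρ.ne'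
          exact mul_ne_zero this c0 e.symm
        have m := normalize_mem_arc hα hβ x0 hx
        refine ⟨‖x‖⁻¹ • x, m, m.1, ‖x‖⁻¹ * (coords e₁ e₂ ξ x).2, ‖x‖⁻¹ * ρ, by positivity, ?_⟩
        rw [mul_smul, mul_smul, ← smul_add, ← e2]
    rw [crossing_eq_sign (slit i) (slit (i + 1)), if_congr cond rfl rfl]
    have hw : wedge (-P i / c) (-P (i + 1) / c) = (Complex.normSq c)⁻¹ *
        inner ℝ (cross (polar W i) (polar W (i + 1))) (ξ : E3) := by
      rw [← hf.wedge_coords]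
      change _ = _ * wedge (P i) (P (i + 1))
      have : Complex.normSq c ≠ 0 := (Complex.normSq_pos.2 c0).ne'
      have e : Complex.normSq c = c.re * c.re + c.im * c.im := Complex.normSq_apply c
      simp only [wedge, Complex.div_re, Complex.div_im, Complex.neg_re, Complex.neg_im]
      field_simp
      rw [e]
      ring
    rw [hw, sign_mul_pos (inv_pos.2 (Complex.normSq_pos.2 c0))]
  have args : ∀ i, (f (i + 1) / f i).arg = (-P (i + 1) / c).arg - (-P i / c).arg +
      2 * Real.pi * crossing (-P i / c) (-P (i + 1) / c) := by
    intro i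
    rw [← arg_div_eq_crossing (slit i) (slit (i + 1)) (slit2 i), ratio,
      Complex.arg_real_mul _ (pos i)]
  change _ = ∑ i : Fin n, (f (i + 1) / f i).arg
  rw [Finset.sum_congr rfl fun i _ => args i, Finset.sum_add_distrib, Finset.sum_sub_distrib,
    show ∑ i, (-P (i + 1) / c).arg = ∑ i, (-P i / c).arg from
      Equiv.sum_comp (Equiv.addRight (1 : Fin n)) (fun i => (-P i / c).arg),
    sub_self, zero_add, ← Finset.mul_sum]
  congr 1
  rw [degreeAlong, Finset.sum_congr rfl fun i _ => term i]
  push_cast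
  rfl

/-- Polar vertices have nonzero horizontal part, so each blocks a single angle `θ`, and finitely
many angles are blocked. -/
theorem exists_meridian (hf : IsFrame e₁ e₂ ξ)
    (hs : ∀ i, secant (coords e₁ e₂ ξ (W i)) (coords e₁ e₂ ξ (W (i + 1))) ≠ 0) :
    ∃ η : S2, IsMeridian W ξ η := by
  obtain ⟨θ, hθ, hθ2⟩ := (Set.Ioo_infinite (neg_lt_self Real.pi_pos)).exists_notMem_finite
    (Set.finite_range fun i : Fin n => (polarCoord e₁ e₂ ξ W i).arg)
  set x : E3 := Real.cos θ • e₁ + Real.sin θ • e₂ with hx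
  have h12 := hf.orth₁₂
  have h21 : inner ℝ e₂ e₁ = 0 := by rw [real_inner_comm]; exact h12
  have hxx : inner ℝ x x = 1 := by
    rw [hx]
    simp only [inner_add_left, inner_add_right, inner_smul_left, inner_smul_right, h12, h21,
      hf.norm₁, hf.norm₂]
    simp
    nlinarith [Real.sin_sq_add_cos_sq θ]
  have hx1 : ‖x‖ = 1 := norm_eq_one_of_inner_self hxx
  have hη : inner ℝ (ξ : E3) x = 0 := by
    rw [hx, inner_add_right, inner_smul_right, inner_smul_right, hf.orth₃₁, real_inner_comm,
      hf.orth₂₃]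
    simp
  have hcx : (coords e₁ e₂ ξ x).1 = Complex.cos θ + Complex.sin θ * Complex.I := by
    rw [hx, map_add, map_smul, map_smul]
    apply Complex.ext
    · simp [coords_re, norm_eq_one_of_inner_self hf.norm₁, h12, ← Complex.ofReal_cos, ← Complex.ofReal_sin]
    · simp [coords_im, norm_eq_one_of_inner_self hf.norm₂, h21, ← Complex.ofReal_cos, ← Complex.ofReal_sin]
  refine ⟨⟨x, by simpa using hx1⟩, hη, fun i hi => hθ2 ?_⟩
  obtain ⟨-, a, b, hb, e⟩ := hi
  have h1 : polarCoord e₁ e₂ ξ W i = b * (coords e₁ e₂ ξ x).1 := by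
    rw [polarCoord, e, coords_meridian (η := ⟨x, by simpa using hx1⟩) hf hη]
  have b0 : 0 < b := by
    refine lt_of_le_of_ne hb ?_
    rintro rfl
    obtain ⟨s, hs0, h2, -⟩ := polar_coord_eq (W := W) hf i (hs i)
    rw [h1, Complex.ofReal_zero, zero_mul] at h2
    exact mul_ne_zero (by exact_mod_cast hs0.ne') (mul_ne_zero Complex.I_ne_zero (hs i)) h2.symm
  refine ⟨i, ?_⟩
  simp only
  rw [h1, hcx, Complex.arg_mul_cos_add_sin_mul_I b0 ⟨hθ.1, hθ.2.le⟩]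

/-- The normal degree is the rotation number. -/
theorem hasNormalDegree_of_partialTurn (hf : IsFrame e₁ e₂ ξ) (hn : 3 ≤ n)
    (hg : InGeneralPosition W) (hsimple : IsSimple W) (ha : IsAdmissible W ξ) {d : ℤ}
    (hd : partialTurn (lift e₁ e₂ ξ W) n = 2 * Real.pi * d) : HasNormalDegree W ξ d := by
  have hp := isPolygon_lift hf hn hg hsimple
  have key := fun k => hp.secant_slit (admissible_lift ha) k
  have hs : ∀ i, secant (coords e₁ e₂ ξ (W i)) (coords e₁ e₂ ξ (W (i + 1))) ≠ 0 := by
    intro i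
    have := (key i.val).1
    simpa only [lift, ix_succ, ix_val] using this
  have hr : ∀ i : Fin n, secant (coords e₁ e₂ ξ (W (i + 1))) (coords e₁ e₂ ξ (W (i + 1 + 1))) /
      secant (coords e₁ e₂ ξ (W i)) (coords e₁ e₂ ξ (W (i + 1))) ∈ Complex.slitPlane := by
    intro i
    have := (key i.val).2
    simpa only [lift, ix_succ n (i.val + 1), ix_succ n i.val, ix_val] using this
  refine ⟨exists_meridian hf hs, fun η hη => ?_⟩
  have h1 := degreeAlong_eq hf hη hs hr
  have h2 : partialTurn (lift e₁ e₂ ξ W) n = ∑ i : Fin n,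
      (secant (coords e₁ e₂ ξ (W (i + 1))) (coords e₁ e₂ ξ (W (i + 1 + 1))) /
        secant (coords e₁ e₂ ξ (W i)) (coords e₁ e₂ ξ (W (i + 1)))).arg := by
    unfold partialTurn
    rw [Finset.sum_range]
    refine Finset.sum_congr rfl fun i _ => ?_
    simp only [turn, lift, ix_succ n (i.val + 1), ix_succ n i.val, ix_val]
  rw [← h2, hd] at h1
  have := mul_left_cancel₀ (mul_ne_zero two_ne_zero Real.pi_ne_zero) h1
  exact_mod_cast this

end Degree

theorem exists_normalDegree {n : ℕ} [NeZero n] (W : Fin n → S2) (ξ : S2) (hn : 3 ≤ n)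
    (hg : InGeneralPosition W) (hs : IsSimple W) (ha : IsAdmissible W ξ) :
    ∃ d : ℤ, HasNormalDegree W ξ d ∧ |d| ≤ |index W ξ| ∧ Even (d - index W ξ) := by
  obtain ⟨e₁, e₂, hf⟩ := exists_frame ξ
  obtain ⟨d, h1, h2, h3⟩ := (isPolygon_lift hf hn hg hs).exists_turn_bound (admissible_lift ha)
  refine ⟨d, hasNormalDegree_of_partialTurn hf hn hg hs ha h1, ?_, ?_⟩
  · rwa [index_eq (e₁ := e₁) (e₂ := e₂)]
  · rwa [index_eq (e₁ := e₁) (e₂ := e₂)]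

end SphericalPolygon
end

/-! ### Relations on the moment curve, and the zigzag polygon. -/

noncomputable section
namespace SphericalPolygon

theorem ConeDisjoint.smul {a b c d : V} (h : ConeDisjoint a b c d) {r s t v : ℝ} (hr : 0 < r)
    (hs : 0 < s) (ht : 0 < t) (hv : 0 < v) : ConeDisjoint (r • a) (s • b) (t • c) (v • d) := by
  intro α β γ δ hα hβ hγ hδ e
  have := h (α * r) (β * s) (γ * t) (δ * v) (by positivity) (by positivity) (by positivity)
    (by positivity) (by simpa only [mul_smul] using e)
  simpa [hr.ne', hs.ne', ht.ne', hv.ne'] using this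

theorem isSimple_of_coneDisjoint {n : ℕ} [NeZero n] {e₁ e₂ e₃ : E3} (hf : IsFrame e₁ e₂ e₃)
    {W : Fin n → S2} (hn : 3 ≤ n) (hg : InGeneralPosition W)
    (hd : ∀ i j : Fin n, i < j → j ≠ i + 1 → i ≠ j + 1 →
      ConeDisjoint (coords e₁ e₂ e₃ (W i)) (coords e₁ e₂ e₃ (W (i + 1)))
        (coords e₁ e₂ e₃ (W j)) (coords e₁ e₂ e₃ (W (j + 1)))) : IsSimple W := by
  have two : ∀ i : Fin n, i ≠ i + 1 ∧ i + 1 ≠ i + 1 + 1 ∧ i ≠ i + 1 + 1 := by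
    intro i
    have h1 := ix_ne n (a := i.val) (b := i.val + 1) (by omega) (by omega)
    have h2 := ix_ne n (a := i.val + 1) (b := i.val + 1 + 1) (by omega) (by omega)
    have h3 := ix_ne n (a := i.val) (b := i.val + 1 + 1) (by omega) (by omega)
    simp only [ix_succ, ix_val] at h1 h2 h3
    exact ⟨h1, h2, h3⟩
  constructor
  · intro i
    ext x
    constructor
    · rintro ⟨⟨hx, α, β, hα, hβ, e⟩, -, γ, δ, hγ, hδ, e'⟩
      obtain ⟨h1, h2, h3⟩ := two i
      have hdet := (hf.det_ne_zero_iff _ _ _).2 (hg i (i + 1) (i + 1 + 1) h1 h2 h3)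
      have key := eq_zero_of_det3_ne_zero hdet (α := α) (β := β - γ) (γ := -δ) (by
        rw [← map_smul, ← map_smul, ← map_smul, ← map_add, ← map_add]
        have : α • (W i : E3) + (β - γ) • (W (i + 1) : E3) + (-δ) • (W (i + 1 + 1) : E3) = 0 := by
          have := sub_eq_zero.2 (e.symm.trans e')
          refine Eq.trans ?_ this
          module
        rw [this, map_zero])
      rw [key.1, zero_smul, zero_add] at e
      rw [e, norm_smul, norm_eq_of_mem_sphere, mul_one, Real.norm_eq_abs, abs_of_nonneg hβ] at hx
      rw [hx, one_smul] at e
      exact e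
    · rintro rfl
      exact ⟨⟨norm_eq_of_mem_sphere _, 0, 1, le_rfl, zero_le_one, by simp⟩,
        norm_eq_of_mem_sphere _, 1, 0, zero_le_one, le_rfl, by simp⟩
  · have main : ∀ i j : Fin n, i < j → j ≠ i + 1 → i ≠ j + 1 → Disjoint (edge W i) (edge W j) := by
      intro i j hij h1 h2
      rw [Set.disjoint_left]
      rintro x ⟨hx, α, β, hα, hβ, e⟩ ⟨-, γ, δ, hγ, hδ, e'⟩
      have := hd i j hij h1 h2 α β γ δ hα hβ hγ hδ (by
        rw [← map_smul, ← map_smul, ← map_smul, ← map_smul, ← map_add, ← map_add, ← e, ← e'])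
      rw [e, this.1, this.2.1] at hx
      simp at hx
    intro i j hij h1 h2
    rcases lt_or_gt_of_ne hij with h | h
    · exact main i j h h1 h2
    · exact (main j i h h2 h1).symm

/-- A point of the moment curve. -/
def momentPt (p : ℝ) : V := (⟨p, p ^ 2⟩, 1)

/-- The linear functional given by the quadratic polynomial with roots `z` and `w` kills the last
two points and has the same strict sign on the first two. Hence `a` and `b` vanish, and two distinct
points of the curve are independent. -/
theorem momentPt_relation {p q z w a b c d : ℝ} (hpq : 0 < (p - z) * (p - w) * ((q - z) * (q - w)))
    (hzw : z ≠ w) (ha : 0 ≤ a) (hb : 0 ≤ b)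
    (h : a • momentPt p + b • momentPt q + c • momentPt z + d • momentPt w = 0) :
    a = 0 ∧ b = 0 ∧ c = 0 ∧ d = 0 := by
  have e1 := congrArg (fun v : V => v.1.re) h
  have e2 := congrArg (fun v : V => v.1.im) h
  have e3 := congrArg (fun v : V => v.2) h
  simp [momentPt] at e1 e2 e3
  have key : a * ((p - z) * (p - w)) + b * ((q - z) * (q - w)) = 0 := by
    linear_combination e2 - (z + w) * e1 + z * w * e3
  have hab : a = 0 ∧ b = 0 := by
    rcases pos_and_pos_or_neg_and_neg_of_mul_pos hpq with ⟨h1, h2⟩ | ⟨h1, h2⟩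
    · have := add_eq_zero_of_nonneg (by positivity) (by positivity) key
      exact ⟨(mul_eq_zero.1 this.1).resolve_right h1.ne',
        (mul_eq_zero.1 this.2).resolve_right h2.ne'⟩
    · have := add_eq_zero_of_nonneg (a := a * -((p - z) * (p - w)))
        (b := b * -((q - z) * (q - w))) (mul_nonneg ha (by linarith)) (mul_nonneg hb (by linarith))
        (by linarith)
      exact ⟨(mul_eq_zero.1 this.1).resolve_right (by linarith),
        (mul_eq_zero.1 this.2).resolve_right (by linarith)⟩
  obtain ⟨rfl, rfl⟩ := hab
  simp at e1 e3
  have hc : c * (z - w) = 0 := by linear_combination e1 - w * e3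
  have hc := (mul_eq_zero.1 hc).resolve_right (sub_ne_zero.2 hzw)
  exact ⟨rfl, rfl, hc, by linarith⟩

theorem det3_momentPt (p q r : ℝ) :
    det3 (momentPt p) (momentPt q) (momentPt r) = (q - p) * (r - q) * (r - p) := by
  simp [det3, wedge, momentPt]
  ring

/-- In a common vector, `c` and `b` would occur with coefficients of the same sign, and both
parameters lie between `a` and `d`. -/
theorem coneDisjoint_zigzag {a b c d : ℝ} (hac : a < c) (hcb : c < b) (hbd : b < d) :
    ConeDisjoint (momentPt a) (-momentPt b) (momentPt c) (-momentPt d) := by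
  intro α β γ δ hα hβ hγ hδ e
  have := momentPt_relation (p := c) (q := b) (z := a) (w := d) (a := γ) (b := β) (c := -α)
    (d := -δ)
    (mul_pos_of_neg_of_neg (mul_neg_of_pos_of_neg (by linarith) (by linarith))
      (mul_neg_of_pos_of_neg (by linarith) (by linarith)))
    (by linarith : a < d).ne hγ hβ (by
      rw [← neg_eq_zero, ← sub_eq_zero.2 e]; module)
  exact ⟨by linarith [this.2.2.1], this.2.1, this.1, by linarith [this.2.2.2]⟩

/-- Wherever `e` lies, two points with coefficients of equal sign can be found on which the
quadratic with the other two as roots has one sign. -/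
theorem coneDisjoint_top {a c e f : ℝ} (hac : a < c) (hcf : c < f) (hef : e < f)
    (hae : e ≠ a) (hce : e ≠ c) :
    ConeDisjoint (momentPt a) (momentPt c) (momentPt e) (-momentPt f) := by
  intro α β γ δ hα hβ hγ hδ h
  rcases lt_or_gt_of_ne hae with k | k
  · have := momentPt_relation (p := a) (q := c) (z := e) (w := f) (a := α) (b := β) (c := -γ)
      (d := δ) (mul_pos_of_neg_of_neg (mul_neg_of_pos_of_neg (by linarith) (by linarith))
        (mul_neg_of_pos_of_neg (by linarith) (by linarith))) hef.ne hα hβ (by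
      rw [← sub_eq_zero.2 h]; module)
    exact ⟨this.1, this.2.1, by linarith [this.2.2.1], this.2.2.2⟩
  · rcases lt_or_gt_of_ne hce with l | l
    · have := momentPt_relation (p := c) (q := f) (z := a) (w := e) (a := β) (b := δ) (c := α)
        (d := -γ) (mul_pos (mul_pos (by linarith) (by linarith))
          (mul_pos (by linarith) (by linarith))) k.ne hβ hδ (by
        rw [← sub_eq_zero.2 h]; module)
      exact ⟨this.2.2.1, this.1, by linarith [this.2.2.2], this.2.1⟩
    · have := momentPt_relation (p := a) (q := c) (z := e) (w := f) (a := α) (b := β) (c := -γ)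
        (d := δ) (mul_pos (mul_pos_of_neg_of_neg (by linarith) (by linarith))
          (mul_pos_of_neg_of_neg (by linarith) (by linarith))) hef.ne hα hβ (by
        rw [← sub_eq_zero.2 h]; module)
      exact ⟨this.1, this.2.1, by linarith [this.2.2.1], this.2.2.2⟩

theorem coneDisjoint_bottom {a c e f : ℝ} (hac : a < c) (hea : e < a) (hef : e < f)
    (haf : f ≠ a) (hcf : f ≠ c) :
    ConeDisjoint (momentPt e) (-momentPt f) (-momentPt a) (-momentPt c) := by
  intro γ δ α β hγ hδ hα hβ h
  rcases lt_or_gt_of_ne hcf with k | k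
  · rcases lt_or_gt_of_ne haf with l | l
    · have := momentPt_relation (p := a) (q := c) (z := e) (w := f) (a := α) (b := β) (c := γ)
        (d := -δ) (mul_pos (mul_pos (by linarith) (by linarith))
          (mul_pos (by linarith) (by linarith))) hef.ne hα hβ (by
        rw [← sub_eq_zero.2 h]; module)
      exact ⟨this.2.2.1, by linarith [this.2.2.2], this.1, this.2.1⟩
    · have := momentPt_relation (p := a) (q := e) (z := f) (w := c) (a := α) (b := γ) (c := -δ)
        (d := β) (mul_pos (mul_pos_of_neg_of_neg (by linarith) (by linarith))
          (mul_pos_of_neg_of_neg (by linarith) (by linarith))) k.ne hα hγ (by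
        rw [← sub_eq_zero.2 h]; module)
      exact ⟨this.2.1, by linarith [this.2.2.1], this.1, this.2.2.2⟩
  · have := momentPt_relation (p := a) (q := c) (z := e) (w := f) (a := α) (b := β) (c := γ)
      (d := -δ) (mul_pos_of_neg_of_neg (mul_neg_of_pos_of_neg (by linarith) (by linarith))
        (mul_neg_of_pos_of_neg (by linarith) (by linarith))) hef.ne hα hβ (by
      rw [← sub_eq_zero.2 h]; module)
    exact ⟨this.2.2.1, by linarith [this.2.2.2], this.1, this.2.1⟩

theorem coneDisjoint_opposite {a c b d : ℝ} (hac : a < c) (hbd : d < b)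
    (hcd : c < d) : ConeDisjoint (momentPt a) (momentPt c) (-momentPt b) (-momentPt d) := by
  intro α β γ δ hα hβ hγ hδ h
  have := momentPt_relation (p := a) (q := c) (z := b) (w := d) (a := α) (b := β) (c := γ)
    (d := δ) (mul_pos (mul_pos_of_neg_of_neg (by linarith) (by linarith))
      (mul_pos_of_neg_of_neg (by linarith) (by linarith))) hbd.ne' hα hβ (by
    rw [← sub_eq_zero.2 h]; module)
  exact this

/-- The vertices above height zero of the zigzag polygon. -/
def topPt (p : ℝ) : V := momentPt p

/-- The vertices below height zero of the zigzag polygon. -/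
def botPt (N p : ℝ) : V := -momentPt (p + N)

open Classical in
/-- The zigzag polygon: `k` waves to the right, followed by `l` waves to the left further to the
right, and closed up by an edge below. -/
def zigzag (k l s : ℕ) : V :=
  if s < 2 * (k + 1) then
    if Even s then botPt (8 * (k + l + 2)) s else topPt s
  else
    if Even s then topPt (4 * (k + l + 2) - s) else botPt (8 * (k + l + 2)) (4 * (k + l + 2) - s)

section Zigzag
variable {k l s : ℕ}

theorem zigzag_bot_left (h : s < 2 * (k + 1)) (hs : Even s) :
    zigzag k l s = botPt (8 * (k + l + 2)) s := by
  rw [zigzag, if_pos h, if_pos hs]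

theorem zigzag_top_left (h : s < 2 * (k + 1)) (hs : ¬ Even s) : zigzag k l s = topPt s := by
  rw [zigzag, if_pos h, if_neg hs]

theorem zigzag_top_right (h : 2 * (k + 1) ≤ s) (hs : Even s) :
    zigzag k l s = topPt (4 * (k + l + 2) - s) := by
  rw [zigzag, if_neg h.not_gt, if_pos hs]

theorem zigzag_bot_right (h : 2 * (k + 1) ≤ s) (hs : ¬ Even s) :
    zigzag k l s = botPt (8 * (k + l + 2)) (4 * (k + l + 2) - s) := by
  rw [zigzag, if_neg h.not_gt, if_neg hs]

/-- The steep edges of the zigzag polygon. -/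
theorem zigzag_steep (l : ℕ) (hs : s ≠ 2 * k + 1) :
    ∃ p q : ℝ, ((zigzag k l s = topPt p ∧ zigzag k l (s + 1) = botPt (8 * (k + l + 2)) q) ∨
      (zigzag k l s = botPt (8 * (k + l + 2)) q ∧ zigzag k l (s + 1) = topPt p)) ∧
      ((s < 2 * k + 1 ∧ s ≤ p ∧ s ≤ q ∧ p ≤ s + 1 ∧ q ≤ s + 1) ∨
        (2 * k + 1 < s ∧ 4 * (k + l + 2) - s - 1 ≤ p ∧ 4 * (k + l + 2) - s - 1 ≤ q ∧
          p ≤ 4 * (k + l + 2) - s ∧ q ≤ 4 * (k + l + 2) - s)) := by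
  rcases Nat.lt_or_gt_of_ne hs with h1 | h1
  · by_cases he : Even s
    · refine ⟨(s + 1 : ℕ), s, Or.inr ⟨zigzag_bot_left (by omega) he,
        zigzag_top_left (by omega) (by simpa [Nat.even_add_one] using he)⟩, Or.inl ?_⟩
      push_cast
      exact ⟨h1, by linarith, le_rfl, le_rfl, by linarith⟩
    · refine ⟨s, (s + 1 : ℕ), Or.inl ⟨zigzag_top_left (by omega) he,
        zigzag_bot_left (by omega) (by simpa [Nat.even_add_one] using he)⟩, Or.inl ?_⟩
      push_cast
      exact ⟨h1, le_rfl, by linarith, by linarith, le_rfl⟩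
  · by_cases he : Even s
    · refine ⟨4 * (k + l + 2) - s, 4 * (k + l + 2) - (s + 1 : ℕ),
        Or.inl ⟨zigzag_top_right (by omega) he,
        zigzag_bot_right (by omega) (by simpa [Nat.even_add_one] using he)⟩, Or.inr ?_⟩
      push_cast
      exact ⟨h1, by linarith, by linarith, le_rfl, by linarith⟩
    · refine ⟨4 * (k + l + 2) - (s + 1 : ℕ), 4 * (k + l + 2) - s,
        Or.inr ⟨zigzag_bot_right (by omega) he,
        zigzag_top_right (by omega) (by simpa [Nat.even_add_one] using he)⟩, Or.inr ?_⟩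
      push_cast
      exact ⟨h1, by linarith, by linarith, by linarith, le_rfl⟩

/-- The shift `8 * (k + l + 2)` of the lower vertices exceeds every parameter `p` and `q`, so on the
moment curve all lower vertices come after all upper ones. -/
theorem zigzag_bounds (h : s + 1 < 2 * (k + l + 2)) {p q : ℝ} (hs : (s < 2 * k + 1 ∧ s ≤ p ∧ s ≤ q ∧ p ≤ s + 1 ∧ q ≤ s + 1) ∨
        (2 * k + 1 < s ∧ (4 * (k + l + 2) - s - 1 : ℝ) ≤ p ∧ (4 * (k + l + 2) - s - 1 : ℝ) ≤ q ∧
          p ≤ 4 * (k + l + 2) - s ∧ q ≤ 4 * (k + l + 2) - s)) :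
    0 ≤ p ∧ 0 ≤ q ∧ p < 8 * (k + l + 2) ∧ q < 8 * (k + l + 2) ∧ s ≤ p ∧ s ≤ q ∧
      p ≤ 4 * (k + l + 2) - s ∧ q ≤ 4 * (k + l + 2) - s := by
  have h' : ((s + 1 : ℕ) : ℝ) < (2 * (k + l + 2) : ℕ) := by exact_mod_cast h
  push_cast at h'
  have hk : (0 : ℝ) ≤ k := Nat.cast_nonneg k
  have hl : (0 : ℝ) ≤ l := Nat.cast_nonneg l
  have h0 : (0 : ℝ) ≤ s := Nat.cast_nonneg s
  rcases hs with ⟨-, h1, h2, h3, h4⟩ | ⟨-, h1, h2, h3, h4⟩ <;>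
    refine ⟨?_, ?_, ?_, ?_, ?_, ?_, ?_, ?_⟩ <;> linarith

end Zigzag

end SphericalPolygon
end

/-! ### Disjointness of the edges of the zigzag polygon. -/

noncomputable section
namespace SphericalPolygon

theorem ConeDisjoint.swap_right {a b c d : V} (h : ConeDisjoint a b c d) :
    ConeDisjoint a b d c := h.symm.swap_left.symm

theorem coneDisjoint_steep {N p q p' q' : ℝ} (h : p < p' ∧ q < q' ∨ p' < p ∧ q' < q)
    (h2 : p < q' + N) (h3 : p' < q + N) :
    ConeDisjoint (topPt p) (botPt N q) (topPt p') (botPt N q') := by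
  rcases h with ⟨h5, h6⟩ | ⟨h5, h6⟩
  · exact coneDisjoint_zigzag h5 h3 (by linarith)
  · exact (coneDisjoint_zigzag h5 h2 (by linarith)).symm

/-- The zigzag polygon does not intersect itself. -/
theorem coneDisjoint_zigzag_edges {k l s s' : ℕ} (hss : s + 1 < s') (hs' : s' < 2 * (k + l + 2))
    (h0 : ¬(s = 0 ∧ s' + 1 = 2 * (k + l + 2))) :
    ConeDisjoint (zigzag k l s) (zigzag k l (s + 1)) (zigzag k l s')
      (zigzag k l (if s' + 1 = 2 * (k + l + 2) then 0 else s' + 1)) := by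
  have hk : (0 : ℝ) ≤ k := Nat.cast_nonneg k
  have hl : (0 : ℝ) ≤ l := Nat.cast_nonneg l
  have hsr : (0 : ℝ) ≤ s := Nat.cast_nonneg s
  have tt : zigzag k l (2 * k + 1) = topPt (2 * k + 1) ∧
      zigzag k l (2 * k + 1 + 1) = topPt (4 * (k + l + 2) - (2 * k + 2)) := by
    rw [zigzag_top_left (by omega) (by simp), zigzag_top_right (by omega) (by simp [Nat.even_add_one])]
    push_cast
    refine ⟨rfl, ?_⟩
    congr 1; ring
  split_ifs with hc
  · have c1 : zigzag k l s' = botPt (8 * (k + l + 2)) (2 * (k + l + 2) + 1) := by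
      obtain rfl : s' = 2 * (k + l + 1) + 1 := by omega
      rw [zigzag_bot_right (by omega) (by simp)]
      push_cast
      congr 1; ring
    have c2 : zigzag k l 0 = botPt (8 * (k + l + 2)) 0 := by
      rw [zigzag_bot_left (by omega) (by simp)]
      simp
    rw [c1, c2]
    by_cases h : s = 2 * k + 1
    · subst h
      rw [tt.1, tt.2]
      refine coneDisjoint_opposite ?_ ?_ ?_ <;> linarith
    · obtain ⟨p, q, ho, hb⟩ := zigzag_steep (k := k) l h
      have hb2 := zigzag_bounds (l := l) (by omega) hb
      -- A steep edge not adjacent to the closing edge has a lower vertex different from both ends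
      -- of the closing edge.
      have hq0 : 0 < q ∧ q ≠ 2 * (k + l + 2) + 1 := by
        rcases hb with ⟨b0, b1, b2, b3, b4⟩ | ⟨b0, b1, b2, b3, b4⟩
        · have e1 : (1 : ℝ) ≤ s := by exact_mod_cast (by omega : 1 ≤ s)
          have e2 : (s + 1 : ℝ) ≤ 2 * k + 1 := by exact_mod_cast (by omega : s + 1 ≤ 2 * k + 1)
          refine ⟨by linarith, ne_of_lt (by linarith)⟩
        · have e2 : (s + 3 : ℝ) ≤ 2 * (k + l + 2) := by
            exact_mod_cast (by omega : s + 3 ≤ 2 * (k + l + 2))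
          refine ⟨by linarith, ne_of_gt (by linarith)⟩
      have main : ConeDisjoint (topPt p) (botPt (8 * (k + l + 2)) q)
          (botPt (8 * (k + l + 2)) 0) (botPt (8 * (k + l + 2)) (2 * (k + l + 2) + 1)) := by
        refine coneDisjoint_bottom ?_ ?_ ?_ ?_ ?_
        · linarith
        · linarith
        · linarith
        · intro e; linarith
        · intro e; exact hq0.2 (by linarith)
      rcases ho with ⟨o1, o2⟩ | ⟨o1, o2⟩ <;> rw [o1, o2]
      · exact main.swap_right
      · exact main.swap_right.swap_left
  · by_cases h : s = 2 * k + 1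
    · subst h
      rw [tt.1, tt.2]
      obtain ⟨p, q, ho, hb⟩ := zigzag_steep (k := k) (s := s') l (by omega)
      have hb2 := zigzag_bounds (l := l) (by omega) hb
      have hp : (2 * k + 1 : ℝ) < p ∧ p < 4 * (k + l + 2) - (2 * k + 2) := by
        rcases hb with ⟨b0, b1, b2, b3, b4⟩ | ⟨b0, b1, b2, b3, b4⟩
        · omega
        · have e1 : (2 * k + 3 : ℝ) ≤ s' := by exact_mod_cast (by omega : 2 * k + 3 ≤ s')
          have e2 : (s' + 2 : ℝ) ≤ 2 * (k + l + 2) := by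
            exact_mod_cast (by omega : s' + 2 ≤ 2 * (k + l + 2))
          constructor <;> linarith
      have main : ConeDisjoint (topPt (2 * k + 1)) (topPt (4 * (k + l + 2) - (2 * k + 2)))
          (topPt p) (botPt (8 * (k + l + 2)) q) := by
        refine coneDisjoint_top ?_ ?_ ?_ ?_ ?_
        · linarith
        · linarith
        · linarith
        · exact hp.1.ne'
        · exact hp.2.ne
      rcases ho with ⟨o1, o2⟩ | ⟨o1, o2⟩ <;> rw [o1, o2]
      · exact main
      · exact main.swap_right
    · obtain ⟨p, q, ho, hb⟩ := zigzag_steep (k := k) l h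
      have hb2 := zigzag_bounds (l := l) (by omega) hb
      by_cases h' : s' = 2 * k + 1
      · subst h'
        rw [tt.1, tt.2]
        have hp : p < 2 * k + 1 := by
          rcases hb with ⟨b0, b1, b2, b3, b4⟩ | ⟨b0, b1, b2, b3, b4⟩
          · have e1 : (s + 2 : ℝ) ≤ 2 * k + 1 := by exact_mod_cast (by omega : s + 2 ≤ 2 * k + 1)
            linarith
          · omega
        have main : ConeDisjoint (topPt (2 * k + 1)) (topPt (4 * (k + l + 2) - (2 * k + 2)))
            (topPt p) (botPt (8 * (k + l + 2)) q) := by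
          refine coneDisjoint_top ?_ ?_ ?_ ?_ ?_
          · linarith
          · linarith
          · linarith
          · exact hp.ne
          · exact ne_of_lt (by linarith)
        rcases ho with ⟨o1, o2⟩ | ⟨o1, o2⟩ <;> rw [o1, o2]
        · exact main.symm
        · exact main.symm.swap_left
      · obtain ⟨p', q', ho', hb'⟩ := zigzag_steep (k := k) (s := s') l h'
        have hb2' := zigzag_bounds (l := l) (by omega) hb'
        have e0 : (s + 2 : ℝ) ≤ s' := by exact_mod_cast (by omega : s + 2 ≤ s')
        have e2 : (s' + 2 : ℝ) ≤ 2 * (k + l + 2) := by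
          exact_mod_cast (by omega : s' + 2 ≤ 2 * (k + l + 2))
        -- Parameters increase along the left waves and decrease along the right ones, and the left
        -- waves precede the right ones. Two steep edges are thus ordered in the same way above and
        -- below.
        have ord : p < p' ∧ q < q' ∨ p' < p ∧ q' < q := by
          rcases hb with ⟨b0, b1, b2, b3, b4⟩ | ⟨b0, b1, b2, b3, b4⟩
          · have e1 : (s + 1 : ℝ) ≤ 2 * k + 1 := by exact_mod_cast (by omega : s + 1 ≤ 2 * k + 1)
            rcases hb' with ⟨c0, c1, c2, c3, c4⟩ | ⟨c0, c1, c2, c3, c4⟩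
            · left; constructor <;> linarith
            · left; constructor <;> linarith
          · rcases hb' with ⟨c0, c1, c2, c3, c4⟩ | ⟨c0, c1, c2, c3, c4⟩
            · omega
            · right; constructor <;> linarith
        have main := coneDisjoint_steep (N := 8 * (k + l + 2)) ord (by linarith) (by linarith)
        rcases ho with ⟨o1, o2⟩ | ⟨o1, o2⟩ <;> rcases ho' with ⟨o1', o2'⟩ | ⟨o1', o2'⟩ <;>
          rw [o1, o2, o1', o2']
        · exact main
        · exact main.swap_right
        · exact main.swap_left
        · exact main.swap_left.swap_right

/-- The parameter on the moment curve of a vertex of the zigzag polygon. -/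
theorem zigzag_eq (k l s : ℕ) : ∃ (ε : ℝ) (t : ℝ), (ε = 1 ∨ ε = -1) ∧
    zigzag k l s = ε • momentPt t ∧
    ((ε = 1 ∧ s < 2 * (k + 1) ∧ t = s) ∨ (ε = -1 ∧ s < 2 * (k + 1) ∧ t = s + 8 * (k + l + 2)) ∨
      (ε = 1 ∧ 2 * (k + 1) ≤ s ∧ t = 4 * (k + l + 2) - s) ∨
      (ε = -1 ∧ 2 * (k + 1) ≤ s ∧ t = 4 * (k + l + 2) - s + 8 * (k + l + 2))) := by
  rcases Nat.lt_or_ge s (2 * (k + 1)) with h | h <;> by_cases he : Even s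
  · exact ⟨-1, _, Or.inr rfl, by rw [zigzag_bot_left h he, botPt, neg_one_smul], by tauto⟩
  · exact ⟨1, _, Or.inl rfl, by rw [zigzag_top_left h he, topPt, one_smul], by tauto⟩
  · exact ⟨1, _, Or.inl rfl, by rw [zigzag_top_right h he, topPt, one_smul], by tauto⟩
  · exact ⟨-1, _, Or.inr rfl, by rw [zigzag_bot_right h he, botPt, neg_one_smul], by tauto⟩

end SphericalPolygon
end

/-! ### The zigzag polygon on the sphere. -/

noncomputable section
namespace SphericalPolygon

instance neZero_zigzag (k l : ℕ) : NeZero (2 * (k + l + 2)) := ⟨by omega⟩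

theorem isFrame_standard : IsFrame !₂[0, 1, 0] !₂[0, 0, 1] !₂[1, 0, 0] := by
  constructor <;> first
    | (rw [inner_eq]; simp)
    | (apply ext_E3 <;> simp [cross_zero, cross_one, cross_two])

/-- The vector with given coordinates in the frame that starts with the second basis vector. -/
def ofCoords (v : V) : E3 := !₂[v.2, v.1.re, v.1.im]

theorem coords_ofCoords (v : V) :
    coords !₂[0, 1, 0] !₂[0, 0, 1] !₂[1, 0, 0] (ofCoords v) = v := by
  apply Prod.ext
  · apply Complex.ext
    · rw [coords_re, inner_eq]; simp [ofCoords]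
    · rw [coords_im, inner_eq]; simp [ofCoords]
  · rw [coords_snd, inner_eq]; simp [ofCoords]

/-- The radial projection of a vector to the sphere; the zero vector is sent to a pole. -/
def toSphere (x : E3) : S2 :=
  if h : x = 0 then ⟨!₂[1, 0, 0], by
    rw [mem_sphere_zero_iff_norm, EuclideanSpace.norm_eq]; simp [Fin.sum_univ_three]⟩
  else ⟨‖x‖⁻¹ • x, by
    rw [mem_sphere_zero_iff_norm, norm_smul, norm_inv, norm_norm,
      inv_mul_cancel₀ (norm_ne_zero_iff.2 h)]⟩

theorem coords_toSphere {v : V} (hv : v ≠ 0) : ∃ r : ℝ, 0 < r ∧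
    coords !₂[0, 1, 0] !₂[0, 0, 1] !₂[1, 0, 0] (toSphere (ofCoords v)) = r • v := by
  have h : ofCoords v ≠ 0 := by
    intro h
    have := coords_ofCoords v
    rw [h, map_zero] at this
    exact hv this.symm
  refine ⟨‖ofCoords v‖⁻¹, inv_pos.2 (norm_pos_iff.2 h), ?_⟩
  rw [toSphere, dif_neg h]
  simp only
  rw [map_smul, coords_ofCoords]

/-- The spherical zigzag polygon. -/
def zigzagPolygon (k l : ℕ) (i : Fin (2 * (k + l + 2))) : S2 := toSphere (ofCoords (zigzag k l i))

/-- The pole with respect to which the zigzag polygon is considered. -/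
def pole : S2 := ⟨!₂[1, 0, 0], by
  rw [mem_sphere_zero_iff_norm, EuclideanSpace.norm_eq]; simp [Fin.sum_univ_three]⟩

theorem momentPt_ne_zero (t : ℝ) : momentPt t ≠ 0 := by
  intro h
  have := congrArg (fun v : V => v.2) h
  simp [momentPt] at this

section Zigzag
variable (k l : ℕ)

/-- The coordinates of the vertices of the spherical zigzag polygon. -/
def zigzagLift : ℕ → V := lift !₂[0, 1, 0] !₂[0, 0, 1] (pole : E3) (zigzagPolygon k l)

theorem coords_zigzagPolygon (i : Fin (2 * (k + l + 2))) : ∃ r : ℝ, 0 < r ∧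
    coords !₂[0, 1, 0] !₂[0, 0, 1] (pole : E3) (zigzagPolygon k l i) = r • zigzag k l i := by
  refine coords_toSphere ?_
  obtain ⟨ε, t, hε, h, -⟩ := zigzag_eq k l i
  rw [h]
  refine smul_ne_zero ?_ (momentPt_ne_zero t)
  rcases hε with rfl | rfl <;> norm_num

theorem zigzagLift_eq {s : ℕ} (hs : s < 2 * (k + l + 2)) : ∃ r : ℝ, 0 < r ∧
    zigzagLift k l s = r • zigzag k l s := by
  obtain ⟨r, hr, h⟩ := coords_zigzagPolygon k l (ix _ s)
  refine ⟨r, hr, ?_⟩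
  rw [zigzagLift, lift, h]
  simp only [ix, Nat.mod_eq_of_lt hs]

theorem inGeneralPosition_zigzagPolygon : InGeneralPosition (zigzagPolygon k l) := by
  intro i j m hij hjm him
  rw [← (isFrame_standard).det_ne_zero_iff]
  obtain ⟨r, hr, h⟩ := coords_zigzagPolygon k l i
  obtain ⟨r', hr', h'⟩ := coords_zigzagPolygon k l j
  obtain ⟨r'', hr'', h''⟩ := coords_zigzagPolygon k l m
  -- The parameters are rewritten as casts of natural numbers, so that their distinctness becomes
  -- integer arithmetic.
  have par : ∀ i : Fin (2 * (k + l + 2)), ∃ ε t : ℝ, ε ≠ 0 ∧ zigzag k l i = ε • momentPt t ∧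
      (((i : ℕ) < 2 * (k + 1) ∧ t = (i : ℕ)) ∨
        ((i : ℕ) < 2 * (k + 1) ∧ t = ((i : ℕ) + 8 * (k + l + 2) : ℕ)) ∨
      (2 * (k + 1) ≤ (i : ℕ) ∧ t = (4 * (k + l + 2) - i : ℕ)) ∨
      (2 * (k + 1) ≤ (i : ℕ) ∧ t = (4 * (k + l + 2) - i + 8 * (k + l + 2) : ℕ))) := by
    intro i
    have hi := i.isLt
    obtain ⟨ε, t, hε, h, ht⟩ := zigzag_eq k l i
    refine ⟨ε, t, by rcases hε with rfl | rfl <;> norm_num, h, ?_⟩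
    push_cast [Nat.cast_sub (by omega : (i : ℕ) ≤ 4 * (k + l + 2))]
    tauto
  have ne : ∀ i j : Fin (2 * (k + l + 2)), i ≠ j → ∀ t t' : ℝ,
      (((i : ℕ) < 2 * (k + 1) ∧ t = (i : ℕ)) ∨
        ((i : ℕ) < 2 * (k + 1) ∧ t = ((i : ℕ) + 8 * (k + l + 2) : ℕ)) ∨
      (2 * (k + 1) ≤ (i : ℕ) ∧ t = (4 * (k + l + 2) - i : ℕ)) ∨
      (2 * (k + 1) ≤ (i : ℕ) ∧ t = (4 * (k + l + 2) - i + 8 * (k + l + 2) : ℕ))) →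
      (((j : ℕ) < 2 * (k + 1) ∧ t' = (j : ℕ)) ∨
        ((j : ℕ) < 2 * (k + 1) ∧ t' = ((j : ℕ) + 8 * (k + l + 2) : ℕ)) ∨
      (2 * (k + 1) ≤ (j : ℕ) ∧ t' = (4 * (k + l + 2) - j : ℕ)) ∨
      (2 * (k + 1) ≤ (j : ℕ) ∧ t' = (4 * (k + l + 2) - j + 8 * (k + l + 2) : ℕ))) → t' - t ≠ 0 := by
    intro i j hij t t' h h' e
    have hi := i.isLt
    have hj := j.isLt
    have hv : (i : ℕ) ≠ j := fun e => hij (Fin.ext e)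
    rcases h with ⟨a, rfl⟩ | ⟨a, rfl⟩ | ⟨a, rfl⟩ | ⟨a, rfl⟩ <;>
      rcases h' with ⟨b, rfl⟩ | ⟨b, rfl⟩ | ⟨b, rfl⟩ | ⟨b, rfl⟩ <;>
      (have := Nat.cast_injective (R := ℝ) (sub_eq_zero.1 e); omega)
  obtain ⟨ε, t, hε, g, ht⟩ := par i
  obtain ⟨ε', t', hε', g', ht'⟩ := par j
  obtain ⟨ε'', t'', hε'', g'', ht''⟩ := par m
  have h1 := ne i j hij t t' ht ht'
  have h2 := ne j m hjm t' t'' ht' ht''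
  have h3 := ne i m him t t'' ht ht''
  have hdet : ∀ (a b c : ℝ) (x y z : V), det3 (a • x) (b • y) (c • z) = a * b * c * det3 x y z := by
    intro a b c x y z
    simp [det3, wedge]
    ring
  have e := hdet (r * ε) (r' * ε') (r'' * ε'') (momentPt t) (momentPt t') (momentPt t'')
  rw [det3_momentPt, mul_smul, mul_smul, mul_smul, ← g, ← g', ← g'', ← h, ← h', ← h''] at e
  change det3 _ _ _ = _ at e
  have hne : r * ε * (r' * ε') * (r'' * ε'') * ((t' - t) * (t'' - t') * (t'' - t)) ≠ 0 := by
    have := hr.ne'; have := hr'.ne'; have := hr''.ne'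
    positivity
  rw [← e] at hne
  exact hne

theorem isSimple_zigzagPolygon : IsSimple (zigzagPolygon k l) := by
  refine isSimple_of_coneDisjoint isFrame_standard (by omega)
    (inGeneralPosition_zigzagPolygon k l) fun i j hij h1 h2 => ?_
  obtain ⟨ri, hri, ei⟩ := coords_zigzagPolygon k l i
  obtain ⟨ri', hri', ei'⟩ := coords_zigzagPolygon k l (i + 1)
  obtain ⟨rj, hrj, ej⟩ := coords_zigzagPolygon k l j
  obtain ⟨rj', hrj', ej'⟩ := coords_zigzagPolygon k l (j + 1)
  have hi := i.isLt
  have hj := j.isLt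
  have hij' : (i : ℕ) < j := hij
  have succ : ∀ i : Fin (2 * (k + l + 2)),
      ((i + 1 : Fin (2 * (k + l + 2))) : ℕ) = if (i : ℕ) + 1 = 2 * (k + l + 2) then 0 else (i : ℕ) + 1 := by
    intro i
    have hi := i.isLt
    rw [Fin.val_add, Fin.val_one', Nat.mod_eq_of_lt (by omega : 1 < 2 * (k + l + 2))]
    split_ifs with h
    · rw [h, Nat.mod_self]
    · exact Nat.mod_eq_of_lt (by omega)
  have hi1 : ((i + 1 : Fin (2 * (k + l + 2))) : ℕ) = i + 1 := by rw [succ, if_neg (by omega)]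
  have n1 : (j : ℕ) ≠ i + 1 := fun e => h1 (Fin.ext (by rw [hi1, e]))
  have n2 : ¬((i : ℕ) = 0 ∧ (j : ℕ) + 1 = 2 * (k + l + 2)) := by
    rintro ⟨a, b⟩
    exact h2 (Fin.ext (by rw [succ, if_pos b, a]))
  have key := (coneDisjoint_zigzag_edges (k := k) (l := l) (by omega : (i : ℕ) + 1 < j) hj n2).smul
    hri hri' hrj hrj'
  rw [← succ, ← hi1, ← ei, ← ei', ← ej, ← ej'] at key
  exact key

theorem isGeneral_zigzagPolygon : IsGeneral (zigzagPolygon k l) pole := by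
  intro i
  obtain ⟨r, hr, h⟩ := coords_zigzagPolygon k l i
  obtain ⟨ε, t, hε, g, -⟩ := zigzag_eq k l i
  rw [← coords_snd !₂[0, 1, 0] !₂[0, 0, 1], h, g]
  rcases hε with rfl | rfl <;> simp [momentPt, hr.ne']

end Zigzag

end SphericalPolygon
end

/-! ### Index and normal degree of the zigzag polygon. -/

noncomputable section
namespace SphericalPolygon

theorem secant_momentPt (r r' t t' : ℝ) : secant (r • momentPt t) (r' • momentPt t') =
    ⟨r * r' * (t' - t), r * r' * (t' - t) * (t + t')⟩ := by
  apply Complex.ext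
  · simp [secant, momentPt]; ring
  · simp [secant, momentPt, pow_two]; ring

/-- A secant of scaled points of the curve is a real factor times `1 + (t + t') i`. For positive
parameters its imaginary part has the sign of that factor, so crossings can be read off from the
order of the parameters and the signs of the scalars. -/
theorem crossing_momentPt {r r' r'' t t' t'' : ℝ} (ht : 0 < t) (ht' : 0 < t') (ht'' : 0 < t'') :
    crossing (secant (r • momentPt t) (r' • momentPt t'))
      (secant (r' • momentPt t') (r'' • momentPt t'')) =
    if 0 < r * r' * (t' - t) ∧ r' * r'' * (t'' - t') < 0 ∧ t'' < t then 1
    else if r * r' * (t' - t) < 0 ∧ 0 < r' * r'' * (t'' - t') ∧ t < t'' then -1 else 0 := by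
  have w : ∀ c c' : ℝ, wedge ⟨c, c * (t + t')⟩ ⟨c', c' * (t' + t'')⟩ = c * c' * (t'' - t) := by
    intro c c'
    simp only [wedge]
    ring
  rw [secant_momentPt, secant_momentPt]
  generalize r * r' * (t' - t) = c
  generalize r' * r'' * (t'' - t') = c'
  unfold crossing
  rw [w]
  have neg_iff : ∀ c s : ℝ, 0 < s → (c * s < 0 ↔ c < 0) := fun c s hs =>
    ⟨fun h => neg_of_mul_neg_left h hs.le, fun h => mul_neg_of_neg_of_pos h hs⟩
  simp only [mul_pos_iff_of_pos_right (add_pos ht ht'), mul_pos_iff_of_pos_right (add_pos ht' ht''),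
    neg_iff c _ (add_pos ht ht'), neg_iff c' _ (add_pos ht' ht'')]
  have e1 : (0 < c ∧ c' < 0 ∧ 0 < c * c' * (t'' - t)) ↔ (0 < c ∧ c' < 0 ∧ t'' < t) := by
    refine and_congr_right fun h => and_congr_right fun h' => ?_
    have := mul_neg_of_pos_of_neg h h'
    constructor <;> intro <;> nlinarith
  have e2 : (c < 0 ∧ 0 < c' ∧ c * c' * (t'' - t) < 0) ↔ (c < 0 ∧ 0 < c' ∧ t < t'') := by
    refine and_congr_right fun h => and_congr_right fun h' => ?_
    have := mul_neg_of_neg_of_pos h h'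
    constructor <;> intro <;> nlinarith
  simp only [e1, e2]

theorem sum_range_two_mul {A : Type*} [AddCommMonoid A] (g : ℕ → A) (m : ℕ) :
    ∑ s ∈ Finset.range (2 * m), g s = ∑ j ∈ Finset.range m, (g (2 * j) + g (2 * j + 1)) := by
  induction m with
  | zero => simp
  | succ m ih =>
    rw [Finset.sum_range_succ, ← ih, mul_add, mul_one, Finset.sum_range_succ,
      Finset.sum_range_succ, add_assoc]

/-- A sum over two blocks, each of which has an exceptional last element. -/
theorem sum_range_blocks (k l : ℕ) (g : ℕ → ℤ) {a b c d : ℤ} (ha : ∀ j < k, g j = a)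
    (hb : g k = b) (hc : ∀ j, k < j → j < k + l + 1 → g j = c) (hd : g (k + l + 1) = d) :
    ∑ j ∈ Finset.range (k + l + 2), g j = k * a + b + l * c + d := by
  rw [Finset.sum_range_succ, hd, show k + l + 1 = k + 1 + l by omega, Finset.sum_range_add,
    Finset.sum_range_succ, hb, Finset.sum_congr rfl fun j hj => ha j (Finset.mem_range.1 hj),
    Finset.sum_congr rfl fun j hj => hc (k + 1 + j) (by omega)
      (by have := Finset.mem_range.1 hj; omega)]
  simp

section Zigzag
variable (k l : ℕ)

theorem zigzagLift_periodic (s : ℕ) : zigzagLift k l (s + 2 * (k + l + 2)) = zigzagLift k l s := by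
  unfold zigzagLift lift
  rw [ix_add_self]

theorem zigzagLift_bot_left {j : ℕ} (hj : j < k + 1) : ∃ r : ℝ, r < 0 ∧
    zigzagLift k l (2 * j) = r • momentPt (2 * j + 8 * (k + l + 2)) := by
  obtain ⟨r, hr, h⟩ := zigzagLift_eq k l (s := 2 * j) (by omega)
  refine ⟨-r, by linarith, ?_⟩
  rw [h, zigzag_bot_left (by omega) (by simp), botPt, smul_neg, neg_smul]
  push_cast
  rfl

theorem zigzagLift_top_left {j : ℕ} (hj : j < k + 1) : ∃ r : ℝ, 0 < r ∧
    zigzagLift k l (2 * j + 1) = r • momentPt (2 * j + 1) := by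
  obtain ⟨r, hr, h⟩ := zigzagLift_eq k l (s := 2 * j + 1) (by omega)
  refine ⟨r, hr, ?_⟩
  rw [h, zigzag_top_left (by omega) (by simp), topPt]
  push_cast
  rfl

theorem zigzagLift_top_right {j : ℕ} (hj : k < j) (hj' : j < k + l + 2) : ∃ r : ℝ, 0 < r ∧
    zigzagLift k l (2 * j) = r • momentPt (4 * (k + l + 2) - 2 * j) := by
  obtain ⟨r, hr, h⟩ := zigzagLift_eq k l (s := 2 * j) (by omega)
  refine ⟨r, hr, ?_⟩
  rw [h, zigzag_top_right (by omega) (by simp), topPt]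
  push_cast
  rfl

theorem zigzagLift_bot_right {j : ℕ} (hj : k < j) (hj' : j < k + l + 2) : ∃ r : ℝ, r < 0 ∧
    zigzagLift k l (2 * j + 1) = r • momentPt (12 * (k + l + 2) - 2 * j - 1) := by
  obtain ⟨r, hr, h⟩ := zigzagLift_eq k l (s := 2 * j + 1) (by omega)
  refine ⟨-r, by linarith, ?_⟩
  rw [h, zigzag_bot_right (by omega) (by simp), botPt, smul_neg, neg_smul]
  push_cast
  congr 3
  ring

theorem exists_zigzagLift_eq (s : ℕ) : ∃ r t : ℝ, 0 < t ∧ zigzagLift k l s = r • momentPt t := by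
  have main : ∀ j, j < k + l + 2 → (∃ r t : ℝ, 0 < t ∧ zigzagLift k l (2 * j) = r • momentPt t) ∧
      ∃ r t : ℝ, 0 < t ∧ zigzagLift k l (2 * j + 1) = r • momentPt t := by
    intro j hj
    have h0 : (j : ℝ) < k + l + 2 := by exact_mod_cast hj
    rcases Nat.lt_or_ge k j with h | h
    · obtain ⟨r, -, e⟩ := zigzagLift_top_right k l h hj
      obtain ⟨r', -, e'⟩ := zigzagLift_bot_right k l h hj
      exact ⟨⟨r, _, by linarith, e⟩, r', _, by linarith, e'⟩
    · obtain ⟨r, -, e⟩ := zigzagLift_bot_left k l (j := j) (by omega)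
      obtain ⟨r', -, e'⟩ := zigzagLift_top_left k l (j := j) (by omega)
      exact ⟨⟨r, _, by positivity, e⟩, r', _, by positivity, e'⟩
  have e : zigzagLift k l s = zigzagLift k l (s % (2 * (k + l + 2))) := by
    unfold zigzagLift lift ix
    simp only [Nat.mod_mod]
  have hlt := Nat.mod_lt s (by omega : 0 < 2 * (k + l + 2))
  rw [e]
  rcases Nat.even_or_odd' (s % (2 * (k + l + 2))) with ⟨j, hj | hj⟩ <;> rw [hj] <;> rw [hj] at hlt
  · exact (main j (by omega)).1
  · exact (main j (by omega)).2

/-- The vertices on both sides of the closing edge. -/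
theorem zigzagLift_close : zigzagLift k l (2 * (k + l + 1) + 2) = zigzagLift k l (2 * 0) ∧
    zigzagLift k l (2 * (k + l + 1) + 3) = zigzagLift k l (2 * 0 + 1) := by
  rw [← zigzagLift_periodic k l (2 * 0), ← zigzagLift_periodic k l (2 * 0 + 1)]
  exact ⟨by congr 1; omega, by congr 1; omega⟩

/-- Vertices are taken in pairs. Each of the first `k + 1` pairs starts with a rise, each of the
next `l` is followed by one, and the last pair leads into the closing edge below. -/
theorem ups_zigzagLift : ups (zigzagLift k l) (2 * (k + l + 2)) = k + l + 1 := by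
  have snd : ∀ r t : ℝ, (r • momentPt t).2 = r := fun r t => by simp [momentPt]
  unfold ups
  rw [sum_range_two_mul, sum_range_blocks k l _ (a := 1) (b := 1) (c := 1) (d := 0)]
  · ring
  · intro j hj
    obtain ⟨r, hr, e⟩ := zigzagLift_bot_left k l (j := j) (by omega)
    obtain ⟨r', hr', e'⟩ := zigzagLift_top_left k l (j := j) (by omega)
    rw [e, e', snd, snd, if_pos ⟨hr.le, hr'⟩, if_neg (fun h => absurd h.1 hr'.not_ge)]
    rfl
  · obtain ⟨r, hr, e⟩ := zigzagLift_bot_left k l (j := k) (by omega)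
    obtain ⟨r', hr', e'⟩ := zigzagLift_top_left k l (j := k) (by omega)
    rw [e, e', snd, snd, if_pos ⟨hr.le, hr'⟩, if_neg (fun h => absurd h.1 hr'.not_ge)]
    rfl
  · intro j hj hj'
    obtain ⟨r, hr, e⟩ := zigzagLift_top_right k l (j := j) (by omega) (by omega)
    obtain ⟨r', hr', e'⟩ := zigzagLift_bot_right k l (j := j) (by omega) (by omega)
    obtain ⟨r'', hr'', e''⟩ := zigzagLift_top_right k l (j := j + 1) (by omega) (by omega)
    rw [show 2 * (j + 1) = 2 * j + 1 + 1 by omega] at e''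
    rw [e, e', e'', snd, snd, snd, if_neg (fun h => absurd h.1 hr.not_ge), if_pos ⟨hr'.le, hr''⟩]
    rfl
  · obtain ⟨r, hr, e⟩ := zigzagLift_top_right k l (j := k + l + 1) (by omega) (by omega)
    obtain ⟨r', hr', e'⟩ := zigzagLift_bot_right k l (j := k + l + 1) (by omega) (by omega)
    obtain ⟨r'', hr'', e''⟩ := zigzagLift_bot_left k l (j := 0) (by omega)
    rw [← (zigzagLift_close k l).1] at e''
    rw [e, e', e'', snd, snd, snd, if_neg (fun h => absurd h.1 hr.not_ge),
      if_neg (fun h => absurd h.2 hr''.not_gt)]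
    rfl

/-- Only the second triple of a pair can contribute: `-1` at the lower turning point of a left wave,
`+1` at the upper turning point of a right wave. The pairs at the top edge and at the closing edge
contribute nothing. -/
theorem sum_crossing_zigzagLift : ∑ s ∈ Finset.range (2 * (k + l + 2)),
    crossing (secant (zigzagLift k l s) (zigzagLift k l (s + 1)))
      (secant (zigzagLift k l (s + 1)) (zigzagLift k l (s + 2))) = l - k := by
  have hk : (0 : ℝ) ≤ k := Nat.cast_nonneg k
  have hl : (0 : ℝ) ≤ l := Nat.cast_nonneg l
  rw [sum_range_two_mul, sum_range_blocks k l _ (a := -1) (b := 0) (c := 1) (d := 0)]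
  · ring
  · intro j hj
    have hj0 : (0 : ℝ) ≤ j := Nat.cast_nonneg j
    have hj1 : (j + 1 : ℝ) ≤ k := by exact_mod_cast hj
    obtain ⟨r, hr, e⟩ := zigzagLift_bot_left k l (j := j) (by omega)
    obtain ⟨r', hr', e'⟩ := zigzagLift_top_left k l (j := j) (by omega)
    obtain ⟨r'', hr'', e''⟩ := zigzagLift_bot_left k l (j := j + 1) (by omega)
    obtain ⟨r₃, hr₃, e₃⟩ := zigzagLift_top_left k l (j := j + 1) (by omega)
    rw [show 2 * (j + 1) = 2 * j + 2 by omega] at e''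
    rw [show 2 * (j + 1) + 1 = 2 * j + 1 + 2 by omega] at e₃
    push_cast at e'' e₃
    rw [e, e', e'', e₃,
      crossing_momentPt (by positivity) (by positivity) (by positivity),
      crossing_momentPt (by positivity) (by positivity) (by positivity),
      if_neg (fun h => absurd h.2.2 (by linarith)),
      if_neg (fun h => absurd h.1 (not_lt.2 (mul_nonneg_of_nonpos_of_nonpos
        (mul_neg_of_neg_of_pos hr hr').le (by linarith)))),
      if_neg (fun h => absurd h.2.2 (by linarith)),
      if_pos ⟨mul_neg_of_neg_of_pos (mul_neg_of_pos_of_neg hr' hr'') (by linarith),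
        mul_pos_of_neg_of_neg (mul_neg_of_neg_of_pos hr'' hr₃) (by linarith), by linarith⟩]
    rfl
  · obtain ⟨r, hr, e⟩ := zigzagLift_bot_left k l (j := k) (by omega)
    obtain ⟨r', hr', e'⟩ := zigzagLift_top_left k l (j := k) (by omega)
    obtain ⟨r'', hr'', e''⟩ := zigzagLift_top_right k l (j := k + 1) (by omega) (by omega)
    obtain ⟨r₃, hr₃, e₃⟩ := zigzagLift_bot_right k l (j := k + 1) (by omega) (by omega)
    rw [show 2 * (k + 1) = 2 * k + 2 by omega] at e''
    rw [show 2 * (k + 1) + 1 = 2 * k + 1 + 2 by omega] at e₃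
    push_cast at e'' e₃
    have p₂ : (0 : ℝ) < 4 * (k + l + 2) - 2 * (k + 1) := by linarith
    have p₃ : (0 : ℝ) < 12 * (k + l + 2) - 2 * (k + 1) - 1 := by linarith
    rw [e, e', e'', e₃,
      crossing_momentPt (by positivity) (by positivity) p₂,
      crossing_momentPt (by positivity) p₂ p₃,
      if_neg (fun h => absurd h.2.1 (not_lt.2 (mul_pos (mul_pos hr' hr'') (by linarith)).le)),
      if_neg (fun h => absurd h.1 (not_lt.2 (mul_nonneg_of_nonpos_of_nonpos
        (mul_neg_of_neg_of_pos hr hr').le (by linarith)))),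
      if_neg (fun h => absurd h.2.2 (by linarith)),
      if_neg (fun h => absurd h.1 (not_lt.2 (mul_pos (mul_pos hr' hr'') (by linarith)).le))]
    rfl
  · intro j hj hj'
    have h1 : (k + 1 : ℝ) ≤ j := by exact_mod_cast hj
    have h2 : (j + 1 : ℝ) ≤ k + l + 1 := by exact_mod_cast hj'
    obtain ⟨r, hr, e⟩ := zigzagLift_top_right k l (j := j) (by omega) (by omega)
    obtain ⟨r', hr', e'⟩ := zigzagLift_bot_right k l (j := j) (by omega) (by omega)
    obtain ⟨r'', hr'', e''⟩ := zigzagLift_top_right k l (j := j + 1) (by omega) (by omega)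
    obtain ⟨r₃, hr₃, e₃⟩ := zigzagLift_bot_right k l (j := j + 1) (by omega) (by omega)
    rw [show 2 * (j + 1) = 2 * j + 2 by omega] at e''
    rw [show 2 * (j + 1) + 1 = 2 * j + 1 + 2 by omega] at e₃
    push_cast at e'' e₃
    have p₀ : (0 : ℝ) < 4 * (k + l + 2) - 2 * j := by linarith
    have p₁ : (0 : ℝ) < 12 * (k + l + 2) - 2 * j - 1 := by linarith
    have p₂ : (0 : ℝ) < 4 * (k + l + 2) - 2 * (j + 1) := by linarith
    have p₃ : (0 : ℝ) < 12 * (k + l + 2) - 2 * (j + 1) - 1 := by linarith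
    rw [e, e', e'', e₃,
      crossing_momentPt p₀ p₁ p₂, crossing_momentPt p₁ p₂ p₃,
      if_neg (fun h => absurd h.1 (not_lt.2 (mul_neg_of_neg_of_pos
        (mul_neg_of_pos_of_neg hr hr') (by linarith)).le)),
      if_neg (fun h => absurd h.2.2 (by linarith)),
      if_pos ⟨mul_pos_of_neg_of_neg (mul_neg_of_neg_of_pos hr' hr'') (by linarith),
        mul_neg_of_neg_of_pos (mul_neg_of_pos_of_neg hr'' hr₃) (by linarith), by linarith⟩]
    rfl
  · obtain ⟨r, hr, e⟩ := zigzagLift_top_right k l (j := k + l + 1) (by omega) (by omega)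
    obtain ⟨r', hr', e'⟩ := zigzagLift_bot_right k l (j := k + l + 1) (by omega) (by omega)
    obtain ⟨r'', hr'', e''⟩ := zigzagLift_bot_left k l (j := 0) (by omega)
    obtain ⟨r₃, hr₃, e₃⟩ := zigzagLift_top_left k l (j := 0) (by omega)
    rw [← (zigzagLift_close k l).1] at e''
    rw [← (zigzagLift_close k l).2] at e₃
    push_cast at e e' e'' e₃
    have p₀ : (0 : ℝ) < 4 * (k + l + 2) - 2 * (k + l + 1) := by linarith
    have p₁ : (0 : ℝ) < 12 * (k + l + 2) - 2 * (k + l + 1) - 1 := by linarith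
    have p₂ : (0 : ℝ) < 2 * 0 + 8 * (k + l + 2) := by linarith
    rw [e, e', e'', e₃,
      crossing_momentPt p₀ p₁ p₂, crossing_momentPt p₁ p₂ (by norm_num),
      if_neg (fun h => absurd h.1 (not_lt.2 (mul_neg_of_neg_of_pos
        (mul_neg_of_pos_of_neg hr hr') (by linarith)).le)),
      if_neg (fun h => absurd h.2.1 (not_lt.2 (mul_neg_of_pos_of_neg
        (mul_pos_of_neg_of_neg hr' hr'') (by linarith)).le)),
      if_neg (fun h => absurd h.1 (not_lt.2 (mul_neg_of_pos_of_neg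
        (mul_pos_of_neg_of_neg hr' hr'') (by linarith)).le)),
      if_neg (fun h => absurd h.2.2 (by linarith))]
    rfl

theorem isPolygon_zigzagLift : IsPolygon (2 * (k + l + 2)) (zigzagLift k l) :=
  isPolygon_lift isFrame_standard (by omega) (inGeneralPosition_zigzagPolygon k l)
    (isSimple_zigzagPolygon k l)

theorem admissible_zigzagLift : Admissible (zigzagLift k l) :=
  admissible_lift (isGeneral_zigzagPolygon k l).isAdmissible

theorem secant_zigzagLift_slit (s : ℕ) :
    secant (zigzagLift k l s) (zigzagLift k l (s + 1)) ∈ Complex.slitPlane := by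
  have h := ((isPolygon_zigzagLift k l).secant_slit (admissible_zigzagLift k l) s).1
  obtain ⟨r, t, ht, e⟩ := exists_zigzagLift_eq k l s
  obtain ⟨r', t', ht', e'⟩ := exists_zigzagLift_eq k l (s + 1)
  rw [e, e', secant_momentPt] at h ⊢
  refine slit_of_im_ne_zero fun h0 => h ?_
  have := (mul_eq_zero.1 h0).resolve_right (by positivity)
  rw [this, zero_mul]
  rfl

theorem index_zigzagPolygon : index (zigzagPolygon k l) pole = -(k + l) := by
  rw [index_eq (e₁ := !₂[0, 1, 0]) (e₂ := !₂[0, 0, 1])]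
  have := ups_zigzagLift k l
  unfold zigzagLift at this
  rw [this]
  ring

theorem hasNormalDegree_zigzagPolygon : HasNormalDegree (zigzagPolygon k l) pole (l - k) := by
  refine hasNormalDegree_of_partialTurn isFrame_standard (by omega)
    (inGeneralPosition_zigzagPolygon k l) (isSimple_zigzagPolygon k l)
    (isGeneral_zigzagPolygon k l).isAdmissible ?_
  have := partialTurn_eq_sum_crossing (zigzagLift_periodic k l) (secant_zigzagLift_slit k l)
    fun s => ((isPolygon_zigzagLift k l).secant_slit (admissible_zigzagLift k l) s).2
  rw [sum_crossing_zigzagLift] at this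
  exact this

end Zigzag

end SphericalPolygon
end

theorem proposition3 :
    (∀ (n : ℕ) [NeZero n] (W : Fin n → S2) (ξ : S2), 3 ≤ n →
      SphericalPolygon.InGeneralPosition W → SphericalPolygon.IsSimple W →
      SphericalPolygon.IsAdmissible W ξ →
        ∃ d : ℤ, SphericalPolygon.HasNormalDegree W ξ d ∧
          |d| ≤ |SphericalPolygon.index W ξ| ∧ Even (d - SphericalPolygon.index W ξ)) ∧
    (∀ i d : ℤ, i < 1 → |d| ≤ |i| → Even (d - i) →
      ∃ (n : ℕ) (_ : NeZero n) (W : Fin n → S2) (ξ : S2), 3 ≤ n ∧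
        SphericalPolygon.InGeneralPosition W ∧ SphericalPolygon.IsSimple W ∧
        SphericalPolygon.IsGeneral W ξ ∧
        SphericalPolygon.index W ξ = i ∧ SphericalPolygon.HasNormalDegree W ξ d) := by
  refine ⟨fun n _ W ξ hn hg hs ha => SphericalPolygon.exists_normalDegree W ξ hn hg hs ha,
    fun i d hi hd he => ?_⟩
  -- Solving `i = -(k + l)` and `d = l - k` gives `l` as half of `d - i` and `k = l - d`; both are
  -- nonnegative because `|d| ≤ -i`.
  obtain ⟨c, hc⟩ := he
  rw [abs_of_nonpos (by omega : i ≤ 0), abs_le] at hd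
  lift c to ℕ using by omega with l
  obtain ⟨k, hk⟩ := Int.eq_ofNat_of_zero_le (by omega : 0 ≤ l - d)
  obtain rfl : i = -(k + l) := by omega
  obtain rfl : d = l - k := by omega
  exact ⟨2 * (k + l + 2), SphericalPolygon.neZero_zigzag k l, SphericalPolygon.zigzagPolygon k l,
    SphericalPolygon.pole, by omega, SphericalPolygon.inGeneralPosition_zigzagPolygon k l,
    SphericalPolygon.isSimple_zigzagPolygon k l, SphericalPolygon.isGeneral_zigzagPolygon k l,
    SphericalPolygon.index_zigzagPolygon k l, SphericalPolygon.hasNormalDegree_zigzagPolygon k l⟩
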